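/- **Setting.** Let $K$ be a field, $C=(c_{ij})_{i,j\in Q_0}$ a symmetrizable generalized Cartan matrix over a finite set $Q_0$ ($c_{ii}=2$; $c_{ij}\le 0$ for $i\ne j$; $c_{ij}\neq0\iff c_{ji}\ne 0$), $D=\mathrm{diag}(c_i)$ with integers $c_i\ge1$ and $DC$ symmetric, and $\Omega\subset Q_0\times Q_0$ an acyclic orientation (one of $(i,j),(j,i)$ lies in $\Omega$ if and only if $c_{ij}<0$); $\overline\Omega=\{(i,j)\mid c_{ij}<0\}$. Put $g_{ij}=\gcd(c_{ij},c_{ji})$, $f_{ij}=|c_{ij}|/g_{ij}$, and $\mathrm{sgn}(i,j)=1$ if $(i,j)\in\Omega$, $-1$ if $(j,i)\in\Omega$. The generalized preprojective algebra $\Pi=\Pi(C,D)$ is the path algebra over $K$ of the quiver with vertex set $Q_0$, loops $\varepsilon_i:i\to i$ and arrows $\alpha_{ij}^{(g)}:j\to i$ ($(i,j)\in\overline\Omega$, $1\le g\le g_{ij}$), modulo $\varepsilon_i^{c_i}=0$, $\varepsilon_i^{f_{ji}}\alpha_{ij}^{(g)}=\alpha_{ij}^{(g)}\varepsilon_j^{f_{ij}}$,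 and $\sum_{j,g}\sum_{f=0}^{f_{ji}-1}\mathrm{sgn}(i,j)\,\varepsilon_i^f\alpha_{ij}^{(g)}\alpha_{ji}^{(g)}\varepsilon_i^{f_{ji}-1-f}=0$ for each $i$. Let $e_i$ be the vertex idempotents and $H_i=K[\varepsilon_i]/(\varepsilon_i^{c_i})$. Modules are left modules. For a $\Pi$-module $M$, $M^*=\mathrm{Hom}_K(M,K)$ is the $\Pi$-module on which $e_i$ and $\varepsilon_i$ act by the transposes of their actions on $M$ and $\alpha_{ij}^{(g)}$ acts by the transpose of the action of $\alpha_{ji}^{(g)}$. $S_i$ is the one-dimensional simple module at $i$, and $E_i$ is the generalized simple module ($e_iE_i=H_i$, $e_jE_i=0$ for $j\ne i$). A module is $\mathbb E$-filtered if it has a finite filtration with successive quotients among the $E_j$. It is locally free of rank vector $(r_i)$ if each $e_iM$ is a free $H_i$-module of finite rank $r_i$. $\mathrm{sub}_iM$ is the largest submodule of $M$ with all composition factors isomorphic to $S_i$. Put $I_i=\Pi(1-e_i)\Pi$ and $I_w=I_{i_1}\cdots I_{i_l}$ for a reduced expression $w=s_{i_1}\cdots s_{i_l}$ in the Weyl group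 $W$ of $C$, where $s_i\alpha_j=\alpha_j-c_{ij}\alpha_i$ on the root lattice $\bigoplus_j\mathbb Z\alpha_j$. On weights, with the $\alpha_j$ independent of the fundamental weights $\varpi_j$, $s_i\varpi_j=\varpi_j-\delta_{ij}\alpha_i$ and $s_i\alpha_j=\alpha_j-c_{ij}\alpha_i$, so that $w\lambda-\lambda$ lies in the root lattice for $\lambda\in\bigoplus_j\mathbb Z\varpi_j$. **The modules $N(\gamma)$.** Let $\widetilde\Pi=\Pi(\widetilde C,\widetilde D)$ be the framed algebra, with vertex set $Q_0\sqcup\{i'\mid i\in Q_0\}$, $\widetilde C=\begin{pmatrix}C&-1\\-1&2\end{pmatrix}$, $\widetilde D=\begin{pmatrix}D&0\\0&D\end{pmatrix}$. A $\widetilde\Pi$-module $M$ is stable if it is $\mathbb E$-filtered and $\mathrm{sub}_iM=0$ for all $i\in Q_0$. For an anti-dominant weight $\lambda=-\sum_i m_i\varpi_i$ ($m_i\geq 0$) and $w\in W$, $\widetilde N(w\lambda)$ is the (up to isomorphism) unique stable $\widetilde\Pi$-module of rank vector $w\lambda-\lambda=\sum_i\nu_i\alpha_i$ (rank $\nu_i$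 at $i$) on $Q_0$ and rank $m_i$ at $i'$; $\widetilde N(\lambda)$ embeds in it, and $N(w\lambda)=\widetilde N(w\lambda)/\widetilde N(\lambda)$, which vanishes at the vertices $i'$ and so is a $\Pi$-module. **Theorem.** Let $\mathbf i=(i_1,\dots,i_l)$ be a reduced word, $1\le k\le l$, and $k^-=\max\{0,\ 1\le s\le k-1\mid i_s=i_k\}$. Let $V_{\mathbf i,k}=N(-s_{i_1}\cdots s_{i_k}\varpi_{i_k})$ and $V_{\mathbf i,k^-}=N(-s_{i_1}\cdots s_{i_{k^-}}\varpi_{i_k})$ (which is $0$ if $k^-=0$). These modules exist, and as $\Pi$-modules $$V_{\mathbf i,k}\cong\big((\Pi/I_{s_{i_1}\cdots s_{i_k}})\otimes_\Pi\Pi e_{i_k}\big)^*.$$ Moreover $V_{\mathbf i,k^-}$ embeds in $V_{\mathbf i,k}$, and for every embedding the quotient $M_{\mathbf i,k}=V_{\mathbf i,k}/V_{\mathbf i,k^-}$ satisfies $$M_{\mathbf i,k}\cong\big(I_{s_{i_1}\cdots s_{i_{k-1}}}\otimes_\Pi E_{i_k}\big)^*\cong\big(I_{s_{i_1}\cdots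 s_{i_{k-1}}}/I_{s_{i_1}\cdots s_{i_k}}\big)^*.$$ -/

import Mathlib

open scoped TensorProduct Polynomial

universe u v w

noncomputable section

namespace GPA

/-- A symmetrizable generalized Cartan matrix `C`, a symmetrizer `diag (c i)` of it, and an
orientation `Ω` of it, with finite vertex set `ι`. -/
structure CartanDatum (ι : Type w) where
  C : Matrix ι ι ℤ
  diag : ∀ i, C i i = 2
  offDiag : ∀ i j, i ≠ j → C i j ≤ 0
  ne_zero_iff : ∀ i j, C i j ≠ 0 ↔ C j i ≠ 0
  c : ι → ℕ
  one_le_c : ∀ i, 1 ≤ c i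
  symm : ∀ i j, (c i : ℤ) * C i j = (c j : ℤ) * C j i
  Ω : ι → ι → Prop
  Ω_iff : ∀ i j, (Ω i j ∨ Ω j i) ↔ C i j < 0
  Ω_acyclic : ∀ i, ¬ Relation.TransGen Ω i i

/-- Symbols for the generators of a path algebra: idempotents `e i`, loops `eps i : i → i`, and
arrows `arr i j g : j → i`. -/
inductive Gen (ι : Type w) : Type w
  | e : ι → Gen ι
  | eps : ι → Gen ι
  | arr : ι → ι → ℕ → Gen ι

namespace CartanDatum

variable {ι : Type w} (𝒟 : CartanDatum ι)

/-- `g_ij = gcd (c_ij, c_ji)`. -/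
def g (i j : ι) : ℕ := Int.gcd (𝒟.C i j) (𝒟.C j i)

/-- `f_ij = |c_ij| / g_ij`. -/
def f (i j : ι) : ℕ := (𝒟.C i j).natAbs / 𝒟.g i j

open Classical in
/-- `1` if `(i, j) ∈ Ω`, and `-1` if `(j, i) ∈ Ω`. -/
def sgn (i j : ι) : ℤ := if 𝒟.Ω i j then 1 else -1

/-- `(i, j)` belongs to the union of `Ω` and the opposite orientation, and `α_ij^(g)` is one of
the arrows `j → i` of the double quiver; these are numbered `0 ≤ g < g_ij`. -/
def IsArrow (i j : ι) (g : ℕ) : Prop := 𝒟.C i j < 0 ∧ g < 𝒟.g i j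

theorem neg_comm {i j : ι} (h : 𝒟.C i j < 0) : 𝒟.C j i < 0 := by
  have hij : i ≠ j := by
    rintro rfl
    have := 𝒟.diag i
    omega
  have h1 := 𝒟.offDiag j i hij.symm
  have h2 := (𝒟.ne_zero_iff i j).1 h.ne
  omega

theorem g_comm (i j : ι) : 𝒟.g i j = 𝒟.g j i := Int.gcd_comm _ _

variable [Fintype ι]

/-- The relations of the generalized preprojective algebra, for elements `e i`, `ε i`, `α i j g`
of a ring `B`. The first eight say that `e, ε, α` come from the path algebra of the double quiver
(the symbols `α i j g` that are not arrows being zero), the last three are the defining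
relations: nilpotency of the loops, commutation of loops and arrows, and the mesh relations. -/
structure Relations {B : Type*} [Ring B] (e ε : ι → B) (α : ι → ι → ℕ → B) : Prop where
  e_mul_self : ∀ i, e i * e i = e i
  e_mul_e : ∀ i j, i ≠ j → e i * e j = 0
  sum_e : ∑ i, e i = 1
  e_mul_ε : ∀ i, e i * ε i = ε i
  ε_mul_e : ∀ i, ε i * e i = ε i
  e_mul_α : ∀ i j g, e i * α i j g = α i j g
  α_mul_e : ∀ i j g, α i j g * e j = α i j g
  α_eq_zero : ∀ i j g, ¬ 𝒟.IsArrow i j g → α i j g = 0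
  p1 : ∀ i, ε i ^ 𝒟.c i = 0
  p2 : ∀ i j g, 𝒟.IsArrow i j g →
    ε i ^ 𝒟.f j i * α i j g = α i j g * ε j ^ 𝒟.f i j
  p3 : ∀ i, ∑ j with 𝒟.C i j < 0, ∑ g ∈ Finset.range (𝒟.g i j), ∑ s ∈ Finset.range (𝒟.f j i),
    𝒟.sgn i j • (ε i ^ s * α i j g * α j i g * ε i ^ (𝒟.f j i - 1 - s)) = 0

variable (K : Type u) [Field K]

section Presentation

/-- The free symbols. -/
abbrev fe (i : ι) : FreeAlgebra K (Gen ι) := FreeAlgebra.ι K (Gen.e i)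
/-- The free symbols. -/
abbrev fε (i : ι) : FreeAlgebra K (Gen ι) := FreeAlgebra.ι K (Gen.eps i)
/-- The free symbols. -/
abbrev fα (i j : ι) (g : ℕ) : FreeAlgebra K (Gen ι) := FreeAlgebra.ι K (Gen.arr i j g)

/-- The defining relations, as pairs of elements of the free algebra. -/
inductive Rel : FreeAlgebra K (Gen ι) → FreeAlgebra K (Gen ι) → Prop
  | e_mul_self (i : ι) : Rel (fe K i * fe K i) (fe K i)
  | e_mul_e (i j : ι) (h : i ≠ j) : Rel (fe K i * fe K j) 0
  | sum_e : Rel (∑ i, fe K i) 1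
  | e_mul_ε (i : ι) : Rel (fe K i * fε K i) (fε K i)
  | ε_mul_e (i : ι) : Rel (fε K i * fe K i) (fε K i)
  | e_mul_α (i j : ι) (g : ℕ) : Rel (fe K i * fα K i j g) (fα K i j g)
  | α_mul_e (i j : ι) (g : ℕ) : Rel (fα K i j g * fe K j) (fα K i j g)
  | α_eq_zero (i j : ι) (g : ℕ) (h : ¬ 𝒟.IsArrow i j g) : Rel (fα K i j g) 0
  | p1 (i : ι) : Rel (fε K i ^ 𝒟.c i) 0
  | p2 (i j : ι) (g : ℕ) (h : 𝒟.IsArrow i j g) :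
      Rel (fε K i ^ 𝒟.f j i * fα K i j g) (fα K i j g * fε K j ^ 𝒟.f i j)
  | p3 (i : ι) : Rel (∑ j with 𝒟.C i j < 0, ∑ g ∈ Finset.range (𝒟.g i j),
      ∑ s ∈ Finset.range (𝒟.f j i),
        𝒟.sgn i j • (fε K i ^ s * fα K i j g * fα K j i g * fε K i ^ (𝒟.f j i - 1 - s))) 0

end Presentation

/-- The generalized preprojective algebra `Π(C, D)` over `K`. -/
def Alg : Type (max u w) := RingQuot (𝒟.Rel K)

instance : Ring (𝒟.Alg K) := inferInstanceAs (Ring (RingQuot (𝒟.Rel K)))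
instance : Algebra K (𝒟.Alg K) := inferInstanceAs (Algebra K (RingQuot (𝒟.Rel K)))

/-- The quotient map from the free algebra. -/
def proj : FreeAlgebra K (Gen ι) →ₐ[K] 𝒟.Alg K := RingQuot.mkAlgHom K (𝒟.Rel K)

/-- The idempotent `e_i` of `Π`. -/
def e (i : ι) : 𝒟.Alg K := 𝒟.proj K (fe K i)
/-- The loop `ε_i` in `Π`. -/
def ε (i : ι) : 𝒟.Alg K := 𝒟.proj K (fε K i)
/-- The arrow `α_ij^(g) : j → i` in `Π`. -/
def α (i j : ι) (g : ℕ) : 𝒟.Alg K := 𝒟.proj K (fα K i j g)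

theorem proj_rel {x y : FreeAlgebra K (Gen ι)} (h : 𝒟.Rel K x y) : 𝒟.proj K x = 𝒟.proj K y :=
  RingQuot.mkAlgHom_rel K h

theorem relations : 𝒟.Relations (𝒟.e K) (𝒟.ε K) (𝒟.α K) where
  e_mul_self i := by simpa using! 𝒟.proj_rel K (Rel.e_mul_self i)
  e_mul_e i j h := by simpa using! 𝒟.proj_rel K (Rel.e_mul_e i j h)
  sum_e := by
    have := 𝒟.proj_rel K Rel.sum_e
    rwa [map_sum, map_one] at this
  e_mul_ε i := by simpa using! 𝒟.proj_rel K (Rel.e_mul_ε i)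
  ε_mul_e i := by simpa using! 𝒟.proj_rel K (Rel.ε_mul_e i)
  e_mul_α i j g := by simpa using! 𝒟.proj_rel K (Rel.e_mul_α i j g)
  α_mul_e i j g := by simpa using! 𝒟.proj_rel K (Rel.α_mul_e i j g)
  α_eq_zero i j g h := by simpa using! 𝒟.proj_rel K (Rel.α_eq_zero i j g h)
  p1 i := by simpa using! 𝒟.proj_rel K (Rel.p1 i)
  p2 i j g h := by simpa using! 𝒟.proj_rel K (Rel.p2 i j g h)
  p3 i := by
    have := 𝒟.proj_rel K (Rel.p3 i)
    simpa only [map_sum, map_zsmul, map_mul, map_pow, map_zero] using! this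

section Lift

variable {𝒟} {B : Type*} [Ring B] [Algebra K B] {e' ε' : ι → B} {α' : ι → ι → ℕ → B}

/-- The values of a homomorphism out of the free algebra on the symbols. -/
def genVal (e' ε' : ι → B) (α' : ι → ι → ℕ → B) : Gen ι → B
  | .e i => e' i
  | .eps i => ε' i
  | .arr i j g => α' i j g

/-- The universal property of `Π`: elements of a `K`-algebra that satisfy the relations define a
homomorphism out of `Π`. -/
def lift (h : 𝒟.Relations e' ε' α') : 𝒟.Alg K →ₐ[K] B :=
  RingQuot.liftAlgHom K ⟨FreeAlgebra.lift K (genVal e' ε' α'), by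
    intro x y hxy
    cases hxy with
    | e_mul_self i => simpa [genVal] using h.e_mul_self i
    | e_mul_e i j hij => simpa [genVal] using h.e_mul_e i j hij
    | sum_e => simpa [genVal] using h.sum_e
    | e_mul_ε i => simpa [genVal] using h.e_mul_ε i
    | ε_mul_e i => simpa [genVal] using h.ε_mul_e i
    | e_mul_α i j g => simpa [genVal] using h.e_mul_α i j g
    | α_mul_e i j g => simpa [genVal] using h.α_mul_e i j g
    | α_eq_zero i j g hg => simpa [genVal] using h.α_eq_zero i j g hg
    | p1 i => simpa [genVal] using h.p1 i
    | p2 i j g hg => simpa [genVal] using h.p2 i j g hg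
    | p3 i =>
      have := h.p3 i
      simpa only [map_sum, map_zsmul, map_mul, map_pow, map_zero, FreeAlgebra.lift_ι_apply,
        genVal] using this⟩

theorem lift_proj (h : 𝒟.Relations e' ε' α') (x : Gen ι) :
    lift K h (𝒟.proj K (FreeAlgebra.ι K x)) = genVal e' ε' α' x := by
  unfold lift proj
  exact (RingQuot.liftAlgHom_mkAlgHom_apply K _ _ _).trans (FreeAlgebra.lift_ι_apply _ _)

@[simp] theorem lift_e (h : 𝒟.Relations e' ε' α') (i : ι) : lift K h (𝒟.e K i) = e' i :=
  lift_proj K h _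
@[simp] theorem lift_ε (h : 𝒟.Relations e' ε' α') (i : ι) : lift K h (𝒟.ε K i) = ε' i :=
  lift_proj K h _
@[simp] theorem lift_α (h : 𝒟.Relations e' ε' α') (i j : ι) (g : ℕ) :
    lift K h (𝒟.α K i j g) = α' i j g :=
  lift_proj K h _

end Lift

/-! ### The anti-involution of `Π` and the duality of modules -/

theorem relations_op : 𝒟.Relations (B := (𝒟.Alg K)ᵐᵒᵖ) (fun i => .op (𝒟.e K i))
    (fun i => .op (𝒟.ε K i)) (fun i j g => .op (𝒟.α K j i g)) where
  e_mul_self i := by rw [← MulOpposite.op_mul, (𝒟.relations K).e_mul_self]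
  e_mul_e i j h := by
    rw [← MulOpposite.op_mul, (𝒟.relations K).e_mul_e j i h.symm, MulOpposite.op_zero]
  sum_e := by
    have := congrArg MulOpposite.op ((𝒟.relations K).sum_e)
    simpa only [Finset.op_sum, MulOpposite.op_one] using this
  e_mul_ε i := by rw [← MulOpposite.op_mul, (𝒟.relations K).ε_mul_e]
  ε_mul_e i := by rw [← MulOpposite.op_mul, (𝒟.relations K).e_mul_ε]
  e_mul_α i j g := by rw [← MulOpposite.op_mul, (𝒟.relations K).α_mul_e]
  α_mul_e i j g := by rw [← MulOpposite.op_mul, (𝒟.relations K).e_mul_α]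
  α_eq_zero i j g h := by
    rw [(𝒟.relations K).α_eq_zero j i g, MulOpposite.op_zero]
    rintro ⟨h1, h2⟩
    exact h ⟨𝒟.neg_comm h1, by rwa [𝒟.g_comm]⟩
  p1 i := by rw [← MulOpposite.op_pow, (𝒟.relations K).p1, MulOpposite.op_zero]
  p2 i j g h := by
    have := (𝒟.relations K).p2 j i g ⟨𝒟.neg_comm h.1, by rw [𝒟.g_comm]; exact h.2⟩
    simp only [← MulOpposite.op_pow, ← MulOpposite.op_mul, this]
  p3 i := by
    have := congrArg MulOpposite.op ((𝒟.relations K).p3 i)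
    rw [MulOpposite.op_zero] at this
    rw [← this]
    simp only [Finset.op_sum]
    refine Finset.sum_congr rfl fun j _ => Finset.sum_congr rfl fun g _ => ?_
    rw [← Finset.sum_range_reflect]
    refine Finset.sum_congr rfl fun s hs => ?_
    have hs' : 𝒟.f j i - 1 - (𝒟.f j i - 1 - s) = s := by
      have := Finset.mem_range.1 hs
      omega
    simp only [hs', ← MulOpposite.op_pow, ← MulOpposite.op_mul, mul_assoc,
      ← MulOpposite.op_smul]

/-- The anti-automorphism of `Π` fixing all `e_i` and `ε_i` and exchanging `α_ij^(g)` and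
`α_ji^(g)`. -/
def anti : 𝒟.Alg K →ₐ[K] (𝒟.Alg K)ᵐᵒᵖ := lift K (𝒟.relations_op K)

section Dual

variable (M : Type v) [AddCommGroup M] [Module K M]

/-- The dual `M^*` of a `Π`-module `M`: the `K`-dual space, on which each `e_i`, `ε_i` acts by the
transpose of its action on `M`, and `α_ij^(g)` by the transpose of the action of `α_ji^(g)`. -/
def Dual (_ : CartanDatum ι) (K : Type u) [Field K] (M : Type v) [AddCommGroup M] [Module K M] :
    Type (max u v) :=
  Module.Dual K M

instance : AddCommGroup (𝒟.Dual K M) := inferInstanceAs (AddCommGroup (Module.Dual K M))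
instance : Module K (𝒟.Dual K M) := inferInstanceAs (Module K (Module.Dual K M))

variable [Module (𝒟.Alg K) M] [IsScalarTower K (𝒟.Alg K) M]

/-- The right action of `Π` on the `K`-dual, made into a left action by `anti`. -/
def dualAct (a : 𝒟.Alg K) (φ : Module.Dual K M) : Module.Dual K M :=
  φ ∘ₗ Algebra.lsmul K K M (𝒟.anti K a).unop

instance : Module (𝒟.Alg K) (𝒟.Dual K M) where
  smul a φ := 𝒟.dualAct K M a φ
  one_smul φ := LinearMap.ext fun m => by
    change (show Module.Dual K M from φ) ((𝒟.anti K 1).unop • m) = (show Module.Dual K M from φ) m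
    simp
  mul_smul a b φ := LinearMap.ext fun m => by
    change (show Module.Dual K M from φ) ((𝒟.anti K (a * b)).unop • m) =
      (show Module.Dual K M from φ) ((𝒟.anti K b).unop • (𝒟.anti K a).unop • m)
    simp [mul_smul]
  smul_zero a := LinearMap.ext fun _ => rfl
  smul_add a φ ψ := LinearMap.ext fun _ => rfl
  add_smul a b φ := LinearMap.ext fun m => by
    change (show Module.Dual K M from φ) ((𝒟.anti K (a + b)).unop • m) =
      (show Module.Dual K M from φ) ((𝒟.anti K a).unop • m) +
      (show Module.Dual K M from φ) ((𝒟.anti K b).unop • m)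
    rw [map_add, MulOpposite.unop_add, add_smul]
    exact map_add (show Module.Dual K M from φ) _ _
  zero_smul φ := LinearMap.ext fun m => by
    change (show Module.Dual K M from φ) ((𝒟.anti K 0).unop • m) = 0
    rw [map_zero, MulOpposite.unop_zero, zero_smul]
    exact map_zero (show Module.Dual K M from φ)

instance : IsScalarTower K (𝒟.Alg K) (𝒟.Dual K M) where
  smul_assoc k a φ := LinearMap.ext fun m => by
    change (show Module.Dual K M from φ) ((𝒟.anti K (k • a)).unop • m) =
      k • (show Module.Dual K M from φ) ((𝒟.anti K a).unop • m)
    have h : (𝒟.anti K (k • a)).unop = k • (𝒟.anti K a).unop := by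
      rw [map_smul, MulOpposite.unop_smul]
    rw [h, smul_assoc]
    exact LinearMap.map_smul (show Module.Dual K M from φ) k _

theorem dual_smul_apply (a : 𝒟.Alg K) (φ : 𝒟.Dual K M) (m : M) :
    (show Module.Dual K M from a • φ) m = (show Module.Dual K M from φ) ((𝒟.anti K a).unop • m) :=
  rfl

end Dual

/-! ### (Generalized) simple modules, locally free modules, rank vectors -/

/-- `K[ε]/(ε^m)`. The algebra `H_i` is the case `m = c_i`. -/
abbrev TruncPoly (m : ℕ) : Type u := K[X] ⧸ Ideal.span {(Polynomial.X : K[X]) ^ m}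

open Classical in
theorem relations_vertex {B : Type*} [Ring B] (i : ι) (x : B) (hx : x ^ 𝒟.c i = 0) :
    𝒟.Relations (fun j => if j = i then (1 : B) else 0) (fun j => if j = i then x else 0)
      (fun _ _ _ => 0) where
  e_mul_self j := by by_cases hj : j = i <;> simp [hj]
  e_mul_e j k h := by
    by_cases hj : j = i
    · have : k ≠ i := fun hk => h (hj.trans hk.symm)
      simp [this]
    · simp [hj]
  sum_e := by simp
  e_mul_ε j := by by_cases hj : j = i <;> simp [hj]
  ε_mul_e j := by by_cases hj : j = i <;> simp [hj]
  e_mul_α _ _ _ := by simp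
  α_mul_e _ _ _ := by simp
  α_eq_zero _ _ _ _ := rfl
  p1 j := by
    have := 𝒟.one_le_c j
    by_cases hj : j = i
    · subst hj; simpa using hx
    · simpa [hj] using zero_pow (M₀ := B) (by omega : 𝒟.c j ≠ 0)
  p2 _ _ _ _ := by simp
  p3 _ := by simp

/-- The homomorphism from `Π` to a `K`-algebra `B` with `e_i ↦ 1`, `ε_i ↦ x`, and all other
generators sent to `0`. -/
def toVertex {B : Type*} [Ring B] [Algebra K B] (i : ι) (x : B) (hx : x ^ 𝒟.c i = 0) :
    𝒟.Alg K →ₐ[K] B :=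
  lift K (𝒟.relations_vertex i x hx)

/-- The generalized simple module `E_i`: the free `H_i`-module of rank one at the vertex `i`. -/
def E (i : ι) : Type u := TruncPoly K (𝒟.c i)

instance (i : ι) : AddCommGroup (𝒟.E K i) := inferInstanceAs (AddCommGroup (TruncPoly K (𝒟.c i)))
instance (i : ι) : Module K (𝒟.E K i) := inferInstanceAs (Module K (TruncPoly K (𝒟.c i)))

/-- The structure map of `E_i`. -/
def toE (i : ι) : 𝒟.Alg K →ₐ[K] TruncPoly K (𝒟.c i) :=
  𝒟.toVertex K i (Ideal.Quotient.mk _ Polynomial.X) (by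
    rw [← map_pow]
    exact Ideal.Quotient.eq_zero_iff_mem.2 (Ideal.mem_span_singleton_self _))

instance (i : ι) : Module (𝒟.Alg K) (𝒟.E K i) :=
  Module.compHom (TruncPoly K (𝒟.c i)) (𝒟.toE K i).toRingHom

instance (i : ι) : IsScalarTower K (𝒟.Alg K) (𝒟.E K i) where
  smul_assoc k a x := by
    change 𝒟.toE K i (k • a) * (show TruncPoly K (𝒟.c i) from x) =
      k • (𝒟.toE K i a * (show TruncPoly K (𝒟.c i) from x))
    rw [map_smul, smul_mul_assoc]

/-- The simple module `S_i`: one-dimensional at the vertex `i`. -/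
def S (_ : CartanDatum ι) (K : Type u) (_ : ι) : Type u := K

instance (i : ι) : AddCommGroup (𝒟.S K i) := inferInstanceAs (AddCommGroup K)
instance (i : ι) : Module K (𝒟.S K i) := inferInstanceAs (Module K K)

/-- The structure map of `S_i`. -/
def toS (i : ι) : 𝒟.Alg K →ₐ[K] K :=
  𝒟.toVertex K i 0 (zero_pow (by have := 𝒟.one_le_c i; omega))

instance (i : ι) : Module (𝒟.Alg K) (𝒟.S K i) := Module.compHom K (𝒟.toS K i).toRingHom

section Modules

variable (M : Type v) [AddCommGroup M] [Module (𝒟.Alg K) M]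

/-- `M` has a finite filtration by submodules with all successive quotients isomorphic to
generalized simple modules. -/
def IsEFiltered : Prop :=
  ∃ (n : ℕ) (F : ℕ → Submodule (𝒟.Alg K) M), F 0 = ⊥ ∧ F n = ⊤ ∧
    ∀ k < n, F k ≤ F (k + 1) ∧
      ∃ j, Nonempty ((F (k + 1) ⧸ (F k).submoduleOf (F (k + 1))) ≃ₗ[𝒟.Alg K] 𝒟.E K j)

/-- `sub_i M`: the largest submodule of `M` all of whose composition factors are isomorphic
to `S_i`. -/
def sub (i : ι) : Submodule (𝒟.Alg K) M :=
  sSup {N | ∀ A B : Submodule (𝒟.Alg K) M, A ⋖ B → B ≤ N →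
    Nonempty ((B ⧸ A.submoduleOf B) ≃ₗ[𝒟.Alg K] 𝒟.S K i)}

variable [Module K M] [IsScalarTower K (𝒟.Alg K) M]

/-- The subspace `e_i M`. -/
def vertexSpace (i : ι) : Submodule K M := LinearMap.range (Algebra.lsmul K K M (𝒟.e K i))

/-- The action of `ε_i` on `e_i M`. -/
def epsOn (i : ι) : Module.End K (𝒟.vertexSpace K M i) :=
  (Algebra.lsmul K K M (𝒟.ε K i)).restrict fun x _ => ⟨𝒟.ε K i • x, by
    change 𝒟.e K i • 𝒟.ε K i • x = 𝒟.ε K i • x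
    rw [← mul_smul, (𝒟.relations K).e_mul_ε]⟩

theorem epsOn_pow (i : ι) : 𝒟.epsOn K M i ^ 𝒟.c i = 0 := by
  ext x
  have h : ∀ m : ℕ, (((𝒟.epsOn K M i ^ m) x : 𝒟.vertexSpace K M i) : M) = 𝒟.ε K i ^ m • (x : M) := by
    intro m
    induction m with
    | zero => simp
    | succ m ih =>
      rw [pow_succ', Module.End.mul_apply, pow_succ', mul_smul, ← ih]
      rfl
  rw [h, (𝒟.relations K).p1]
  simp

/-- `e_i M` as a module over `H_i = K[ε]/(ε^c_i)`, where `ε` acts as `ε_i`. -/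
abbrev vertexModule (i : ι) : Module (TruncPoly K (𝒟.c i)) (𝒟.vertexSpace K M i) :=
  Module.compHom (𝒟.vertexSpace K M i)
    (Ideal.Quotient.liftₐ (Ideal.span {(Polynomial.X : K[X]) ^ 𝒟.c i})
      (Polynomial.aeval (𝒟.epsOn K M i)) (by
        intro a ha
        obtain ⟨b, rfl⟩ := Ideal.mem_span_singleton.1 ha
        simp [𝒟.epsOn_pow K M i])).toRingHom

/-- `M` is locally free of finite rank, with rank vector `r`: each `e_i M` is a free `H_i`-module
of rank `r i`. -/
def HasRankVector (r : ι → ℕ) : Prop :=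
  ∀ i, letI := 𝒟.vertexModule K M i
    Module.Free (TruncPoly K (𝒟.c i)) (𝒟.vertexSpace K M i) ∧
    Module.Finite (TruncPoly K (𝒟.c i)) (𝒟.vertexSpace K M i) ∧
    Module.finrank (TruncPoly K (𝒟.c i)) (𝒟.vertexSpace K M i) = r i

end Modules

/-! ### Weyl group, reduced words, weights -/

section Weyl

/-- The pairing of the root lattice `⨁ ℤ α_j = ℤ^ι` with the simple coroot `α_i^∨`:
`⟨α_j, α_i^∨⟩ = c_ij`. -/
def corootR (i : ι) : Module.Dual ℤ (ι → ℤ) := ∑ j, 𝒟.C i j • LinearMap.proj j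

theorem corootR_apply (i : ι) (a : ι → ℤ) : 𝒟.corootR i a = ∑ j, 𝒟.C i j * a j := by
  simp [corootR]

variable [DecidableEq ι]

/-- The simple reflection `s_i` of the root lattice: `s_i α_j = α_j - c_ij α_i`. -/
def s (i : ι) : (ι → ℤ) ≃ₗ[ℤ] (ι → ℤ) :=
  Module.reflection (x := Pi.single i 1) (f := 𝒟.corootR i) (by
    rw [corootR_apply, Finset.sum_eq_single i] <;> simp +contextual [𝒟.diag])

/-- A word `i_1, …, i_l` is reduced if no shorter word represents the same element
`s_{i_1} ⋯ s_{i_l}` of the Weyl group, the group of automorphisms of the root lattice generated by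
the simple reflections. -/
def IsReduced (l : List ι) : Prop :=
  ∀ l' : List ι, (l'.map 𝒟.s).prod = (l.map 𝒟.s).prod → l.length ≤ l'.length

/-- The pairing of the simple coroot `α_i^∨` with `(a, b)`, standing for the weight
`∑ a_j α_j + ∑ b_j ϖ_j`: `⟨α_j, α_i^∨⟩ = c_ij` and `⟨ϖ_j, α_i^∨⟩ = δ_ij`. The simple roots are kept
independent of the fundamental weights, so that a difference `w λ - λ` is a well-defined element
of the root lattice also if `det C = 0`. -/
def corootP (i : ι) : Module.Dual ℤ ((ι → ℤ) × (ι → ℤ)) :=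
  (𝒟.corootR i).coprod (LinearMap.proj i)

/-- The simple reflection `s_i` on weights: `s_i α_j = α_j - c_ij α_i`, `s_i ϖ_j = ϖ_j - δ_ij α_i`. -/
def sP (i : ι) : ((ι → ℤ) × (ι → ℤ)) ≃ₗ[ℤ] ((ι → ℤ) × (ι → ℤ)) :=
  Module.reflection (x := (Pi.single i 1, 0)) (f := 𝒟.corootP i) (by
    have : 𝒟.corootR i (Pi.single i 1) = 2 := by
      rw [corootR_apply, Finset.sum_eq_single i] <;> simp +contextual [𝒟.diag]
    simp [corootP, this])

/-- The anti-dominant weight `λ = - ∑ m_j ϖ_j`. -/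
def antidominant (_ : CartanDatum ι) (m : ι → ℕ) : (ι → ℤ) × (ι → ℤ) := (0, fun j => -(m j : ℤ))

end Weyl

/-! ### Idempotent ideals -/

section Ideals

/-- The two-sided ideal `I_i = Π (1 - e_i) Π`. -/
def idemIdeal (i : ι) : Ideal (𝒟.Alg K) :=
  Ideal.span {x | ∃ a b, x = a * (1 - 𝒟.e K i) * b}

instance (i : ι) : (𝒟.idemIdeal K i).IsTwoSided where
  mul_mem_of_left b ha := by
    refine Submodule.span_induction (p := fun x _ => x * b ∈ 𝒟.idemIdeal K i) ?_ ?_ ?_ ?_ ha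
    · rintro _ ⟨x, y, rfl⟩
      exact Submodule.subset_span ⟨x, y * b, by simp only [mul_assoc]⟩
    · simp
    · intro x y _ _ hx hy
      rw [add_mul]
      exact add_mem hx hy
    · intro r x _ hx
      rw [smul_eq_mul, mul_assoc]
      exact Ideal.mul_mem_left _ _ hx

/-- The product `I_{i_1} I_{i_2} ⋯ I_{i_l}` for a word `i_1, …, i_l`. This is the ideal `I_w` if the
word is a reduced expression of `w`. -/
def I : List ι → Ideal (𝒟.Alg K)
  | [] => ⊤
  | i :: l => 𝒟.idemIdeal K i * I l

instance instITwoSided (l : List ι) : (𝒟.I K l).IsTwoSided := by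
  induction l with
  | nil => unfold I; infer_instance
  | cons i l ih => unfold I; infer_instance

/-- The left ideal `Π e_i`. -/
def P (i : ι) : Ideal (𝒟.Alg K) := Ideal.span {𝒟.e K i}

end Ideals

end CartanDatum

/-! ### Tensor products over a noncommutative algebra -/

section Tensor

variable (K : Type*) [Field K] {A : Type*} [Ring A] [Algebra K A]

/-- The right `A`-module structure of a two-sided ideal. -/
instance idealRightModule (I : Ideal A) [I.IsTwoSided] : Module Aᵐᵒᵖ I where
  smul a x := ⟨x.1 * a.unop, I.mul_mem_right _ x.2⟩
  one_smul _ := Subtype.ext (mul_one _)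
  mul_smul _ _ _ := Subtype.ext (mul_assoc _ _ _).symm
  smul_zero _ := Subtype.ext (zero_mul _)
  smul_add _ _ _ := Subtype.ext (add_mul _ _ _)
  add_smul _ _ _ := Subtype.ext (mul_add _ _ _)
  zero_smul _ := Subtype.ext (mul_zero _)

/-- The right `A`-module structure of the quotient by a two-sided ideal:
`(x + I) a = x a + I`. -/
instance quotientRightModule (I : Ideal A) [I.IsTwoSided] : Module Aᵐᵒᵖ (A ⧸ I) :=
  Module.compHom (A ⧸ I) (Ideal.Quotient.mk I).op

variable (A)

/-- `M ⊗_A N`, for an `A`-`A`-bimodule `M` and a left `A`-module `N`, as a left `A`-module: the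
quotient of `M ⊗_K N` by the relations `m a ⊗ n = m ⊗ a n`. -/
abbrev BalancedTensor (M : Type*) [AddCommGroup M] [Module K M] [Module A M] [IsScalarTower K A M]
    [Module Aᵐᵒᵖ M] (N : Type*) [AddCommGroup N] [Module K N] [Module A N] : Type _ :=
  (M ⊗[K] N) ⧸ Submodule.span A
    {z : M ⊗[K] N | ∃ (m : M) (a : A) (n : N),
      z = (MulOpposite.op a • m) ⊗ₜ[K] n - m ⊗ₜ[K] (a • n)}

end Tensor

/-! ### Framing, stable modules, and the modules `N(γ)` -/

namespace CartanDatum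

variable {ι : Type w} (𝒟 : CartanDatum ι)

/-- The orientation of the framed datum: the given one on unprimed vertices (`Sum.inl`), together
with all `(i', i)`, where `i'` is `Sum.inr i`. -/
def framedΩ : ι ⊕ ι → ι ⊕ ι → Prop
  | .inl i, .inl j => 𝒟.Ω i j
  | .inr i, .inl j => i = j
  | _, .inr _ => False

theorem framedΩ_transGen {i : ι} {x : ι ⊕ ι} (h : Relation.TransGen 𝒟.framedΩ (.inl i) x) :
    ∃ j, x = .inl j ∧ Relation.TransGen 𝒟.Ω i j := by
  induction h with
  | @single b h =>
    cases b with
    | inl j => exact ⟨j, rfl, .single h⟩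
    | inr j => exact h.elim
  | @tail b c _ h2 ih =>
    obtain ⟨j, rfl, hj⟩ := ih
    cases c with
    | inl k => exact ⟨k, rfl, hj.tail h2⟩
    | inr k => exact h2.elim

theorem framedΩ_transGen_inr {x : ι ⊕ ι} {i : ι} :
    ¬ Relation.TransGen 𝒟.framedΩ x (.inr i) := by
  intro h
  cases h with
  | single h => cases x <;> exact h
  | @tail b _ _ h => cases b <;> exact h

variable [DecidableEq ι]

/-- The framed datum `(C̃, D̃)`, with `C̃ = (C, -1; -1, 2)` and `D̃ = (D, 0; 0, D)`. -/
def framed : CartanDatum (ι ⊕ ι) where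
  C := Matrix.fromBlocks 𝒟.C (-1) (-1) (Matrix.diagonal fun _ => 2)
  diag i := by cases i <;> simp [𝒟.diag]
  offDiag i j h := by
    rcases i with i | i <;> rcases j with j | j
    · exact 𝒟.offDiag _ _ (by simpa using h)
    · by_cases h' : i = j <;> simp [h']
    · by_cases h' : i = j <;> simp [h']
    · have h' : i ≠ j := by simpa using h
      simp [h']
  ne_zero_iff i j := by
    rcases i with i | i <;> rcases j with j | j
    · exact 𝒟.ne_zero_iff _ _
    all_goals
      by_cases h : i = j
      · subst h; simp
      · simp [h, Ne.symm h]
  c := Sum.elim 𝒟.c 𝒟.c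
  one_le_c i := by cases i <;> exact 𝒟.one_le_c _
  symm i j := by
    rcases i with i | i <;> rcases j with j | j
    · exact 𝒟.symm _ _
    all_goals
      by_cases h : i = j
      · subst h; simp
      · simp [h, Ne.symm h]
  Ω := 𝒟.framedΩ
  Ω_iff i j := by
    rcases i with i | i <;> rcases j with j | j
    · exact 𝒟.Ω_iff _ _
    all_goals
      by_cases h : i = j
      · subst h; simp [framedΩ]
      · simp [framedΩ, h, Ne.symm h]
  Ω_acyclic i h := by
    cases i with
    | inl i =>
      obtain ⟨j, hj, h'⟩ := 𝒟.framedΩ_transGen h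
      cases hj
      exact 𝒟.Ω_acyclic _ h'
    | inr i => exact 𝒟.framedΩ_transGen_inr h

variable [Fintype ι] (K : Type u) [Field K]

theorem relations_unframed : 𝒟.framed.Relations (Sum.elim (𝒟.e K) 0) (Sum.elim (𝒟.ε K) 0)
    (fun x y g => Sum.elim (fun i => Sum.elim (fun j => 𝒟.α K i j g) 0 y) 0 x) := by
  have R := 𝒟.relations K
  refine ⟨?_, ?_, ?_, ?_, ?_, ?_, ?_, ?_, ?_, ?_, ?_⟩
  · rintro (i | i) <;> simp [R.e_mul_self]
  · rintro (i | i) (j | j) h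
    · exact R.e_mul_e i j (by simpa using h)
    all_goals simp
  · simpa using R.sum_e
  · rintro (i | i) <;> simp [R.e_mul_ε]
  · rintro (i | i) <;> simp [R.ε_mul_e]
  · rintro (i | i) (j | j) g <;> simp [R.e_mul_α]
  · rintro (i | i) (j | j) g <;> simp [R.α_mul_e]
  · rintro (i | i) (j | j) g h
    · exact R.α_eq_zero i j g h
    all_goals simp
  · rintro (i | i)
    · exact R.p1 i
    · have := 𝒟.one_le_c i
      have h0 : 𝒟.c i ≠ 0 := by omega
      simpa [framed] using zero_pow (M₀ := 𝒟.Alg K) h0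
  · rintro (i | i) (j | j) g h
    · exact R.p2 i j g h
    all_goals simp
  · rintro (i | i)
    · have := R.p3 i
      simp only [Finset.sum_filter] at this ⊢
      rw [Fintype.sum_sum_type]
      simpa using! this
    · simp

/-- The homomorphism from the framed algebra to `Π` that kills everything at the primed
vertices. -/
def unframe : 𝒟.framed.Alg K →ₐ[K] 𝒟.Alg K := lift K (𝒟.relations_unframed K)

/-- `M` is a stable module over the framed algebra with rank vector `(w λ - λ, λ)`, where
`w = s_{i_1} ⋯ s_{i_l}` for the given word and `λ = - ∑ m_j ϖ_j`. Stable means: `M` is `𝔼`-filtered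
and `sub_i M = 0` for all unprimed vertices `i`. Here `λ` as a rank vector means rank `m_j` at the
primed vertex `j'`. -/
def IsStableOfWeight (l : List ι) (m : ι → ℕ) (M : Type v) [AddCommGroup M] [Module K M]
    [Module (𝒟.framed.Alg K) M] [IsScalarTower K (𝒟.framed.Alg K) M] : Prop :=
  𝒟.framed.IsEFiltered K M ∧ (∀ i : ι, 𝒟.framed.sub K M (.inl i) = ⊥) ∧
  ∃ ν : ι → ℕ, 𝒟.framed.HasRankVector K M (Sum.elim ν m) ∧
    (l.map 𝒟.sP).prod (𝒟.antidominant m) - 𝒟.antidominant m = (fun i => (ν i : ℤ), 0)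

/-- The `Π`-module `V` is (up to isomorphism) the module `N(w λ) = Ñ(w λ) / Ñ(λ)`, where
`w = s_{i_1} ⋯ s_{i_l}` for the given word and `λ = - ∑ m_j ϖ_j`. Here `Ñ(w λ)` denotes the
stable module over the framed algebra of rank vector `(w λ - λ, λ)`, and the quotient is a
`Π`-module because it vanishes at the primed vertices. -/
def IsN (l : List ι) (m : ι → ℕ) (V : Type v) [AddCommGroup V] [Module (𝒟.Alg K) V] : Prop :=
  ∃ (N : Type v) (_ : AddCommGroup N) (_ : Module K N) (_ : Module (𝒟.framed.Alg K) N)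
    (_ : IsScalarTower K (𝒟.framed.Alg K) N)
    (N₀ : Type v) (_ : AddCommGroup N₀) (_ : Module K N₀) (_ : Module (𝒟.framed.Alg K) N₀)
    (_ : IsScalarTower K (𝒟.framed.Alg K) N₀)
    (f : N₀ →ₗ[𝒟.framed.Alg K] N) (p : N →ₛₗ[(𝒟.unframe K).toRingHom] V),
    𝒟.IsStableOfWeight K l m N ∧ 𝒟.IsStableOfWeight K [] m N₀ ∧
    Function.Injective f ∧ Function.Exact f p ∧ Function.Surjective p

/-- `k⁻ = max {0, 1 ≤ s ≤ k - 1 | i_s = i_k}`. (Words are `i_1, …, i_l`, and `i_s` is the entry of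
the list at position `s - 1`.) -/
def pred (l : List ι) (k : ℕ) : ℕ :=
  ((Finset.Icc 1 (k - 1)).filter fun s => l[s - 1]? = l[k - 1]?).sup id

end CartanDatum

end GPA

end

noncomputable section
set_option linter.unusedSectionVars false
namespace GPA.CartanDatum

/-! ### Sign coherence of the real roots -/

section Weyl

variable {ι : Type w} (𝒟 : CartanDatum ι) [Fintype ι]

/-! Write Q_w = Π e_i / I_w e_i, a cyclic module generated at the vertex i = i_k. The core is
N(-wϖ_i) ≅ Q_w^* for every reduced word w. Granting this, appending letters other than i to w does
not change I_w e_i. So for u = s_{i_1} ⋯ s_{i_{k-1}} the module V_{k⁻} is Q_u^*, it embeds in V_k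
dually to the projection Q_{u s_i} → Q_u, and the quotient is dual to I_u e_i / I_u I_i e_i ≅ I_u /
I_u I_i ≅ I_u ⊗ E_i. Any other embedding has the same image: forms in it vanish on I_u e_i, and
dimensions agree (`range_eq_ker_dualHom`).

Local tool: at a vertex j every module M has a complex of H_j-modules e_j M → ⨁_k jH_k ⊗ e_k M → e_j
M with maps M_out and M_in. The kernel of M_out is the part of M killed by I_j, and the image of
M_in is the e_j-part of I_j M. For M = Π e_i the complex is exact in the middle
(`exists_outMap_eq_P`): let Π act on Π ⊕ coker M_out. It follows that, when i occurs in w, the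
kernel of Π e_i / I_j I_w e_i → Q_w at j is the middle homology of the complex of Q_w. If M_out is
injective for Q_w, this homology is free over H_j and its rank is the one prescribed by the
reflection s_j. By induction on the word, Q_w is locally free with rank vector wλ - λ, where λ =
-ϖ_i (`isExtremal_of_isReduced`).

Injectivity of M_out and uniqueness of N both come from one numerical argument, `extremal_cyclic`.
In a cyclic module generated at i, the part killed by I_j has dimension at least what the Cartan
pairing demands (`finrank_idemTor_ge`). Dividing it out therefore reflects the dimension vector by
s_j, up to an excess y α_j with y ≥ 0. Along a reduced word these excesses are carried to
nonnegative combinations of positive roots. At the end the remaining module would have minus their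
sum as its dimension vector, so every excess is zero. Hence a generator of a cyclic module with the
dimensions of Q_w is killed by I_w, and Q_w contains nothing killed by I_j if s_j w is longer than
w. The positivity used is w⁻¹α_j ≥ 0 for reduced s_j w, which is proved with the invariant form and
a reduction to rank two.

Existence: frame Q_w^* by evaluation at the generator of Q_w. The result is stable because the
generator generates, and it is 𝔼-filtered because the layers I_{w'} e_i / I_j I_{w'} e_i are free
over H_j. Uniqueness: for a stable N with quotient V, the framing arrow i → i' followed by a
suitable form on e_{i'} N gives a linear form on V with no nonzero submodule in its kernel
(`exists_dual_of_framed`). This form generates V^*, so `extremal_cyclic` makes V^* a quotient of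
Q_w, and equality of dimensions gives an isomorphism. -/

/-- The invariant symmetric form `(α_i, α_j) = c_i c_ij` on the root lattice. -/
def rootForm : (ι → ℤ) →ₗ[ℤ] Module.Dual ℤ (ι → ℤ) :=
  ∑ i, (𝒟.c i : ℤ) • (LinearMap.proj i).smulRight (𝒟.corootR i)

theorem rootForm_apply (a b : ι → ℤ) :
    𝒟.rootForm a b = ∑ i, (𝒟.c i : ℤ) * (a i * 𝒟.corootR i b) := by
  simp [rootForm]

theorem rootForm_symm (a b : ι → ℤ) : 𝒟.rootForm a b = 𝒟.rootForm b a := by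
  simp only [rootForm_apply, corootR_apply, Finset.mul_sum]
  rw [Finset.sum_comm]
  refine Finset.sum_congr rfl fun i _ => Finset.sum_congr rfl fun j _ => ?_
  have := 𝒟.symm i j
  linear_combination (-(a j * b i)) * this

variable [DecidableEq ι]

theorem corootR_single (i j : ι) : 𝒟.corootR i (Pi.single j 1) = 𝒟.C i j := by
  rw [corootR_apply, Finset.sum_eq_single j] <;> simp +contextual

theorem s_apply (i : ι) (a : ι → ℤ) : 𝒟.s i a = a - 𝒟.corootR i a • Pi.single i 1 :=
  Module.reflection_apply _ _

theorem s_apply_of_ne {i k : ι} (h : k ≠ i) (a : ι → ℤ) : 𝒟.s i a k = a k := by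
  simp [s_apply, h]

theorem s_single_self (i : ι) : 𝒟.s i (Pi.single i 1) = -Pi.single i 1 := by
  rw [s_apply, corootR_single, 𝒟.diag]; module

@[simp] theorem s_s (i : ι) (a : ι → ℤ) : 𝒟.s i (𝒟.s i a) = a :=
  Module.involutive_reflection _ a

theorem s_mul_s (i : ι) : 𝒟.s i * 𝒟.s i = 1 := by
  ext1 a; exact 𝒟.s_s i a

theorem rootForm_single (i : ι) (b : ι → ℤ) :
    𝒟.rootForm (Pi.single i 1) b = 𝒟.c i * 𝒟.corootR i b := by
  rw [rootForm_apply, Finset.sum_eq_single i] <;> simp +contextual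

theorem rootForm_s (i : ι) (a b : ι → ℤ) : 𝒟.rootForm (𝒟.s i a) (𝒟.s i b) = 𝒟.rootForm a b := by
  have h1 : 𝒟.rootForm a (Pi.single i 1) = 𝒟.c i * 𝒟.corootR i a := by
    rw [rootForm_symm, rootForm_single]
  simp only [s_apply, map_sub, map_smul, LinearMap.sub_apply, LinearMap.smul_apply, h1,
    rootForm_single, corootR_single, 𝒟.diag, smul_eq_mul]
  ring

/-- The element `s_{i_1} ⋯ s_{i_l}` of the Weyl group. -/
abbrev weyl (l : List ι) : (ι → ℤ) ≃ₗ[ℤ] (ι → ℤ) := (l.map 𝒟.s).prod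

theorem weyl_nil : 𝒟.weyl [] = 1 := rfl

theorem weyl_cons_apply (i : ι) (l : List ι) (a : ι → ℤ) :
    𝒟.weyl (i :: l) a = 𝒟.s i (𝒟.weyl l a) := by
  simp [weyl]

theorem weyl_append (l l' : List ι) : 𝒟.weyl (l ++ l') = 𝒟.weyl l * 𝒟.weyl l' := by
  simp [weyl]

theorem weyl_reverse (l : List ι) : 𝒟.weyl l.reverse = (𝒟.weyl l)⁻¹ := by
  induction l with
  | nil => simp [weyl_nil]
  | cons i l ih =>
    rw [List.reverse_cons, weyl_append, ih]
    simp only [weyl, List.map_cons, List.map_nil, List.prod_cons, List.prod_nil, mul_one,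
      mul_inv_rev]
    congr 1

theorem rootForm_weyl (l : List ι) (a b : ι → ℤ) :
    𝒟.rootForm (𝒟.weyl l a) (𝒟.weyl l b) = 𝒟.rootForm a b := by
  induction l with
  | nil => rfl
  | cons i l ih => rw [weyl_cons_apply, weyl_cons_apply, rootForm_s, ih]

/-- A vector of the root lattice whose coordinates all have the same sign. -/
def SignCoherent (a : ι → ℤ) : Prop := 0 ≤ a ∨ a ≤ 0

/-- The element w is an isometry, so α_i and α_j have equal length, that is c_i = c_j. Comparing the
forms then gives ⟨w a, α_j^∨⟩ = ⟨a, α_i^∨⟩. -/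
theorem weyl_mul_s_of_eq_single {l : List ι} {i j : ι}
    (h : 𝒟.weyl l (Pi.single i 1) = Pi.single j 1) : 𝒟.weyl l * 𝒟.s i = 𝒟.s j * 𝒟.weyl l := by
  ext1 a
  have hc : 𝒟.rootForm (Pi.single i 1) (Pi.single i 1) =
      𝒟.rootForm (Pi.single j 1) (Pi.single j 1) := by
    rw [← h, rootForm_weyl]
  have h1 : 𝒟.rootForm (Pi.single j 1) (𝒟.weyl l a) = 𝒟.rootForm (Pi.single i 1) a := by
    rw [← h, rootForm_weyl]
  have hi := 𝒟.one_le_c i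
  simp only [rootForm_single, corootR_single, 𝒟.diag] at hc h1
  have hcc : (𝒟.c i : ℤ) = 𝒟.c j := by omega
  have h2 : 𝒟.corootR j (𝒟.weyl l a) = 𝒟.corootR i a := by
    rw [← hcc] at h1
    exact mul_left_cancel₀ (by omega) h1
  change 𝒟.weyl l (𝒟.s i a) = 𝒟.s j (𝒟.weyl l a)
  rw [s_apply, s_apply, h2, map_sub, map_smul, h]

/-- A reflection s_j changes only the j-th coordinate, so a positive root made negative by it is a
multiple of α_j. Applying w⁻¹ shows that the multiple divides 1. -/
theorem eq_single_of_s_nonpos {l : List ι} {i j : ι}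
    (h0 : 0 ≤ 𝒟.weyl l (Pi.single i 1)) (h1 : 𝒟.s j (𝒟.weyl l (Pi.single i 1)) ≤ 0) :
    𝒟.weyl l (Pi.single i 1) = Pi.single j 1 := by
  set b := 𝒟.weyl l (Pi.single i 1) with hb
  have h2 : b = b j • Pi.single j 1 := by
    ext k
    by_cases hk : k = j
    · subst hk; simp
    · have := h1 k
      rw [s_apply_of_ne _ hk] at this
      have h3 := h0 k
      simp only [Pi.zero_apply] at this h3
      simp [hk]; omega
  have h3 : Pi.single i (1 : ℤ) = b j • (𝒟.weyl l).symm (Pi.single j 1) := by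
    rw [← map_smul, ← h2, hb, LinearEquiv.symm_apply_apply]
  have h4 := congrFun h3 i
  simp only [Pi.single_eq_same, Pi.smul_apply, smul_eq_mul] at h4
  have h5 : b j = 1 := Int.eq_one_of_dvd_one (h0 j) (Dvd.intro _ h4.symm)
  rw [h2, h5, one_smul]

/-- The exchange condition. Reading the word from the right, the root α_i changes sign at some
letter j. At that moment it equals α_j, and this letter can be deleted. Sign coherence is a
hypothesis because the lemma is used in the induction that proves it. -/
theorem exists_shorter_of_nonpos (i : ι) (l : List ι)
    (hcoh : ∀ l', l'.length ≤ l.length → SignCoherent (𝒟.weyl l' (Pi.single i 1)))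
    (h : 𝒟.weyl l (Pi.single i 1) ≤ 0) :
    ∃ l', l'.length + 1 = l.length ∧ 𝒟.weyl l' = 𝒟.weyl l * 𝒟.s i := by
  induction l with
  | nil =>
    have := h i
    simp [weyl_nil] at this
  | cons j l ih =>
    rcases hcoh l (by simp) with h0 | h0
    · have h1 := 𝒟.weyl_mul_s_of_eq_single (𝒟.eq_single_of_s_nonpos h0
        (by rwa [weyl_cons_apply] at h))
      refine ⟨l, rfl, ?_⟩
      have : 𝒟.weyl (j :: l) = 𝒟.s j * 𝒟.weyl l := by simp [weyl]
      rw [this, mul_assoc, h1, ← mul_assoc, s_mul_s, one_mul]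
    · obtain ⟨l', h1, h2⟩ := ih (fun l' hl' => hcoh l' (by simp; omega)) h0
      refine ⟨j :: l', by simp [h1], ?_⟩
      have h3 : ∀ m, 𝒟.weyl (j :: m) = 𝒟.s j * 𝒟.weyl m := fun m => by simp [weyl]
      rw [h3, h2, h3, mul_assoc]

/-- Invariance of the form gives c_i x² + c_i c_ij x y + c_j y² = c_i. For integers with x y < 0 the
cross term is nonnegative, so the left side is at least c_i + c_j. -/
theorem weyl_single_rankTwo {i j : ι} (hij : i ≠ j) (l : List ι) (hl : ∀ x ∈ l, x = i ∨ x = j) :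
    ∃ x y : ℤ, 𝒟.weyl l (Pi.single i 1) = x • Pi.single i 1 + y • Pi.single j 1 ∧
      ((0 ≤ x ∧ 0 ≤ y) ∨ (x ≤ 0 ∧ y ≤ 0)) := by
  have h : ∃ x y : ℤ, 𝒟.weyl l (Pi.single i 1) = x • Pi.single i 1 + y • Pi.single j 1 := by
    induction l with
    | nil => exact ⟨1, 0, by simp [weyl_nil]⟩
    | cons k l ih =>
      obtain ⟨x, y, h⟩ := ih fun x hx => hl x (by simp [hx])
      rw [weyl_cons_apply, h, s_apply]
      rcases hl k (by simp) with rfl | rfl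
      · exact ⟨x - 𝒟.corootR k (x • Pi.single k 1 + y • Pi.single j 1), y, by module⟩
      · exact ⟨x, y - 𝒟.corootR k (x • Pi.single i 1 + y • Pi.single k 1), by module⟩
  obtain ⟨x, y, h⟩ := h
  refine ⟨x, y, h, ?_⟩
  have h1 := 𝒟.rootForm_weyl l (Pi.single i 1) (Pi.single i 1)
  rw [h] at h1
  simp only [map_add, map_smul, LinearMap.add_apply, LinearMap.smul_apply, rootForm_single,
    corootR_single, 𝒟.diag, smul_eq_mul] at h1
  have h2 := 𝒟.symm i j
  have h3 := 𝒟.offDiag i j hij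
  have hi := 𝒟.one_le_c i
  have hj := 𝒟.one_le_c j
  by_contra hcon
  have hxy : x * y < 0 := by
    rcases lt_trichotomy x 0 with hx | hx | hx <;> rcases lt_trichotomy y 0 with hy | hy | hy
    all_goals first
      | (exfalso; apply hcon; omega)
      | nlinarith
  have hx : 1 ≤ x ^ 2 := by
    have : x ≠ 0 := by rintro rfl; simp at hxy
    have := sq_pos_of_ne_zero this
    omega
  have hy : 1 ≤ y ^ 2 := by
    have : y ≠ 0 := by rintro rfl; simp at hxy
    have := sq_pos_of_ne_zero this
    omega
  have h4 : (0 : ℤ) ≤ (𝒟.c i * 𝒟.C i j) * (x * y) :=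
    mul_nonneg_of_nonpos_of_nonpos (mul_nonpos_of_nonneg_of_nonpos (by positivity) h3) hxy.le
  have hi' : (1 : ℤ) ≤ 𝒟.c i := by exact_mod_cast hi
  have hj' : (1 : ℤ) ≤ 𝒟.c j := by exact_mod_cast hj
  have h5 : (𝒟.c i : ℤ) ≤ 𝒟.c i * x ^ 2 := le_mul_of_one_le_right (by omega) hx
  have h6 : (𝒟.c j : ℤ) ≤ 𝒟.c j * y ^ 2 := le_mul_of_one_le_right (by omega) hy
  have h7 : 2 * ((𝒟.c i : ℤ) * x ^ 2) + 2 * ((𝒟.c i * 𝒟.C i j) * (x * y)) +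
      2 * (𝒟.c j * y ^ 2) = 2 * 𝒟.c i := by
    linear_combination h1 + (x * y) * h2
  omega

/-- For a word ending in j ≠ i, write the element as v u with u a word in i and j, and v of minimal
length. By minimality v α_i and v α_j are positive, and u α_i is a combination of α_i and α_j with
coefficients of one sign. If j = i, the last letter only flips the sign. -/
theorem signCoherent_weyl_of_length_le (n : ℕ) : ∀ l : List ι, l.length ≤ n → ∀ i,
    SignCoherent (𝒟.weyl l (Pi.single i 1)) := by
  induction n with
  | zero =>
    intro l hl i
    obtain rfl : l = [] := by simpa using hl
    exact Or.inl (by simp [weyl_nil])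
  | succ n ih =>
    intro l hl i
    rcases List.eq_nil_or_concat l with rfl | ⟨l₀, j, hl₀⟩
    · exact Or.inl (by simp [weyl_nil])
    rw [List.concat_eq_append] at hl₀
    subst hl₀
    have hlen : l₀.length ≤ n := by simpa using hl
    by_cases hij : i = j
    · subst hij
      have : 𝒟.weyl (l₀ ++ [i]) (Pi.single i 1) = -𝒟.weyl l₀ (Pi.single i 1) := by
        rw [weyl_append, LinearEquiv.mul_apply, ← map_neg, ← 𝒟.s_single_self]
        simp [weyl]
      rw [this]
      rcases ih l₀ hlen i with h | h
      · exact Or.inr (by simpa using h)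
      · exact Or.inl (by simpa using h)
    classical
    let p : ℕ → Prop := fun m => ∃ v u : List ι, v.length = m ∧ (∀ x ∈ u, x = i ∨ x = j) ∧
      𝒟.weyl v * 𝒟.weyl u = 𝒟.weyl (l₀ ++ [j])
    have hp : ∃ m, p m := ⟨l₀.length, l₀, [j], rfl, by simp, (weyl_append _ _ _).symm⟩
    obtain ⟨v, u, hv, hu, hvu⟩ := Nat.find_spec hp
    have hvn : v.length ≤ n := by
      rw [hv]
      exact (Nat.find_min' hp ⟨l₀, [j], rfl, by simp, (weyl_append _ _ _).symm⟩).trans hlen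
    have hpos : ∀ q, (q = i ∨ q = j) → 0 ≤ 𝒟.weyl v (Pi.single q 1) := by
      intro q hq
      rcases ih v hvn q with h | h
      · exact h
      exfalso
      -- If v α_q were negative, exchange would move a letter q from v to u, against the minimality
      -- of v.
      obtain ⟨v', h1, h2⟩ := 𝒟.exists_shorter_of_nonpos q v
        (fun l' hl' => ih l' (hl'.trans hvn) q) h
      refine Nat.find_min hp (m := v'.length) (by omega) ⟨v', q :: u, rfl, ?_, ?_⟩
      · intro x hx
        rcases List.mem_cons.1 hx with rfl | hx
        · exact hq
        · exact hu x hx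
      · rw [h2, ← hvu]
        have : 𝒟.weyl (q :: u) = 𝒟.s q * 𝒟.weyl u := by simp [weyl]
        rw [this, mul_assoc, ← mul_assoc (𝒟.s q), s_mul_s, one_mul]
    obtain ⟨x, y, hxy, hsign⟩ := 𝒟.weyl_single_rankTwo hij u hu
    have h1 := hpos i (Or.inl rfl)
    have h2 := hpos j (Or.inr rfl)
    rw [← hvu, LinearEquiv.mul_apply, hxy, map_add, map_smul, map_smul]
    rcases hsign with ⟨hx, hy⟩ | ⟨hx, hy⟩
    · exact Or.inl (add_nonneg (smul_nonneg hx h1) (smul_nonneg hy h2))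
    · exact Or.inr (add_nonpos (smul_nonpos_of_nonpos_of_nonneg hx h1)
        (smul_nonpos_of_nonpos_of_nonneg hy h2))

theorem IsReduced.of_append_left {l l' : List ι} (h : 𝒟.IsReduced (l ++ l')) : 𝒟.IsReduced l := by
  intro m hm
  have := h (m ++ l') (by rw [List.map_append, List.map_append, List.prod_append, hm,
    List.prod_append])
  simpa using this

theorem IsReduced.of_append_right {l l' : List ι} (h : 𝒟.IsReduced (l ++ l')) :
    𝒟.IsReduced l' := by
  intro m hm
  have := h (l ++ m) (by rw [List.map_append, List.map_append, List.prod_append, hm,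
    List.prod_append])
  simpa using this

/-- If `s_j w` is longer than `w`, then `w⁻¹ α_j` is a positive root. -/
theorem IsReduced.weyl_symm_single_nonneg {j : ι} {l : List ι} (h : 𝒟.IsReduced (j :: l)) :
    0 ≤ (𝒟.weyl l).symm (Pi.single j 1) := by
  change 0 ≤ (𝒟.weyl l)⁻¹ (Pi.single j 1)
  rw [← weyl_reverse]
  rcases 𝒟.signCoherent_weyl_of_length_le _ l.reverse le_rfl j with h0 | h0
  · exact h0
  exfalso
  -- If w⁻¹α_j were negative, w⁻¹ s_j would have a word one letter shorter than that of w⁻¹.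
  -- Reversed, it is a word for s_j w two letters shorter than j :: l.
  obtain ⟨l', h1, h2⟩ := 𝒟.exists_shorter_of_nonpos j l.reverse
    (fun l' hl' => 𝒟.signCoherent_weyl_of_length_le _ l' hl' j) h0
  have := h l'.reverse (by
    change 𝒟.weyl _ = 𝒟.weyl _
    have h3 : 𝒟.weyl (j :: l) = 𝒟.s j * 𝒟.weyl l := by simp [weyl]
    rw [weyl_reverse, h2, weyl_reverse, mul_inv_rev, inv_inv, h3]
    rfl)
  simp at this h1
  omega

end Weyl

end GPA.CartanDatum

namespace GPA

/-! ### Nilpotent endomorphisms with free `K[ε]/(ε^c)`-module structure -/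

section Crit

variable {K : Type*} [Field K] {V W : Type*} [AddCommGroup V] [Module K V]
  [AddCommGroup W] [Module K W]

/-- For `ε ^ c = 0`, this says that `ε` makes `V` a free module over `K[ε]/(ε^c)`. -/
def IsFreeNilp (c : ℕ) (ε : Module.End K V) : Prop :=
  ∀ x, ε x = 0 → ∃ y, x = (ε ^ (c - 1)) y

variable {c : ℕ} {ε : Module.End K V}

/-- Induction on a: ε^a x is killed by ε, hence equals ε^(c-1) y. Subtracting ε^(c-1-a) y from x
leaves an element killed by ε^a. -/
theorem IsFreeNilp.exists_eq_pow (h : IsFreeNilp c ε) {a : ℕ} (ha : a ≤ c) :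
    ∀ x, (ε ^ a) x = 0 → ∃ y, x = (ε ^ (c - a)) y := by
  induction a with
  | zero => intro x hx; exact ⟨0, by simpa using hx⟩
  | succ a ih =>
    intro x hx
    rw [pow_succ', Module.End.mul_apply] at hx
    obtain ⟨y, hy⟩ := h _ hx
    have h1 : c - 1 = a + (c - (a + 1)) := by omega
    have h2 : (ε ^ a) (x - (ε ^ (c - (a + 1))) y) = 0 := by
      rw [map_sub, hy, h1, pow_add, Module.End.mul_apply, sub_self]
    obtain ⟨z, hz⟩ := ih (by omega) _ h2
    refine ⟨y + ε z, ?_⟩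
    have h3 : c - a = (c - (a + 1)) + 1 := by omega
    rw [h3, pow_succ, Module.End.mul_apply] at hz
    rw [map_add, ← hz]; abel

theorem pow_apply_comm_of_comp {f : V →ₗ[K] W} {ε : Module.End K V} {ε' : Module.End K W}
    (h : ∀ x, f (ε x) = ε' (f x)) (n : ℕ) (x : V) : f ((ε ^ n) x) = (ε' ^ n) (f x) := by
  induction n with
  | zero => simp
  | succ n ih => rw [pow_succ', pow_succ', Module.End.mul_apply, Module.End.mul_apply, h, ih]

/-- An extension of a free module by a free module is free; `hker` is the freeness of the kernel of
g. -/
theorem IsFreeNilp.extension {εV : Module.End K V} {εW : Module.End K W} (hW : IsFreeNilp c εW)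
    (hc : 1 ≤ c) (hV : εV ^ c = 0) {g : V →ₗ[K] W} (hg : Function.Surjective g)
    (hεg : ∀ x, g (εV x) = εW (g x))
    (hker : ∀ x, g x = 0 → εV x = 0 → ∃ y, g y = 0 ∧ x = (εV ^ (c - 1)) y) :
    IsFreeNilp c εV := by
  intro b hb
  obtain ⟨w, hw⟩ := hW (g b) (by rw [← hεg, hb, map_zero])
  obtain ⟨b', rfl⟩ := hg w
  obtain ⟨a, -, ha⟩ := hker (b - (εV ^ (c - 1)) b')
    (by rw [map_sub, hw, pow_apply_comm_of_comp hεg, sub_self])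
    (by
      have : εV ((εV ^ (c - 1)) b') = 0 := by
        rw [← Module.End.mul_apply, ← pow_succ', Nat.sub_add_cancel hc, hV]; rfl
      rw [map_sub, hb, this, sub_zero])
  refine ⟨b' + a, ?_⟩
  rw [map_add, ← ha]; abel

/-- Freeness of the middle homology of a complex `F → G → F` that is exact at the left end, where
`F`, `G` and the cokernel at the right end are free. -/
theorem IsFreeNilp.homology {F G : Type*} [AddCommGroup F] [Module K F] [AddCommGroup G]
    [Module K G] {εF : Module.End K F} {εG : Module.End K G} (hF : IsFreeNilp c εF)
    (hG : IsFreeNilp c εG) (hc : 1 ≤ c) (hF0 : εF ^ c = 0) (hG0 : εG ^ c = 0)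
    {o : F →ₗ[K] G} {n : G →ₗ[K] F} (ho : Function.Injective o) (hno : ∀ x, n (o x) = 0)
    (hεo : ∀ x, o (εF x) = εG (o x)) (hεn : ∀ x, n (εG x) = εF (n x))
    (hcoker : ∀ x, εF x ∈ LinearMap.range n → ∃ y, x - (εF ^ (c - 1)) y ∈ LinearMap.range n)
    (z : G) (hz : n z = 0) (hεz : εG z ∈ LinearMap.range o) :
    ∃ z', n z' = 0 ∧ z - (εG ^ (c - 1)) z' ∈ LinearMap.range o := by
  have hGc : ∀ x, (εG ^ (c - 1)) (εG x) = 0 := fun x => by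
    rw [← Module.End.mul_apply, ← pow_succ, Nat.sub_add_cancel hc, hG0]; rfl
  obtain ⟨p, hp⟩ := hεz
  have h1 : (εF ^ (c - 1)) p = 0 := ho (by
    rw [pow_apply_comm_of_comp hεo, hp, hGc, map_zero])
  obtain ⟨p', hp'⟩ := hF.exists_eq_pow (Nat.sub_le c 1) _ h1
  rw [Nat.sub_sub_self hc, pow_one] at hp'
  -- Modulo the image of o the element z is now killed by ε in the free module G, so it is ε^(c-1)
  -- u. It remains to replace u by an element of the kernel of n.
  obtain ⟨u, hu⟩ := hG (z - o p') (by rw [map_sub, ← hεo, ← hp', hp, sub_self])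
  have h2 : (εF ^ (c - 1)) (n u) = 0 := by
    rw [← pow_apply_comm_of_comp hεn, ← hu, map_sub, hz, hno, sub_zero]
  obtain ⟨x, hx⟩ := hF.exists_eq_pow (Nat.sub_le c 1) _ h2
  rw [Nat.sub_sub_self hc, pow_one] at hx
  -- Here n u = ε x, and freeness of the cokernel gives x = ε^(c-1) y + n v. Thus n u = ε n v, and u
  -- - ε v lies in the kernel of n with the same image under ε^(c-1).
  obtain ⟨y, v, hv⟩ := hcoker x (hx ▸ ⟨u, rfl⟩)
  refine ⟨u - εG v, ?_, p', ?_⟩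
  · have : εF ((εF ^ (c - 1)) y) = 0 := by
      rw [← Module.End.mul_apply, ← pow_succ', Nat.sub_add_cancel hc, hF0]; rfl
    rw [map_sub, hεn, hv, map_sub, this, hx, sub_zero, sub_self]
  · rw [map_sub, hGc, sub_zero, ← hu]; abel

end Crit

/-! ### Truncated polynomial algebras -/

section TruncPoly

open CartanDatum Polynomial

variable (K : Type u) [Field K] (c : ℕ)

/-- The class of the variable. -/
def truncX : TruncPoly K c := Ideal.Quotient.mk _ X

theorem truncX_pow : truncX K c ^ c = 0 := by
  rw [truncX, ← map_pow]
  exact Ideal.Quotient.eq_zero_iff_mem.2 (Ideal.mem_span_singleton_self _)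

theorem truncX_pow_mul_eq_zero {a : ℕ} {p : K[X]} :
    truncX K c ^ a * Ideal.Quotient.mk _ p = 0 ↔ X ^ c ∣ X ^ a * p := by
  rw [truncX, ← map_pow, ← map_mul, Ideal.Quotient.eq_zero_iff_mem, Ideal.mem_span_singleton]

variable {K c}

theorem truncX_pow_pred_ne_zero (hc : 1 ≤ c) : truncX K c ^ (c - 1) ≠ 0 := by
  intro h
  have := (truncX_pow_mul_eq_zero K c (p := 1)).1 (by simpa using h)
  rw [mul_one] at this
  have h1 := (pow_dvd_pow_iff X_ne_zero not_isUnit_X).1 this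
  omega

theorem truncX_pow_mul_eq_zero_iff {a : ℕ} (ha : a ≤ c) (h : TruncPoly K c) :
    truncX K c ^ a * h = 0 ↔ ∃ h', h = truncX K c ^ (c - a) * h' := by
  constructor
  · obtain ⟨p, rfl⟩ := Ideal.Quotient.mk_surjective h
    rw [truncX_pow_mul_eq_zero]
    intro h1
    have h2 : (X : K[X]) ^ c = X ^ a * X ^ (c - a) := by rw [← pow_add]; congr 1; omega
    rw [h2] at h1
    obtain ⟨q, rfl⟩ := (mul_dvd_mul_iff_left (pow_ne_zero a X_ne_zero)).1 h1
    exact ⟨Ideal.Quotient.mk _ q, by rw [map_mul, map_pow]; rfl⟩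
  · rintro ⟨h', rfl⟩
    rw [← mul_assoc, ← pow_add, Nat.add_sub_cancel' ha, truncX_pow, zero_mul]

theorem exists_eq_algebraMap_add_truncX_mul (h : TruncPoly K c) :
    ∃ (k : K) (h' : TruncPoly K c), h = algebraMap K _ k + truncX K c * h' := by
  obtain ⟨p, rfl⟩ := Ideal.Quotient.mk_surjective h
  refine ⟨p.coeff 0, Ideal.Quotient.mk _ p.divX, ?_⟩
  conv_lhs => rw [← X_mul_divX_add p, map_add, map_mul, add_comm]
  rfl

theorem finrank_truncPoly : Module.finrank K (TruncPoly K c) = c := by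
  have := finrank_quotient_span_eq_natDegree (K := K) (f := X ^ c)
  simpa using this

instance finite_truncPoly : Module.Finite K (TruncPoly K c) :=
  (Polynomial.monic_X_pow c).finite_quotient

theorem algHom_ext_truncPoly {B : Type*} [Ring B] [Algebra K B] {f g : TruncPoly K c →ₐ[K] B}
    (h : f (truncX K c) = g (truncX K c)) : f = g :=
  Ideal.Quotient.algHom_ext _ (Polynomial.algHom_ext h)

/-- The homomorphism out of `K[ε]/(ε^c)` sending `ε` to a given element. -/
def truncLift {B : Type*} [Ring B] [Algebra K B] (x : B) (hx : x ^ c = 0) :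
    TruncPoly K c →ₐ[K] B :=
  Ideal.Quotient.liftₐ (Ideal.span {(X : K[X]) ^ c}) (aeval x) (by
    intro a ha
    obtain ⟨b, rfl⟩ := Ideal.mem_span_singleton.1 ha
    simp [hx])

@[simp] theorem truncLift_truncX {B : Type*} [Ring B] [Algebra K B] (x : B) (hx : x ^ c = 0) :
    truncLift (K := K) x hx (truncX K c) = x := by
  unfold truncLift truncX
  exact (Ideal.Quotient.lift_mk _ _ _).trans (aeval_X x)

theorem truncPoly_induction {P : TruncPoly K c → Prop} (h0 : P 0)
    (h1 : ∀ (k : K) (h), P h → P (algebraMap K _ k + truncX K c * h)) (h : TruncPoly K c) :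
    P h := by
  obtain ⟨p, rfl⟩ := Ideal.Quotient.mk_surjective h
  induction hn : p.natDegree using Nat.strong_induction_on generalizing p with
  | _ n ih =>
    by_cases hp : p.natDegree = 0
    · rw [Polynomial.eq_C_of_natDegree_eq_zero hp]
      have := h1 (p.coeff 0) 0 h0
      rw [mul_zero, add_zero] at this
      exact this
    · have := h1 (p.coeff 0) _ (ih p.divX.natDegree (by rw [natDegree_divX_eq_natDegree_tsub_one]
                                                        omega) p.divX rfl)
      convert this using 1
      conv_lhs => rw [← X_mul_divX_add p, map_add, map_mul, add_comm]
      rfl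

/-- A basis is given by elements y_i for which ε^(c-1) y_i runs through a K-basis of the socle ker
ε. Independence and spanning both follow by descending to the socle with powers of ε. -/
theorem free_of_isFreeNilp {V : Type*} [AddCommGroup V] [Module K V] [Module (TruncPoly K c) V]
    [IsScalarTower K (TruncPoly K c) V] [Module.Finite K V] (hc : 1 ≤ c)
    (h : ∀ x : V, truncX K c • x = 0 → ∃ y, x = truncX K c ^ (c - 1) • y) :
    Module.Free (TruncPoly K c) V := by
  set R := TruncPoly K c
  let B : Submodule K V := LinearMap.ker (Algebra.lsmul K K V (truncX K c))
  let b := Module.finBasis K B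
  have hb : ∀ i, ∃ y, (b i : V) = truncX K c ^ (c - 1) • y := fun i => h _ (b i).2
  choose y hy using hb
  have hli : LinearIndependent R y := by
    rw [Fintype.linearIndependent_iff]
    intro g hg
    -- If all coefficients are divisible by ε^a, multiplying the relation by ε^(c-1-a) gives a
    -- K-linear relation in the socle. So the coefficients of ε^a vanish.
    have key : ∀ a ≤ c, ∀ i, ∃ g', g i = truncX K c ^ a * g' := by
      intro a
      induction a with
      | zero => exact fun _ i => ⟨g i, by simp⟩
      | succ a ih =>
        intro ha
        choose g' hg' using ih (by omega)
        choose k g'' hk using fun i => exists_eq_algebraMap_add_truncX_mul (g' i)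
        have h1 : ∑ i, k i • b i = 0 := by
          apply Subtype.ext
          have h2 := congrArg (fun v => truncX K c ^ (c - (a + 1)) • v) hg
          simp only [Finset.smul_sum, smul_zero] at h2
          rw [Submodule.coe_zero, ← h2, Submodule.coe_sum]
          refine Finset.sum_congr rfl fun i _ => ?_
          have h3 : truncX K c ^ (c - (a + 1)) * g i = algebraMap K R (k i) * truncX K c ^ (c - 1) := by
            rw [hg', hk, ← mul_assoc, ← pow_add, mul_add, ← mul_assoc, ← pow_succ,
              show c - (a + 1) + a = c - 1 by omega, Nat.sub_add_cancel hc, truncX_pow, zero_mul,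
              add_zero, mul_comm]
          rw [smul_smul, h3, mul_smul, algebraMap_smul, ← hy]
          rfl
        have h4 := Fintype.linearIndependent_iff.1 b.linearIndependent k h1
        intro i
        refine ⟨g'' i, ?_⟩
        rw [hg', hk, h4, map_zero, zero_add, ← mul_assoc, pow_succ]
    intro i
    obtain ⟨g', h'⟩ := key c le_rfl i
    rw [h', truncX_pow, zero_mul]
  have hsp : ∀ a ≤ c, ∀ x : V, truncX K c ^ a • x = 0 → x ∈ Submodule.span R (Set.range y) := by
    intro a
    induction a with
    | zero => intro _ x hx; rw [pow_zero, one_smul] at hx; rw [hx]; exact zero_mem _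
    | succ a ih =>
      intro ha x hx
      have h1 : truncX K c ^ a • x ∈ B := by
        change truncX K c • truncX K c ^ a • x = 0
        rw [smul_smul, ← pow_succ', hx]
      have h2 := b.sum_repr ⟨_, h1⟩
      set k := b.repr ⟨_, h1⟩
      have h3 : truncX K c ^ a • (x - ∑ i, k i • truncX K c ^ (c - (a + 1)) • y i) = 0 := by
        have h4 := congrArg (Subtype.val) h2
        rw [Submodule.coe_sum] at h4
        rw [smul_sub, Finset.smul_sum, sub_eq_zero]
        refine h4.symm.trans ?_
        refine Finset.sum_congr rfl fun i _ => ?_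
        rw [smul_comm, smul_smul, ← pow_add, show a + (c - (a + 1)) = c - 1 by omega, ← hy]
        rfl
      have h5 := ih (by omega) _ h3
      have h6 : ∑ i, k i • truncX K c ^ (c - (a + 1)) • y i ∈ Submodule.span R (Set.range y) := by
        refine sum_mem fun i _ => ?_
        rw [← algebraMap_smul R (k i)]
        exact Submodule.smul_mem _ _ (Submodule.smul_mem _ _ (Submodule.subset_span ⟨i, rfl⟩))
      simpa using add_mem h5 h6
  refine Module.Free.of_basis (Module.Basis.mk hli fun x _ => hsp c le_rfl x ?_)
  rw [truncX_pow]
  exact zero_smul R x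

end TruncPoly

end GPA

namespace GPA

/-! ### Adjoining an `n`-th root to an endomorphism -/

section Shift

variable {K : Type*} [Field K] {V : Type*} [AddCommGroup V] [Module K V]

/-- The cyclic shift on `V^n` whose `n`-th power is `β` in each coordinate. -/
def shift (n : ℕ) (β : Module.End K V) : Module.End K (Fin n → V) where
  toFun z f := if h : f.1 = 0 then β (z ⟨n - 1, by omega⟩) else z ⟨f.1 - 1, by omega⟩
  map_add' x y := by ext f; by_cases h : f.1 = 0 <;> simp [h]
  map_smul' k x := by ext f; by_cases h : f.1 = 0 <;> simp [h]

variable {n : ℕ} {β : Module.End K V}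

theorem shift_apply (z : Fin n → V) (f : Fin n) : shift n β z f =
    if h : f.1 = 0 then β (z ⟨n - 1, by omega⟩) else z ⟨f.1 - 1, by omega⟩ := rfl

theorem shift_pow_apply {s : ℕ} (hs : s ≤ n) (z : Fin n → V) (f : Fin n) :
    (shift n β ^ s) z f = if h : f.1 < s then β (z ⟨f.1 + n - s, by omega⟩)
      else z ⟨f.1 - s, by omega⟩ := by
  induction s generalizing f with
  | zero => simp
  | succ s ih =>
    rw [pow_succ', Module.End.mul_apply, shift_apply]
    by_cases hf : f.1 = 0
    · rw [dif_pos hf, dif_pos (by omega), ih (by omega), dif_neg (by simp; omega)]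
      congr 2; ext; simp; omega
    · rw [dif_neg hf, ih (by omega)]
      by_cases hf' : f.1 < s + 1
      · rw [dif_pos hf', dif_pos (by simp; omega)]
        congr 2; ext; simp; omega
      · rw [dif_neg hf', dif_neg (by simp; omega)]
        congr 1; ext; simp; omega

theorem shift_pow_self_mul_apply (m : ℕ) (z : Fin n → V) (f : Fin n) :
    (shift n β ^ (n * m)) z f = (β ^ m) (z f) := by
  induction m generalizing z with
  | zero => simp
  | succ m ih =>
    rw [mul_add, mul_one, pow_add, Module.End.mul_apply, ih, shift_pow_apply le_rfl,
      dif_pos f.2, pow_succ, Module.End.mul_apply]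
    simp

theorem shift_pow_single (hn : 0 < n) {s : ℕ} (hs : s < n) (y : V) :
    (shift n β ^ s) (Pi.single ⟨0, hn⟩ y) = Pi.single ⟨s, hs⟩ y := by
  ext f
  rw [shift_pow_apply hs.le]
  by_cases hf : f.1 < s
  · rw [dif_pos hf, Pi.single_eq_of_ne, Pi.single_eq_of_ne, map_zero]
    · rintro rfl; simp at hf
    · intro h; have := congrArg Fin.val h; simp at this; omega
  · rw [dif_neg hf]
    by_cases hfs : f.1 = s
    · have h1 : f = ⟨s, hs⟩ := Fin.ext hfs
      subst h1; simp
    · rw [Pi.single_eq_of_ne, Pi.single_eq_of_ne]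
      · rintro rfl; simp at hfs
      · intro h; have := congrArg Fin.val h; simp at this; omega

/-- The shift raises the exponent of a by one; the last coordinate wraps around to exponent 0
through a^n γ = γ β. This is what makes M_in commute with ε_j. -/
theorem sum_pow_smul_shift (hn : 0 < n) {W : Type*} [AddCommGroup W] [Module K W]
    (a : Module.End K W) (γ : V →ₗ[K] W) (h : ∀ x, γ (β x) = (a ^ n) (γ x)) (z : Fin n → V) :
    ∑ f : Fin n, (a ^ f.1) (γ (shift n β z f)) = a (∑ f : Fin n, (a ^ f.1) (γ (z f))) := by
  obtain ⟨n, rfl⟩ : ∃ m, n = m + 1 := ⟨n - 1, by omega⟩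
  rw [Fin.sum_univ_succ, Fin.sum_univ_castSucc, map_add, map_sum, add_comm]
  congr 1
  · refine Finset.sum_congr rfl fun f _ => ?_
    rw [shift_apply, dif_neg (by simp), ← Module.End.mul_apply a, ← pow_succ']
    rfl
  · rw [shift_apply, dif_pos (by rfl), h, ← Module.End.mul_apply a, ← pow_succ']
    rfl

/-- A vector killed by the shift lives in the last coordinate and is killed by β there, hence is
β^(m-1) y. Since n m - 1 = n (m - 1) + (n - 1), it is reached from y placed in coordinate 0. -/
theorem IsFreeNilp.shift (hn : 0 < n) {m : ℕ} (hm : 0 < m) (h : IsFreeNilp m β) :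
    IsFreeNilp (n * m) (shift n β) := by
  intro z hz
  have h0 : ∀ f : Fin n, f.1 ≠ n - 1 → z f = 0 := by
    intro f hf
    have := congrFun hz ⟨f.1 + 1, by omega⟩
    rw [shift_apply, dif_neg (by simp)] at this
    exact this
  have h1 := congrFun hz ⟨0, hn⟩
  rw [shift_apply, dif_pos rfl] at h1
  obtain ⟨y, hy⟩ := h _ h1
  refine ⟨Pi.single ⟨0, hn⟩ y, ?_⟩
  obtain ⟨m, rfl⟩ : ∃ k, m = k + 1 := ⟨m - 1, by omega⟩
  rw [show n * (m + 1) - 1 = n * m + (n - 1) by rw [mul_add]; omega, pow_add,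
    Module.End.mul_apply, shift_pow_single hn (by omega)]
  ext f
  rw [shift_pow_self_mul_apply]
  by_cases hf : f.1 = n - 1
  · have hf' : f = ⟨n - 1, Nat.sub_one_lt_of_lt hn⟩ := Fin.ext hf
    rw [hf', Pi.single_eq_same]; exact hy
  · rw [h0 f hf, Pi.single_eq_of_ne, map_zero]
    rintro rfl; exact hf rfl

end Shift

namespace CartanDatum

/-! ### Arithmetic of the Cartan datum and rules for the generators -/

section Generators

variable {ι : Type w} {𝒟 : CartanDatum ι}

theorem ne_of_neg {j k : ι} (h : 𝒟.C j k < 0) : j ≠ k := by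
  rintro rfl
  have := 𝒟.diag j
  omega

theorem g_pos {j k : ι} (h : 𝒟.C j k < 0) : 0 < 𝒟.g j k :=
  Int.gcd_pos_of_ne_zero_left _ h.ne

theorem g_mul_f {j k : ι} : 𝒟.g j k * 𝒟.f j k = (𝒟.C j k).natAbs :=
  Nat.mul_div_cancel' (Int.natAbs_dvd_natAbs.2 (Int.gcd_dvd_left _ _))

theorem f_pos {j k : ι} (h : 𝒟.C j k < 0) : 0 < 𝒟.f j k := by
  refine Nat.pos_of_ne_zero fun h0 => ?_
  have := 𝒟.g_mul_f (j := j) (k := k)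
  rw [h0, mul_zero] at this
  omega

/-- Symmetry of DC gives c_j f_jk = c_k f_kj with f_jk and f_kj coprime. The number m is the
nilpotency order common to ε_j^(f_kj) and ε_k^(f_jk), which the arrows between j and k intertwine.
-/
theorem exists_c_eq {j k : ι} (h : 𝒟.C j k < 0) :
    ∃ m, 0 < m ∧ 𝒟.c j = 𝒟.f k j * m ∧ 𝒟.c k = 𝒟.f j k * m := by
  have hkj := 𝒟.neg_comm h
  have h1 : 𝒟.c j * 𝒟.f j k = 𝒟.c k * 𝒟.f k j := by
    have h2 := congrArg Int.natAbs (𝒟.symm j k)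
    rw [Int.natAbs_mul, Int.natAbs_mul, ← g_mul_f, ← g_mul_f, 𝒟.g_comm k j] at h2
    simp only [Int.natAbs_natCast] at h2
    refine Nat.eq_of_mul_eq_mul_left (g_pos h) ?_
    linarith
  have hcop : Nat.Coprime (𝒟.f j k) (𝒟.f k j) := by
    have h2 := Nat.coprime_div_gcd_div_gcd (g_pos h)
    unfold f
    rw [𝒟.g_comm k j]
    exact h2
  obtain ⟨m, hm⟩ : 𝒟.f k j ∣ 𝒟.c j := hcop.symm.dvd_of_dvd_mul_right (Dvd.intro_left _ h1.symm)
  refine ⟨m, Nat.pos_of_ne_zero ?_, hm, ?_⟩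
  · rintro rfl
    have := 𝒟.one_le_c j
    omega
  · rw [hm] at h1
    refine Nat.eq_of_mul_eq_mul_left (f_pos hkj) ?_
    linarith

theorem IsArrow.symm {i j : ι} {g : ℕ} (h : 𝒟.IsArrow i j g) : 𝒟.IsArrow j i g :=
  ⟨𝒟.neg_comm h.1, by rw [𝒟.g_comm]; exact h.2⟩

variable [Fintype ι] {K : Type u} [Field K]

theorem α_self (i : ι) (g : ℕ) : 𝒟.α K i i g = 0 :=
  (𝒟.relations K).α_eq_zero i i g fun h => ne_of_neg h.1 rfl

theorem proj_surjective : Function.Surjective (𝒟.proj K) := RingQuot.mkAlgHom_surjective _ _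

theorem alg_induction {P : 𝒟.Alg K → Prop} (algebraMap : ∀ k, P (algebraMap K _ k))
    (e : ∀ i, P (𝒟.e K i)) (ε : ∀ i, P (𝒟.ε K i)) (α : ∀ i j g, P (𝒟.α K i j g))
    (add : ∀ a b, P a → P b → P (a + b)) (mul : ∀ a b, P a → P b → P (a * b)) (a : 𝒟.Alg K) :
    P a := by
  obtain ⟨x, rfl⟩ := proj_surjective a
  induction x using FreeAlgebra.induction with
  | grade0 k => rw [AlgHom.commutes]; exact algebraMap k
  | grade1 x =>
    cases x with
    | e i => exact e i
    | eps i => exact ε i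
    | arr i j g => exact α i j g
  | mul a b ha hb => rw [map_mul]; exact mul _ _ ha hb
  | add a b ha hb => rw [map_add]; exact add _ _ ha hb

variable {M : Type v} [AddCommGroup M] [Module (𝒟.Alg K) M]

theorem e_smul_e_smul (i : ι) (x : M) : 𝒟.e K i • 𝒟.e K i • x = 𝒟.e K i • x := by
  rw [smul_smul, (𝒟.relations K).e_mul_self]

theorem e_smul_e_smul_of_ne {i j : ι} (h : i ≠ j) (x : M) : 𝒟.e K i • 𝒟.e K j • x = 0 := by
  rw [smul_smul, (𝒟.relations K).e_mul_e i j h, zero_smul]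

theorem e_smul_ε_smul (i : ι) (x : M) : 𝒟.e K i • 𝒟.ε K i • x = 𝒟.ε K i • x := by
  rw [smul_smul, (𝒟.relations K).e_mul_ε]

theorem e_smul_ε_smul_of_ne {i j : ι} (h : i ≠ j) (x : M) : 𝒟.e K i • 𝒟.ε K j • x = 0 := by
  rw [← e_smul_ε_smul, e_smul_e_smul_of_ne h]

theorem ε_smul_e_smul (i : ι) (x : M) : 𝒟.ε K i • 𝒟.e K i • x = 𝒟.ε K i • x := by
  rw [smul_smul, (𝒟.relations K).ε_mul_e]

theorem ε_mul_e_comm (i : ι) : 𝒟.ε K i * 𝒟.e K i = 𝒟.e K i * 𝒟.ε K i := by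
  rw [(𝒟.relations K).ε_mul_e, (𝒟.relations K).e_mul_ε]

theorem ε_smul_of_ne {i j : ι} (h : i ≠ j) {x : M} (hx : 𝒟.e K j • x = x) : 𝒟.ε K i • x = 0 := by
  rw [← hx, ← ε_smul_e_smul, e_smul_e_smul_of_ne h, smul_zero]

theorem e_smul_α_smul (i j : ι) (g : ℕ) (x : M) : 𝒟.e K i • 𝒟.α K i j g • x = 𝒟.α K i j g • x := by
  rw [smul_smul, (𝒟.relations K).e_mul_α]

theorem e_smul_α_smul_of_ne {k i : ι} (h : k ≠ i) (j : ι) (g : ℕ) (x : M) :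
    𝒟.e K k • 𝒟.α K i j g • x = 0 := by
  rw [← e_smul_α_smul, e_smul_e_smul_of_ne h]

theorem α_smul_e_smul (i j : ι) (g : ℕ) (x : M) : 𝒟.α K i j g • 𝒟.e K j • x = 𝒟.α K i j g • x := by
  rw [smul_smul, (𝒟.relations K).α_mul_e]

theorem α_smul_of_ne {i j k : ι} (h : j ≠ k) (g : ℕ) {x : M} (hx : 𝒟.e K k • x = x) :
    𝒟.α K i j g • x = 0 := by
  rw [← hx, ← α_smul_e_smul, e_smul_e_smul_of_ne h, smul_zero]

theorem sum_e_smul (x : M) : ∑ i, 𝒟.e K i • x = x := by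
  rw [← Finset.sum_smul, (𝒟.relations K).sum_e, one_smul]

variable [Module K M] [IsScalarTower K (𝒟.Alg K) M]

theorem smul_mem_of_generators {W : Submodule K M} (he : ∀ i, ∀ x ∈ W, 𝒟.e K i • x ∈ W)
    (hε : ∀ i, ∀ x ∈ W, 𝒟.ε K i • x ∈ W) (hα : ∀ i j g, ∀ x ∈ W, 𝒟.α K i j g • x ∈ W)
    (a : 𝒟.Alg K) : ∀ x ∈ W, a • x ∈ W := by
  induction a using alg_induction with
  | algebraMap k => intro x hx; rw [algebraMap_smul]; exact W.smul_mem _ hx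
  | e i => exact he i
  | ε i => exact hε i
  | α i j g => exact hα i j g
  | add a b ha hb => intro x hx; rw [add_smul]; exact W.add_mem (ha x hx) (hb x hx)
  | mul a b ha hb => intro x hx; rw [mul_smul]; exact ha _ (hb x hx)

end Generators

/-! ### The maps `M_in` and `M_out` at a vertex -/

section Tilde

variable {ι : Type w} (𝒟 : CartanDatum ι) [Fintype ι] (K : Type u) [Field K]
variable (M : Type v) [AddCommGroup M] [Module K M] [Module (𝒟.Alg K) M]
  [IsScalarTower K (𝒟.Alg K) M]

variable {M} in
theorem mem_vertexSpace {i : ι} {x : M} : x ∈ 𝒟.vertexSpace K M i ↔ 𝒟.e K i • x = x := by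
  constructor
  · rintro ⟨y, rfl⟩
    exact e_smul_e_smul i y
  · intro h
    exact ⟨x, h⟩

theorem coe_epsOn (i : ι) (x : 𝒟.vertexSpace K M i) :
    (𝒟.epsOn K M i x : M) = 𝒟.ε K i • (x : M) := rfl

theorem coe_epsOn_pow (i : ι) (n : ℕ) (x : 𝒟.vertexSpace K M i) :
    ((𝒟.epsOn K M i ^ n) x : M) = 𝒟.ε K i ^ n • (x : M) := by
  induction n with
  | zero => simp
  | succ n ih => rw [pow_succ', Module.End.mul_apply, coe_epsOn, ih, smul_smul, pow_succ']

/-- The multiplication by `α_ij^(g)` from `e_j M` to `e_i M`. -/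
def arrowOn (i j : ι) (g : ℕ) : 𝒟.vertexSpace K M j →ₗ[K] 𝒟.vertexSpace K M i :=
  (Algebra.lsmul K K M (𝒟.α K i j g)).restrict fun x _ =>
    (𝒟.mem_vertexSpace K).2 (e_smul_α_smul i j g x)

theorem coe_arrowOn (i j : ι) (g : ℕ) (x : 𝒟.vertexSpace K M j) :
    (𝒟.arrowOn K M i j g x : M) = 𝒟.α K i j g • (x : M) := rfl

/-- Indices for the basis `ε_j^s α_jk^(g)` of `⨁_k jH_k` as a right module. -/
abbrev TildeIdx (j : ι) : Type w := Σ k : {k // 𝒟.C j k < 0}, Fin (𝒟.g j k) × Fin (𝒟.f k j)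

/-- The space `⨁_k jH_k ⊗ e_k M`. -/
abbrev Tilde (j : ι) : Type (max v w) := (t : 𝒟.TildeIdx j) → 𝒟.vertexSpace K M t.1.1

/-- The endomorphism `ε_j` of `⨁_k jH_k ⊗ e_k M`. -/
def tildeEps (j : ι) : Module.End K (𝒟.Tilde K M j) where
  -- For a fixed arrow, the coordinate s stands for ε_j^s α_jk^(g) ⊗ e_k M. Multiplication by ε_j
  -- raises s, and ε_j^(f_kj) passes through the arrow as ε_k^(f_jk).
  toFun z t := shift (𝒟.f t.1 j) (𝒟.epsOn K M t.1 ^ 𝒟.f j t.1) (fun s => z ⟨t.1, t.2.1, s⟩) t.2.2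
  map_add' x y := by
    ext t
    exact congrArg Subtype.val (congrFun (map_add (shift (𝒟.f t.1 j) (𝒟.epsOn K M t.1 ^ 𝒟.f j t.1))
      (fun s => x ⟨t.1, t.2.1, s⟩) (fun s => y ⟨t.1, t.2.1, s⟩)) t.2.2)
  map_smul' r x := by
    ext t
    exact congrArg Subtype.val (congrFun (map_smul (shift (𝒟.f t.1 j) (𝒟.epsOn K M t.1 ^ 𝒟.f j t.1))
      r (fun s => x ⟨t.1, t.2.1, s⟩)) t.2.2)

theorem tildeEps_apply (j : ι) (z : 𝒟.Tilde K M j) (t : 𝒟.TildeIdx j) :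
    𝒟.tildeEps K M j z t = shift (𝒟.f t.1 j) (𝒟.epsOn K M t.1 ^ 𝒟.f j t.1)
      (fun s => z ⟨t.1, t.2.1, s⟩) t.2.2 := rfl

theorem tildeEps_pow_apply (j : ι) (n : ℕ) (z : 𝒟.Tilde K M j) (t : 𝒟.TildeIdx j) :
    (𝒟.tildeEps K M j ^ n) z t = (shift (𝒟.f t.1 j) (𝒟.epsOn K M t.1 ^ 𝒟.f j t.1) ^ n)
      (fun s => z ⟨t.1, t.2.1, s⟩) t.2.2 := by
  induction n generalizing t with
  | zero => rfl
  | succ n ih =>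
    rw [pow_succ', pow_succ', Module.End.mul_apply, Module.End.mul_apply]
    rw [tildeEps_apply]
    exact congrArg (fun y => shift _ _ y t.2.2) (funext fun s => ih ⟨t.1, t.2.1, s⟩)

theorem tildeEps_pow_c (j : ι) : 𝒟.tildeEps K M j ^ 𝒟.c j = 0 := by
  ext1 z
  funext t
  obtain ⟨m, -, h1, h2⟩ := exists_c_eq t.1.2
  rw [tildeEps_pow_apply, h1, shift_pow_self_mul_apply, ← pow_mul, ← h2, epsOn_pow]
  rfl

/-- For each arrow, e_k M is free over the truncated polynomials in ε_k^(f_jk) of order m, where c_k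
= f_jk m. Adjoining an f_kj-th root raises the order to f_kj m = c_j. -/
theorem isFreeNilp_tildeEps (j : ι)
    (h : ∀ k, IsFreeNilp (𝒟.c k) (𝒟.epsOn K M k)) :
    IsFreeNilp (𝒟.c j) (𝒟.tildeEps K M j) := by
  intro z hz
  have key : ∀ (k : {k // 𝒟.C j k < 0}) (g : Fin (𝒟.g j k)), ∃ y : Fin (𝒟.f k j) → 𝒟.vertexSpace K M k,
      (fun s => z ⟨k, g, s⟩) = (shift (𝒟.f k j) (𝒟.epsOn K M k ^ 𝒟.f j k) ^ (𝒟.c j - 1)) y := by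
    intro k g
    obtain ⟨m, hm, h1, h2⟩ := exists_c_eq k.2
    have h3 : IsFreeNilp m (𝒟.epsOn K M k ^ 𝒟.f j k) := by
      intro x hx
      have := (h k).exists_eq_pow (by rw [h2]; exact Nat.le_mul_of_pos_right _ hm) x hx
      rwa [h2, ← Nat.mul_sub_one, pow_mul] at this
    have h4 := h3.shift (f_pos (𝒟.neg_comm k.2)) hm
    rw [← h1] at h4
    refine h4 _ ?_
    ext1 s
    exact congrFun hz ⟨k, g, s⟩
  choose y hy using key
  refine ⟨fun t => y t.1 t.2.1 t.2.2, ?_⟩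
  funext t
  rw [tildeEps_pow_apply, ← hy]

/-- The map `M_in : ⨁_k jH_k ⊗ e_k M → e_j M`. -/
def inMap (j : ι) : 𝒟.Tilde K M j →ₗ[K] 𝒟.vertexSpace K M j :=
  ∑ t : 𝒟.TildeIdx j, 𝒟.sgn j t.1 •
    ((𝒟.epsOn K M j ^ t.2.2.1 : Module.End K _) ∘ₗ 𝒟.arrowOn K M j t.1 t.2.1) ∘ₗ LinearMap.proj t

theorem inMap_apply (j : ι) (z : 𝒟.Tilde K M j) : 𝒟.inMap K M j z =
    ∑ t : 𝒟.TildeIdx j, 𝒟.sgn j t.1 •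
      (𝒟.epsOn K M j ^ t.2.2.1) (𝒟.arrowOn K M j t.1 t.2.1 (z t)) := by
  simp [inMap]

theorem coe_inMap (j : ι) (z : 𝒟.Tilde K M j) : (𝒟.inMap K M j z : M) =
    ∑ t : 𝒟.TildeIdx j, 𝒟.sgn j t.1 • (𝒟.ε K j ^ t.2.2.1 * 𝒟.α K j t.1 t.2.1) • (z t : M) := by
  rw [inMap_apply, Submodule.coe_sum]
  refine Finset.sum_congr rfl fun t _ => ?_
  rw [mul_smul, AddSubgroupClass.coe_zsmul, coe_epsOn_pow, coe_arrowOn]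

/-- The map `M_out : e_j M → ⨁_k jH_k ⊗ e_k M`. -/
def outMap (j : ι) : 𝒟.vertexSpace K M j →ₗ[K] 𝒟.Tilde K M j :=
  LinearMap.pi fun t => 𝒟.arrowOn K M t.1 j t.2.1 ∘ₗ
    (𝒟.epsOn K M j ^ (𝒟.f t.1 j - 1 - t.2.2.1) : Module.End K _)

theorem outMap_apply (j : ι) (x : 𝒟.vertexSpace K M j) (t : 𝒟.TildeIdx j) :
    𝒟.outMap K M j x t =
      𝒟.arrowOn K M t.1 j t.2.1 ((𝒟.epsOn K M j ^ (𝒟.f t.1 j - 1 - t.2.2.1)) x) := rfl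

theorem coe_outMap (j : ι) (x : 𝒟.vertexSpace K M j) (t : 𝒟.TildeIdx j) :
    (𝒟.outMap K M j x t : M) =
      (𝒟.α K t.1 j t.2.1 * 𝒟.ε K j ^ (𝒟.f t.1 j - 1 - t.2.2.1)) • (x : M) := by
  rw [outMap_apply, coe_arrowOn, coe_epsOn_pow, mul_smul]

theorem sum_tildeIdx {B : Type*} [AddCommMonoid B] (j : ι) (F : ι → ℕ → ℕ → B) :
    ∑ t : 𝒟.TildeIdx j, F t.1 t.2.1 t.2.2 =
      ∑ k with 𝒟.C j k < 0, ∑ g ∈ Finset.range (𝒟.g j k), ∑ s ∈ Finset.range (𝒟.f k j), F k g s := by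
  rw [Fintype.sum_sigma, ← Finset.sum_subtype_eq_sum_filter]
  rw [show (Finset.univ.subtype fun k => 𝒟.C j k < 0) = Finset.univ by ext; simp]
  refine Finset.sum_congr rfl fun k _ => ?_
  rw [Fintype.sum_prod_type, ← Fin.sum_univ_eq_sum_range
    (fun g => ∑ s ∈ Finset.range (𝒟.f k j), F k g s)]
  refine Finset.sum_congr rfl fun g _ => ?_
  rw [← Fin.sum_univ_eq_sum_range (fun s => F k g s)]

/-- The composite is the mesh relation at j applied to x: the exponents s in M_in and f_kj - 1 - s
in M_out are those of the relation. -/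
theorem inMap_outMap (j : ι) (x : 𝒟.vertexSpace K M j) :
    𝒟.inMap K M j (𝒟.outMap K M j x) = 0 := by
  apply Subtype.ext
  rw [coe_inMap, Submodule.coe_zero]
  have h := 𝒟.sum_tildeIdx j fun k g s =>
    𝒟.sgn j k • (𝒟.ε K j ^ s * 𝒟.α K j k g * 𝒟.α K k j g * 𝒟.ε K j ^ (𝒟.f k j - 1 - s))
  rw [(𝒟.relations K).p3 j] at h
  rw [← zero_smul (𝒟.Alg K) (x : M), ← h, Finset.sum_smul]
  refine Finset.sum_congr rfl fun t _ => ?_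
  rw [coe_outMap, smul_smul, smul_assoc]
  simp only [mul_assoc]

theorem p2_on {i j : ι} {g : ℕ} (h : 𝒟.IsArrow i j g) (x : 𝒟.vertexSpace K M j) :
    𝒟.arrowOn K M i j g ((𝒟.epsOn K M j ^ 𝒟.f i j) x) =
      (𝒟.epsOn K M i ^ 𝒟.f j i) (𝒟.arrowOn K M i j g x) := by
  apply Subtype.ext
  rw [coe_arrowOn, coe_epsOn_pow, coe_epsOn_pow, coe_arrowOn, smul_smul, smul_smul,
    (𝒟.relations K).p2 i j g h]

theorem inMap_tildeEps (j : ι) (z : 𝒟.Tilde K M j) :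
    𝒟.inMap K M j (𝒟.tildeEps K M j z) = 𝒟.epsOn K M j (𝒟.inMap K M j z) := by
  rw [inMap_apply, inMap_apply, Fintype.sum_sigma, Fintype.sum_sigma, map_sum]
  refine Finset.sum_congr rfl fun k _ => ?_
  rw [Fintype.sum_prod_type, Fintype.sum_prod_type, map_sum]
  refine Finset.sum_congr rfl fun g _ => ?_
  dsimp only
  rw [← Finset.smul_sum, ← Finset.smul_sum, map_zsmul]
  congr 1
  exact sum_pow_smul_shift (f_pos (𝒟.neg_comm k.2)) (𝒟.epsOn K M j) (𝒟.arrowOn K M j k g)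
    (fun x => 𝒟.p2_on K M ⟨k.2, g.2⟩ x) (fun s => z ⟨k, g, s⟩)

theorem outMap_epsOn (j : ι) (x : 𝒟.vertexSpace K M j) :
    𝒟.outMap K M j (𝒟.epsOn K M j x) = 𝒟.tildeEps K M j (𝒟.outMap K M j x) := by
  funext t
  rw [tildeEps_apply, shift_apply, outMap_apply]
  have hf := f_pos (𝒟.neg_comm t.1.2)
  have ht := t.2.2.2
  rw [← Module.End.mul_apply, ← pow_succ]
  by_cases h : t.2.2.1 = 0
  · rw [dif_pos h, outMap_apply]
    dsimp only
    rw [h, Nat.sub_self, pow_zero, Module.End.one_apply, ← 𝒟.p2_on K M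
      (IsArrow.symm ⟨t.1.2, t.2.1.2⟩), Nat.sub_zero, Nat.sub_add_cancel hf]
  · rw [dif_neg h, outMap_apply]
    dsimp only
    congr 3
    omega

variable {M} {N : Type*} [AddCommGroup N] [Module K N] [Module (𝒟.Alg K) N]
  [IsScalarTower K (𝒟.Alg K) N]

/-- The map induced by a homomorphism on vertex spaces. -/
def vertexMap (φ : M →ₗ[𝒟.Alg K] N) (i : ι) : 𝒟.vertexSpace K M i →ₗ[K] 𝒟.vertexSpace K N i :=
  (φ.restrictScalars K).restrict fun x hx => by
    rw [mem_vertexSpace] at hx ⊢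
    rw [LinearMap.restrictScalars_apply, ← map_smul, hx]

theorem coe_vertexMap (φ : M →ₗ[𝒟.Alg K] N) (i : ι) (x : 𝒟.vertexSpace K M i) :
    (𝒟.vertexMap K φ i x : N) = φ x := rfl

theorem vertexMap_epsOn (φ : M →ₗ[𝒟.Alg K] N) (i : ι) (x : 𝒟.vertexSpace K M i) :
    𝒟.vertexMap K φ i (𝒟.epsOn K M i x) = 𝒟.epsOn K N i (𝒟.vertexMap K φ i x) :=
  Subtype.ext (map_smul φ _ _)

theorem vertexMap_injective {φ : M →ₗ[𝒟.Alg K] N} (h : Function.Injective φ) (i : ι) :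
    Function.Injective (𝒟.vertexMap K φ i) := fun _ _ hxy =>
  Subtype.ext (h (congrArg Subtype.val hxy))

theorem vertexMap_surjective {φ : M →ₗ[𝒟.Alg K] N} (h : Function.Surjective φ) (i : ι) :
    Function.Surjective (𝒟.vertexMap K φ i) := by
  rintro ⟨y, hy⟩
  rw [mem_vertexSpace] at hy
  obtain ⟨x, rfl⟩ := h y
  exact ⟨⟨𝒟.e K i • x, (𝒟.mem_vertexSpace K).2 (e_smul_e_smul i x)⟩,
    Subtype.ext ((map_smul φ _ _).trans hy)⟩

/-- The map induced by a homomorphism on `⨁_k jH_k ⊗ e_k M`. -/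
def tildeMap (φ : M →ₗ[𝒟.Alg K] N) (j : ι) : 𝒟.Tilde K M j →ₗ[K] 𝒟.Tilde K N j :=
  LinearMap.pi fun t => 𝒟.vertexMap K φ t.1 ∘ₗ LinearMap.proj t

theorem tildeMap_apply (φ : M →ₗ[𝒟.Alg K] N) (j : ι) (z : 𝒟.Tilde K M j) (t : 𝒟.TildeIdx j) :
    𝒟.tildeMap K φ j z t = 𝒟.vertexMap K φ t.1 (z t) := rfl

theorem inMap_tildeMap (φ : M →ₗ[𝒟.Alg K] N) (j : ι) (z : 𝒟.Tilde K M j) :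
    𝒟.inMap K N j (𝒟.tildeMap K φ j z) = 𝒟.vertexMap K φ j (𝒟.inMap K M j z) := by
  apply Subtype.ext
  rw [coe_vertexMap, coe_inMap, coe_inMap, map_sum]
  refine Finset.sum_congr rfl fun t _ => ?_
  rw [map_zsmul, map_smul]
  rfl

theorem outMap_vertexMap (φ : M →ₗ[𝒟.Alg K] N) (j : ι) (x : 𝒟.vertexSpace K M j) :
    𝒟.outMap K N j (𝒟.vertexMap K φ j x) = 𝒟.tildeMap K φ j (𝒟.outMap K M j x) := by
  funext t
  apply Subtype.ext
  rw [tildeMap_apply, coe_vertexMap, coe_outMap, coe_outMap, map_smul, coe_vertexMap]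

theorem tildeMap_tildeEps (φ : M →ₗ[𝒟.Alg K] N) (j : ι) (z : 𝒟.Tilde K M j) :
    𝒟.tildeMap K φ j (𝒟.tildeEps K M j z) = 𝒟.tildeEps K N j (𝒟.tildeMap K φ j z) := by
  funext t
  rw [tildeMap_apply, tildeEps_apply, tildeEps_apply, shift_apply, shift_apply]
  by_cases h : t.2.2.1 = 0
  · rw [dif_pos h, dif_pos h, tildeMap_apply]
    exact pow_apply_comm_of_comp (𝒟.vertexMap_epsOn K φ _) _ _
  · rw [dif_neg h, dif_neg h, tildeMap_apply]

theorem tildeMap_surjective {φ : M →ₗ[𝒟.Alg K] N} (h : Function.Surjective φ) (j : ι) :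
    Function.Surjective (𝒟.tildeMap K φ j) := by
  intro z
  choose y hy using fun t : 𝒟.TildeIdx j => 𝒟.vertexMap_surjective K h t.1 (z t)
  exact ⟨y, funext hy⟩

end Tilde

end CartanDatum

end GPA

namespace GPA.CartanDatum

/-! ### The ideal I_j in terms of M_in and M_out -/

section Radical

variable {ι : Type w} (𝒟 : CartanDatum ι) [Fintype ι] (K : Type u) [Field K]
variable {M : Type v} [AddCommGroup M] [Module K M] [Module (𝒟.Alg K) M]
  [IsScalarTower K (𝒟.Alg K) M]

/-- The elements y of N with e_j y in S are stable under all generators: ε_j preserves S, arrows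
into j land in S, and e_j kills what ends at another vertex. -/
theorem e_smul_smul_mem {j : ι} {N : Submodule (𝒟.Alg K) M} {S : Submodule K M}
    (hε : ∀ x ∈ S, 𝒟.ε K j • x ∈ S) (hα : ∀ k g, ∀ x ∈ N, 𝒟.α K j k g • x ∈ S) {x : M}
    (hx : x ∈ N) (hex : 𝒟.e K j • x ∈ S) (a : 𝒟.Alg K) : 𝒟.e K j • a • x ∈ S := by
  let W : Submodule K M :=
    N.restrictScalars K ⊓ S.comap (Algebra.lsmul K K M (𝒟.e K j))
  suffices h : a • x ∈ W from h.2
  refine smul_mem_of_generators (𝒟 := 𝒟) ?_ ?_ ?_ a x ⟨hx, hex⟩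
  · rintro i y ⟨hy, hey⟩
    refine ⟨N.smul_mem _ hy, ?_⟩
    change 𝒟.e K j • 𝒟.e K i • y ∈ S
    by_cases hij : j = i
    · subst hij; rw [e_smul_e_smul]; exact hey
    · rw [e_smul_e_smul_of_ne hij]; exact zero_mem _
  · rintro i y ⟨hy, hey⟩
    refine ⟨N.smul_mem _ hy, ?_⟩
    change 𝒟.e K j • 𝒟.ε K i • y ∈ S
    by_cases hij : j = i
    · subst hij; rw [e_smul_ε_smul, ← ε_smul_e_smul]; exact hε _ hey
    · rw [e_smul_ε_smul_of_ne hij]; exact zero_mem _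
  · rintro i k g y ⟨hy, hey⟩
    refine ⟨N.smul_mem _ hy, ?_⟩
    change 𝒟.e K j • 𝒟.α K i k g • y ∈ S
    by_cases hij : j = i
    · subst hij; rw [e_smul_α_smul]; exact hα _ _ _ hy
    · rw [e_smul_α_smul_of_ne hij]; exact zero_mem _

theorem sgn_mul_sgn (i j : ι) : 𝒟.sgn i j * 𝒟.sgn i j = 1 := by
  unfold sgn; split_ifs <;> rfl

theorem tildeEps_pow_single [DecidableEq ι] {j : ι} {k : {k // 𝒟.C j k < 0}} (g : Fin (𝒟.g j k))
    (s : Fin (𝒟.f k j)) (y : 𝒟.vertexSpace K M k) :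
    (𝒟.tildeEps K M j ^ s.1) (Pi.single ⟨k, g, ⟨0, f_pos (𝒟.neg_comm k.2)⟩⟩ y) =
      Pi.single ⟨k, g, s⟩ y := by
  funext t
  rw [tildeEps_pow_apply]
  obtain ⟨k', g', s'⟩ := t
  dsimp only
  by_cases h : (⟨k', g'⟩ : Σ k : {k // 𝒟.C j k < 0}, Fin (𝒟.g j k)) = ⟨k, g⟩
  · obtain ⟨rfl, h⟩ := Sigma.mk.inj_iff.1 h
    obtain rfl := eq_of_heq h
    have h1 : ∀ (r : Fin (𝒟.f k' j)) (s : Fin (𝒟.f k' j)),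
        (Pi.single (M := fun t : 𝒟.TildeIdx j => 𝒟.vertexSpace K M t.1.1) ⟨k', g', r⟩ y)
          ⟨k', g', s⟩ = Pi.single (M := fun _ => 𝒟.vertexSpace K M k') r y s := by
      intro r s
      by_cases hrs : s = r
      · subst hrs; simp
      · rw [Pi.single_eq_of_ne hrs, Pi.single_eq_of_ne]
        intro h; apply hrs; simpa using h
    simp only [h1]
    rw [shift_pow_single _ s.2]
  · have h1 : ∀ (r : Fin (𝒟.f k j)) (s : Fin (𝒟.f k' j)),
        (Pi.single (M := fun t : 𝒟.TildeIdx j => 𝒟.vertexSpace K M t.1.1) ⟨k, g, r⟩ y)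
          ⟨k', g', s⟩ = 0 := by
      intro r s
      rw [Pi.single_eq_of_ne]
      intro h2
      apply h
      obtain ⟨rfl, h2⟩ := Sigma.mk.inj_iff.1 h2
      have h3 := congrArg Prod.fst (eq_of_heq h2)
      exact Sigma.mk.inj_iff.2 ⟨rfl, heq_of_eq h3⟩
    rw [h1]
    have h2 := funext (h1 ⟨0, f_pos (𝒟.neg_comm k.2)⟩)
    rw [h2]
    exact congrFun (map_zero (shift (𝒟.f k' j) (𝒟.epsOn K M k' ^ 𝒟.f j k') ^ s.1)) s'

theorem inMap_single [DecidableEq ι] {j : ι} (t : 𝒟.TildeIdx j) (y : 𝒟.vertexSpace K M t.1) :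
    𝒟.inMap K M j (Pi.single t y) = 𝒟.sgn j t.1 •
      (𝒟.epsOn K M j ^ t.2.2.1) (𝒟.arrowOn K M j t.1 t.2.1 y) := by
  rw [inMap_apply, Finset.sum_eq_single t]
  · rw [Pi.single_eq_same]
  · intro t' _ h
    rw [Pi.single_eq_of_ne h, map_zero, map_zero, smul_zero]
  · simp

/-- The image of `M_in` as a subspace of `M`. -/
def imIn (j : ι) : Submodule K M :=
  (LinearMap.range (𝒟.inMap K M j)).map (𝒟.vertexSpace K M j).subtype

variable {K} in
theorem ε_smul_mem_imIn {j : ι} {x : M} (hx : x ∈ 𝒟.imIn K (M := M) j) :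
    𝒟.ε K j • x ∈ 𝒟.imIn K (M := M) j := by
  obtain ⟨_, ⟨z, rfl⟩, rfl⟩ := hx
  exact ⟨_, ⟨_, 𝒟.inMap_tildeEps K M j z⟩, rfl⟩

variable {K} in
theorem α_smul_mem_imIn (j k : ι) (g : ℕ) (x : M) : 𝒟.α K j k g • x ∈ 𝒟.imIn K (M := M) j := by
  classical
  by_cases h : 𝒟.IsArrow j k g
  · let y : 𝒟.vertexSpace K M k :=
      ⟨𝒟.e K k • x, (𝒟.mem_vertexSpace K).2 (e_smul_e_smul k x)⟩
    refine ⟨_, ⟨𝒟.sgn j k • Pi.single ⟨⟨k, h.1⟩, ⟨g, h.2⟩, ⟨0, f_pos (𝒟.neg_comm h.1)⟩⟩ y, rfl⟩, ?_⟩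
    rw [map_zsmul, inMap_single, smul_smul, sgn_mul_sgn, one_smul]
    exact α_smul_e_smul _ _ _ _
  · rw [(𝒟.relations K).α_eq_zero _ _ _ h, zero_smul]
    exact zero_mem _

variable {K} in
theorem one_sub_e_mem (j : ι) : 1 - 𝒟.e K j ∈ 𝒟.idemIdeal K j :=
  Submodule.subset_span ⟨1, 1, by simp⟩

variable {K} in
theorem α_mem_idemIdeal {j k : ι} (h : k ≠ j) (i : ι) (g : ℕ) :
    𝒟.α K k i g ∈ 𝒟.idemIdeal K j :=
  Submodule.subset_span ⟨1, 𝒟.α K k i g, by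
    rw [one_mul, sub_mul, one_mul, ← (𝒟.relations K).e_mul_α k, ← mul_assoc,
      (𝒟.relations K).e_mul_e j k h.symm, zero_mul, sub_zero]⟩

variable {K} in
theorem α_mem_idemIdeal' {j k : ι} (h : k ≠ j) (i : ι) (g : ℕ) :
    𝒟.α K i k g ∈ 𝒟.idemIdeal K j :=
  Submodule.subset_span ⟨𝒟.α K i k g, 1, by
    rw [mul_one, mul_sub, mul_one, ← (𝒟.relations K).α_mul_e i k, mul_assoc,
      (𝒟.relations K).e_mul_e k j h, mul_zero, sub_zero]⟩

variable {K} in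
-- An element (1 - e_j) b x has no component at j, so whatever comes back to j does so through an
-- arrow into j. With `imIn_le_idemIdeal_smul` this identifies the image of M_in with e_j I_j M.
theorem e_smul_mem_imIn {j : ι} {x : M}
    (hx : x ∈ 𝒟.idemIdeal K j • (⊤ : Submodule (𝒟.Alg K) M)) :
    𝒟.e K j • x ∈ 𝒟.imIn K (M := M) j := by
  induction hx using Submodule.smul_induction_on' with
  | smul a ha n hn =>
    clear hn
    induction ha using Submodule.span_induction with
    | mem a ha =>
      obtain ⟨b, b', rfl⟩ := ha
      rw [mul_assoc, mul_smul]
      refine 𝒟.e_smul_smul_mem K (N := ⊤) (fun x hx => 𝒟.ε_smul_mem_imIn hx)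
        (fun k g x _ => 𝒟.α_smul_mem_imIn j k g x) trivial ?_ b
      rw [smul_smul, ← mul_assoc, mul_sub, mul_one, (𝒟.relations K).e_mul_self, sub_self, zero_mul,
        zero_smul]
      exact zero_mem _
    | zero => rw [zero_smul, smul_zero]; exact zero_mem _
    | add a b _ _ ha hb => rw [add_smul, smul_add]; exact add_mem ha hb
    | smul b a _ ha =>
      rw [smul_eq_mul, mul_smul]
      exact 𝒟.e_smul_smul_mem K (N := ⊤) (fun x hx => 𝒟.ε_smul_mem_imIn hx)
        (fun k g x _ => 𝒟.α_smul_mem_imIn j k g x) trivial ha b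
  | add x _ y _ hx hy => rw [smul_add]; exact add_mem hx hy

variable {K} in
theorem imIn_le_idemIdeal_smul {j : ι} {x : M} (hx : x ∈ 𝒟.imIn K (M := M) j) :
    x ∈ 𝒟.idemIdeal K j • (⊤ : Submodule (𝒟.Alg K) M) := by
  obtain ⟨_, ⟨z, rfl⟩, rfl⟩ := hx
  change (𝒟.inMap K M j z : M) ∈ _
  rw [coe_inMap]
  refine sum_mem fun t _ => zsmul_mem ?_ _
  refine Submodule.smul_mem_smul ?_ trivial
  exact Ideal.mul_mem_left _ _ (𝒟.α_mem_idemIdeal' (ne_of_neg t.1.2).symm _ _)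

variable {K} in
theorem mem_range_inMap {j : ι} {x : 𝒟.vertexSpace K M j} :
    x ∈ LinearMap.range (𝒟.inMap K M j) ↔
      (x : M) ∈ 𝒟.idemIdeal K j • (⊤ : Submodule (𝒟.Alg K) M) := by
  constructor
  · intro h; exact 𝒟.imIn_le_idemIdeal_smul ⟨x, h, rfl⟩
  · intro h
    have := 𝒟.e_smul_mem_imIn h
    rw [(𝒟.mem_vertexSpace K).1 x.2] at this
    obtain ⟨y, hy, hxy⟩ := this
    rwa [← Subtype.ext hxy]

variable {K} in
theorem mem_idemIdeal_smul_of_e_smul_eq_zero {j : ι} {x : M} {N : Submodule (𝒟.Alg K) M}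
    (hx : x ∈ N) (h : 𝒟.e K j • x = 0) : x ∈ 𝒟.idemIdeal K j • N := by
  have : (1 - 𝒟.e K j) • x = x := by rw [sub_smul, one_smul, h, sub_zero]
  rw [← this]
  exact Submodule.smul_mem_smul (𝒟.one_sub_e_mem j) hx

/-- The elements of `M` killed by `I_j`. -/
def idemTor (j : ι) : Submodule (𝒟.Alg K) M where
  carrier := {m | ∀ a ∈ 𝒟.idemIdeal K j, a • m = 0}
  add_mem' hx hy a ha := by rw [smul_add, hx a ha, hy a ha, add_zero]
  zero_mem' a _ := smul_zero a
  smul_mem' b x hx a ha := by rw [smul_smul]; exact hx _ (Ideal.mul_mem_right _ _ ha)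

variable {K} in
theorem e_smul_of_mem_idemTor {j : ι} {x : M} (hx : x ∈ 𝒟.idemTor K (M := M) j) :
    𝒟.e K j • x = x := by
  have := hx _ (𝒟.one_sub_e_mem j)
  rwa [sub_smul, one_smul, sub_eq_zero, eq_comm] at this

variable {K} in
-- The elements satisfying both conditions form a Π-stable subspace on which e_j is the identity, so
-- 1 - e_j kills it, and with it all of I_j.
theorem mem_idemTor_of_α {j : ι} {x : M} (hx : 𝒟.e K j • x = x)
    (h : ∀ k g n, 𝒟.α K k j g • 𝒟.ε K j ^ n • x = 0) : x ∈ 𝒟.idemTor K (M := M) j := by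
  let W : Submodule K M :=
    { carrier := {x | 𝒟.e K j • x = x ∧ ∀ k g n, 𝒟.α K k j g • 𝒟.ε K j ^ n • x = 0}
      add_mem' := by
        rintro x y ⟨hx, hx'⟩ ⟨hy, hy'⟩
        exact ⟨by rw [smul_add, hx, hy], fun k g n => by
          rw [smul_add, smul_add, hx', hy', add_zero]⟩
      zero_mem' := ⟨smul_zero _, fun k g n => by rw [smul_zero, smul_zero]⟩
      smul_mem' := by
        rintro r x ⟨hx, hx'⟩
        exact ⟨by rw [smul_comm, hx], fun k g n => by
          rw [smul_comm (𝒟.ε K j ^ n), smul_comm (𝒟.α K k j g), hx', smul_zero]⟩ }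
  have hW : ∀ a : 𝒟.Alg K, ∀ x ∈ W, a • x ∈ W := by
    refine fun a => smul_mem_of_generators (𝒟 := 𝒟) ?_ ?_ ?_ a
    · rintro i x ⟨hx, hx'⟩
      by_cases hij : i = j
      · subst hij; rw [hx]; exact ⟨hx, hx'⟩
      · rw [← hx, e_smul_e_smul_of_ne hij]; exact zero_mem _
    · rintro i x ⟨hx, hx'⟩
      by_cases hij : i = j
      · subst hij
        refine ⟨e_smul_ε_smul _ _, fun k g n => ?_⟩
        rw [smul_smul (_ ^ n), ← pow_succ, hx']
      · rw [ε_smul_of_ne hij hx]; exact zero_mem _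
    · rintro i k g x ⟨hx, hx'⟩
      by_cases hkj : k = j
      · subst hkj
        have := hx' i g 0
        rw [pow_zero, one_smul] at this
        rw [this]; exact zero_mem _
      · rw [α_smul_of_ne hkj g hx]; exact zero_mem _
  intro a ha
  induction ha using Submodule.span_induction with
  | mem a ha =>
    obtain ⟨b, b', rfl⟩ := ha
    have h1 := (hW b' x ⟨hx, h⟩).1
    rw [mul_smul, mul_smul, sub_smul, one_smul, h1, sub_self, smul_zero]
  | zero => exact zero_smul _ _
  | add a b _ _ ha hb => rw [add_smul, ha, hb, add_zero]
  | smul b a _ ha => rw [smul_eq_mul, mul_smul, ha, smul_zero]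

variable {K} in
-- An element of e_j M is killed by I_j as soon as all α_kj ε_j^n kill it. The map M_out tests the
-- exponents n < f_kj, and these suffice.
theorem mem_ker_outMap {j : ι} {x : 𝒟.vertexSpace K M j} :
    x ∈ LinearMap.ker (𝒟.outMap K M j) ↔ (x : M) ∈ 𝒟.idemTor K (M := M) j := by
  constructor
  · intro h
    refine 𝒟.mem_idemTor_of_α ((𝒟.mem_vertexSpace K).1 x.2) fun k g n => ?_
    by_cases ha : 𝒟.IsArrow k j g
    · induction n using Nat.strong_induction_on with
      | _ n ih =>
        by_cases hn : n < 𝒟.f k j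
        · have h1 := congrFun h ⟨⟨k, ha.symm.1⟩, ⟨g, ha.symm.2⟩, ⟨𝒟.f k j - 1 - n, by
            change _ < 𝒟.f k j; omega⟩⟩
          have h2 := congrArg Subtype.val h1
          rw [coe_outMap] at h2
          dsimp only at h2
          rw [show 𝒟.f k j - 1 - (𝒟.f k j - 1 - n) = n by omega, mul_smul] at h2
          exact h2
        -- For n ≥ f_kj a factor ε_j^(f_kj) moves to the left of the arrow as ε_k^(f_jk), which
        -- lowers the exponent.
        · have h1 : 𝒟.ε K j ^ n = 𝒟.ε K j ^ 𝒟.f k j * 𝒟.ε K j ^ (n - 𝒟.f k j) := by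
            rw [← pow_add]; congr 1; omega
          rw [h1, smul_smul, ← mul_assoc, ← (𝒟.relations K).p2 k j g ha, mul_assoc, mul_smul,
            mul_smul, ih _ (by have := f_pos ha.1; omega), smul_zero]
    · rw [(𝒟.relations K).α_eq_zero _ _ _ ha, zero_smul]
  · intro h
    funext t
    apply Subtype.ext
    rw [coe_outMap]
    exact h _ (Ideal.mul_mem_right _ _ (𝒟.α_mem_idemIdeal (ne_of_neg t.1.2).symm _ _))

/-- Each k ≠ j contributes g_jk f_kj = |c_kj| indices. The summand 2 d_j cancels the diagonal term
c_jj d_j. -/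
theorem sum_C_mul (j : ι) (d : ι → ℕ) : (∑ t : 𝒟.TildeIdx j, d t.1 : ℤ) =
    2 * d j - ∑ k, 𝒟.C k j * d k := by
  classical
  have h1 := 𝒟.sum_tildeIdx j fun k _ _ => (d k : ℤ)
  rw [h1]
  simp only [Finset.sum_const, Finset.card_range, smul_smul]
  have h2 : ∀ k, 𝒟.C k j * d k + (if 𝒟.C j k < 0 then (𝒟.g j k * 𝒟.f k j) • (d k : ℤ) else 0) =
      if k = j then 2 * (d k : ℤ) else 0 := by
    intro k
    by_cases hk : k = j
    · subst hk
      have : ¬ 𝒟.C k k < 0 := by rw [𝒟.diag]; omega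
      rw [if_neg this, if_pos rfl, 𝒟.diag, add_zero]
    · rw [if_neg hk]
      have h3 := 𝒟.offDiag k j hk
      have h4 := 𝒟.offDiag j k (Ne.symm hk)
      have h5 := 𝒟.ne_zero_iff k j
      by_cases hC : 𝒟.C j k < 0
      · rw [if_pos hC, 𝒟.g_comm, g_mul_f, nsmul_eq_mul, ← add_mul]
        have : 𝒟.C k j + ((𝒟.C k j).natAbs : ℤ) = 0 := by omega
        rw [this, zero_mul]
      · have : 𝒟.C k j = 0 := by
          by_contra h6
          have := h5.1 h6
          omega
        rw [if_neg hC, this, zero_mul, add_zero]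
  have h3 := Finset.sum_congr (rfl : (Finset.univ : Finset ι) = Finset.univ) fun k _ => h2 k
  rw [Finset.sum_add_distrib, Finset.sum_ite_eq' Finset.univ j, if_pos (Finset.mem_univ _)] at h3
  rw [Finset.sum_filter]
  linarith

theorem finrank_tilde [Module.Finite K M] (j : ι) : (Module.finrank K (𝒟.Tilde K M j) : ℤ) =
    2 * Module.finrank K (𝒟.vertexSpace K M j) -
      ∑ k, 𝒟.C k j * Module.finrank K (𝒟.vertexSpace K M k) := by
  rw [← sum_C_mul 𝒟 j fun k => Module.finrank K (𝒟.vertexSpace K M k), Module.finrank_pi_fintype]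
  push_cast
  rfl

/-- The homomorphism `H_i → Π` sending the variable to `ε_i` (and `1` to `1`). -/
def vertexHom (i : ι) : TruncPoly K (𝒟.c i) →ₐ[K] 𝒟.Alg K :=
  truncLift (𝒟.ε K i) ((𝒟.relations K).p1 i)

@[simp] theorem vertexHom_truncX (i : ι) : 𝒟.vertexHom K i (truncX K (𝒟.c i)) = 𝒟.ε K i :=
  truncLift_truncX _ _

theorem vertexHom_comm (i : ι) (h : TruncPoly K (𝒟.c i)) :
    𝒟.vertexHom K i h * 𝒟.e K i = 𝒟.e K i * 𝒟.vertexHom K i h := by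
  induction h using truncPoly_induction with
  | h0 => simp
  | h1 k h ih =>
    rw [map_add, map_mul, vertexHom_truncX, AlgHom.commutes, add_mul, mul_add, mul_assoc, ih,
      ← mul_assoc, ← mul_assoc, ε_mul_e_comm, Algebra.commutes]

/-- The map `H_i → e_i M` given by an element of `e_i M`. -/
def vertexGen {i : ι} (x : M) : TruncPoly K (𝒟.c i) →ₗ[K] M where
  toFun h := 𝒟.vertexHom K i h • x
  map_add' h h' := by rw [map_add, add_smul]
  map_smul' r h := by rw [map_smul, smul_assoc]; rfl

/-- A path from i ending at j either consists of powers of ε_j only, which requires j = i, or has a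
last arrow, which leads into j and puts its value into the image of M_in. -/
theorem vertexSpace_le_of_cyclic [DecidableEq ι] {i : ι} {x : M} (hx : 𝒟.e K i • x = x)
    (hgen : ∀ y : M, ∃ a : 𝒟.Alg K, a • x = y) (j : ι) (y : M) (hy : 𝒟.e K j • y = y) :
    y ∈ 𝒟.imIn K (M := M) j ⊔
      (if j = i then LinearMap.range (𝒟.vertexGen K (i := j) x) else ⊥) := by
  obtain ⟨a, rfl⟩ := hgen y
  rw [← hy]
  refine 𝒟.e_smul_smul_mem K (N := ⊤) ?_ ?_ trivial ?_ a
  · intro y hy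
    obtain ⟨y', hy', z, hz, rfl⟩ := Submodule.mem_sup.1 hy
    rw [smul_add]
    refine add_mem (Submodule.mem_sup_left (𝒟.ε_smul_mem_imIn hy')) (Submodule.mem_sup_right ?_)
    by_cases hij : j = i
    · rw [if_pos hij] at hz ⊢
      obtain ⟨h, rfl⟩ := hz
      refine ⟨truncX K (𝒟.c j) * h, ?_⟩
      change 𝒟.vertexHom K j _ • x = 𝒟.ε K j • 𝒟.vertexHom K j _ • x
      rw [map_mul, vertexHom_truncX, mul_smul]
    · rw [if_neg hij] at hz ⊢
      rw [(Submodule.mem_bot K).1 hz, smul_zero]; exact zero_mem _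
  · intro k g x _
    exact Submodule.mem_sup_left (𝒟.α_smul_mem_imIn j k g x)
  · refine Submodule.mem_sup_right ?_
    by_cases hij : j = i
    · rw [if_pos hij, hij, hx]
      refine ⟨1, ?_⟩
      change 𝒟.vertexHom K i 1 • x = x
      rw [map_one, one_smul]
    · rw [if_neg hij, ← hx, e_smul_e_smul_of_ne hij]; exact zero_mem _

/-- A lower bound for the dimension of the part of a cyclic module that is killed by `I_j`. -/
theorem finrank_idemTor_ge [DecidableEq ι] [Module.Finite K M] {i : ι} {x : M} (hx : 𝒟.e K i • x = x)
    (hgen : ∀ y : M, ∃ a : 𝒟.Alg K, a • x = y) (j : ι) :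
    ∑ k, 𝒟.C k j * Module.finrank K (𝒟.vertexSpace K M k) - (if j = i then (𝒟.c j : ℤ) else 0) ≤
      Module.finrank K (LinearMap.ker (𝒟.outMap K M j)) := by
  have h1 := LinearMap.finrank_range_add_finrank_ker (𝒟.inMap K M j)
  have h2 := LinearMap.finrank_range_add_finrank_ker (𝒟.outMap K M j)
  have h3 : Module.finrank K (LinearMap.range (𝒟.outMap K M j)) ≤
      Module.finrank K (LinearMap.ker (𝒟.inMap K M j)) := by
    apply Submodule.finrank_mono
    rintro _ ⟨y, rfl⟩
    exact 𝒟.inMap_outMap K M j y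
  have h4 : Module.finrank K (𝒟.vertexSpace K M j) ≤
      Module.finrank K (LinearMap.range (𝒟.inMap K M j)) + (if j = i then 𝒟.c j else 0) := by
    have h5 : 𝒟.vertexSpace K M j ≤ 𝒟.imIn K (M := M) j ⊔
        (if j = i then LinearMap.range (𝒟.vertexGen K (i := j) x) else ⊥) := fun y hy =>
      𝒟.vertexSpace_le_of_cyclic K hx hgen j y ((𝒟.mem_vertexSpace K).1 hy)
    refine (Submodule.finrank_mono h5).trans ?_
    refine (Submodule.finrank_add_le_finrank_add_finrank _ _).trans (add_le_add ?_ ?_)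
    · exact Submodule.finrank_map_le _ _
    · by_cases hij : j = i
      · rw [if_pos hij, if_pos hij]
        exact (LinearMap.finrank_range_le _).trans_eq (finrank_truncPoly (K := K))
      · rw [if_neg hij, if_neg hij, finrank_bot]
  have h6 := 𝒟.finrank_tilde K (M := M) j
  -- Let d_j = dim e_j M and T the dimension of the middle term. Then rk M_out ≤ T - rk M_in and rk
  -- M_in ≥ d_j - δ_ij c_j, hence dim ker M_out ≥ 2 d_j - T - δ_ij c_j, and 2 d_j - T = ∑ c_kj d_k.
  split_ifs at h4 ⊢ <;> omega

end Radical

end GPA.CartanDatum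

namespace GPA.CartanDatum

/-! ### Exactness of the complex at a vertex for the projective modules -/

section Exactness

variable {ι : Type w} (𝒟 : CartanDatum ι) [Fintype ι] [DecidableEq ι] (K : Type u) [Field K]

/-- The cokernel of `M_out` for the regular module. -/
abbrev CokerOut (j : ι) : Type _ :=
  𝒟.Tilde K (𝒟.Alg K) j ⧸ LinearMap.range (𝒟.outMap K (𝒟.Alg K) j)

/-- The endomorphism `ε_j` of the cokernel of `M_out`. -/
def cokerEps (j : ι) : Module.End K (𝒟.CokerOut K j) :=
  Submodule.mapQ _ _ (𝒟.tildeEps K (𝒟.Alg K) j) (by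
    rintro _ ⟨x, rfl⟩
    exact ⟨_, 𝒟.outMap_epsOn K _ j x⟩)

theorem cokerEps_pow_mk (j : ι) (n : ℕ) (z : 𝒟.Tilde K (𝒟.Alg K) j) :
    (𝒟.cokerEps K j ^ n) (Submodule.Quotient.mk z) =
      Submodule.Quotient.mk ((𝒟.tildeEps K (𝒟.Alg K) j ^ n) z) :=
  (pow_apply_comm_of_comp (f := Submodule.mkQ _) (ε := 𝒟.tildeEps K (𝒟.Alg K) j)
    (ε' := 𝒟.cokerEps K j) (fun _ => rfl) n z).symm

/-- The map `a ↦ e_l a` to the vertex space of the regular module. -/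
def toVertexSpace (l : ι) : 𝒟.Alg K →ₗ[K] 𝒟.vertexSpace K (𝒟.Alg K) l :=
  (Algebra.lsmul K K (𝒟.Alg K) (𝒟.e K l)).rangeRestrict

theorem coe_toVertexSpace (l : ι) (a : 𝒟.Alg K) :
    (𝒟.toVertexSpace K l a : 𝒟.Alg K) = 𝒟.e K l * a := rfl

open Classical in
/-- The action of the arrow `α_jl^(g)` into the cokernel of `M_out`. -/
def cokerArrow (j l : ι) (g : ℕ) : 𝒟.Alg K →ₗ[K] 𝒟.CokerOut K j :=
  if h : 𝒟.IsArrow j l g then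
    -- The sign is that of M_in, so that ∑ sgn ε_j^s α_jl z_t, acting through these maps, reproduces
    -- the class of z.
    𝒟.sgn j l • Submodule.mkQ _ ∘ₗ
      LinearMap.single K (fun t : 𝒟.TildeIdx j => 𝒟.vertexSpace K (𝒟.Alg K) t.1.1)
        ⟨⟨l, h.1⟩, ⟨g, h.2⟩, ⟨0, f_pos (𝒟.neg_comm h.1)⟩⟩ ∘ₗ 𝒟.toVertexSpace K l
  else 0

theorem cokerArrow_apply {j l : ι} {g : ℕ} (h : 𝒟.IsArrow j l g) (a : 𝒟.Alg K) :
    𝒟.cokerArrow K j l g a = 𝒟.sgn j l • Submodule.Quotient.mk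
      (Pi.single ⟨⟨l, h.1⟩, ⟨g, h.2⟩, ⟨0, f_pos (𝒟.neg_comm h.1)⟩⟩ (𝒟.toVertexSpace K l a)) := by
  rw [cokerArrow, dif_pos h]
  rfl

theorem cokerEps_pow_cokerArrow {j l : ι} {g : ℕ} (h : 𝒟.IsArrow j l g) (s : Fin (𝒟.f l j))
    (a : 𝒟.Alg K) : (𝒟.cokerEps K j ^ s.1) (𝒟.cokerArrow K j l g a) =
      𝒟.sgn j l • Submodule.Quotient.mk
        (Pi.single ⟨⟨l, h.1⟩, ⟨g, h.2⟩, s⟩ (𝒟.toVertexSpace K l a)) := by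
  rw [cokerArrow_apply 𝒟 K h, map_zsmul, cokerEps_pow_mk]
  congr 2
  exact 𝒟.tildeEps_pow_single K (k := ⟨l, h.1⟩) ⟨g, h.2⟩ s _

theorem cokerEps_pow_f_cokerArrow {j l : ι} {g : ℕ} (h : 𝒟.IsArrow j l g) (a : 𝒟.Alg K) :
    (𝒟.cokerEps K j ^ 𝒟.f l j) (𝒟.cokerArrow K j l g a) =
      𝒟.cokerArrow K j l g (𝒟.ε K l ^ 𝒟.f j l * a) := by
  rw [cokerArrow_apply 𝒟 K h, cokerArrow_apply 𝒟 K h, map_zsmul, cokerEps_pow_mk]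
  congr 2
  funext t
  rw [tildeEps_pow_apply]
  by_cases ht : t = ⟨⟨l, h.1⟩, ⟨g, h.2⟩, ⟨0, f_pos (𝒟.neg_comm h.1)⟩⟩
  · subst ht
    have := shift_pow_self_mul_apply (n := 𝒟.f l j) (β := 𝒟.epsOn K (𝒟.Alg K) l ^ 𝒟.f j l) 1
      (fun s => Pi.single (M := fun t : 𝒟.TildeIdx j => 𝒟.vertexSpace K (𝒟.Alg K) t.1.1)
        ⟨⟨l, h.1⟩, ⟨g, h.2⟩, ⟨0, f_pos (𝒟.neg_comm h.1)⟩⟩ (𝒟.toVertexSpace K l a)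
        ⟨⟨l, h.1⟩, ⟨g, h.2⟩, s⟩) ⟨0, f_pos (𝒟.neg_comm h.1)⟩
    rw [mul_one, pow_one] at this
    refine this.trans ?_
    rw [Pi.single_eq_same, Pi.single_eq_same]
    apply Subtype.ext
    rw [coe_epsOn_pow, coe_toVertexSpace, coe_toVertexSpace, smul_eq_mul, ← mul_assoc, ← mul_assoc]
    congr 1
    exact ((Commute.pow_left (ε_mul_e_comm (K := K) (𝒟 := 𝒟) l) _))
  · obtain ⟨k, g', s⟩ := t
    have := shift_pow_self_mul_apply (n := 𝒟.f k j) (β := 𝒟.epsOn K (𝒟.Alg K) k ^ 𝒟.f j k) 1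
      (fun s => Pi.single (M := fun t : 𝒟.TildeIdx j => 𝒟.vertexSpace K (𝒟.Alg K) t.1.1)
        ⟨⟨l, h.1⟩, ⟨g, h.2⟩, ⟨0, f_pos (𝒟.neg_comm h.1)⟩⟩ (𝒟.toVertexSpace K l a)
        ⟨k, g', s⟩) s
    rw [mul_one, pow_one] at this
    by_cases hl : k.1 = l
    · obtain ⟨k, hk⟩ := k
      subst hl
      refine this.trans ?_
      rw [Pi.single_eq_of_ne ht, Pi.single_eq_of_ne ht, map_zero]
    · have hk : (k : ι) ≠ l := hl
      refine (?_ : _ = (shift (𝒟.f k j) (𝒟.epsOn K (𝒟.Alg K) k ^ 𝒟.f j k) ^ 𝒟.f l j) 0 s).trans ?_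
      · refine congrArg (fun y => (shift (𝒟.f k j) (𝒟.epsOn K (𝒟.Alg K) k ^ 𝒟.f j k) ^ 𝒟.f l j)
          y s) (funext fun s' => ?_)
        rw [Pi.single_eq_of_ne]
        · rfl
        · intro h'
          exact hl (congrArg (fun t : 𝒟.TildeIdx j => t.1.1) h')
      · rw [map_zero, Pi.single_eq_of_ne ht]
        rfl

theorem cokerArrow_e_mul (j l : ι) (g : ℕ) (a : 𝒟.Alg K) :
    𝒟.cokerArrow K j l g (𝒟.e K l * a) = 𝒟.cokerArrow K j l g a := by
  by_cases h : 𝒟.IsArrow j l g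
  · rw [cokerArrow_apply 𝒟 K h, cokerArrow_apply 𝒟 K h]
    congr 3
    apply Subtype.ext
    rw [coe_toVertexSpace, coe_toVertexSpace, ← mul_assoc, (𝒟.relations K).e_mul_self]
  · rw [cokerArrow, dif_neg h]; rfl

/-- The mesh relation in the cokernel of `M_out`. -/
theorem sum_cokerArrow (j : ι) (a : 𝒟.Alg K) :
    ∑ k with 𝒟.C j k < 0, ∑ g ∈ Finset.range (𝒟.g j k), ∑ s ∈ Finset.range (𝒟.f k j),
      𝒟.sgn j k • (𝒟.cokerEps K j ^ s) (𝒟.cokerArrow K j k g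
        (𝒟.α K k j g * (𝒟.ε K j ^ (𝒟.f k j - 1 - s) * a))) = 0 := by
  rw [← 𝒟.sum_tildeIdx j fun k g s => 𝒟.sgn j k • (𝒟.cokerEps K j ^ s) (𝒟.cokerArrow K j k g
        (𝒟.α K k j g * (𝒟.ε K j ^ (𝒟.f k j - 1 - s) * a)))]
  have h : ∀ t : 𝒟.TildeIdx j, 𝒟.sgn j t.1 • (𝒟.cokerEps K j ^ t.2.2.1) (𝒟.cokerArrow K j t.1 t.2.1
        (𝒟.α K t.1 j t.2.1 * (𝒟.ε K j ^ (𝒟.f t.1 j - 1 - t.2.2.1) * a))) =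
      Submodule.Quotient.mk (Pi.single t (𝒟.outMap K (𝒟.Alg K) j (𝒟.toVertexSpace K j a) t)) := by
    intro t
    rw [cokerEps_pow_cokerArrow 𝒟 K ⟨t.1.2, t.2.1.2⟩, smul_smul, sgn_mul_sgn, one_smul]
    congr 2
    apply Subtype.ext
    rw [coe_toVertexSpace, coe_outMap, coe_toVertexSpace, smul_eq_mul, ← mul_assoc,
      (𝒟.relations K).e_mul_α]
    rw [mul_assoc (𝒟.α K _ _ _), ← mul_assoc _ (𝒟.e K j) a,
      (Commute.pow_left (ε_mul_e_comm (K := K) (𝒟 := 𝒟) j) _).eq,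
      mul_assoc (𝒟.e K j), ← mul_assoc (𝒟.α K _ _ _) (𝒟.e K j), (𝒟.relations K).α_mul_e]
  rw [Finset.sum_congr rfl fun t _ => h t]
  have h1 := Finset.univ_sum_single (𝒟.outMap K (𝒟.Alg K) j (𝒟.toVertexSpace K j a))
  have h2 := congrArg (Submodule.mkQ (LinearMap.range (𝒟.outMap K (𝒟.Alg K) j))) h1
  rw [map_sum] at h2
  refine h2.trans ?_
  exact (Submodule.Quotient.mk_eq_zero _).2 ⟨_, rfl⟩

/-- The idempotents acting on `Π ⊕ coker M_out`. -/
def extE (j k : ι) : Module.End K (𝒟.Alg K × 𝒟.CokerOut K j) :=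
  (Algebra.lmul K (𝒟.Alg K) (𝒟.e K k)).prodMap (if k = j then LinearMap.id else 0)

/-- The loops acting on `Π ⊕ coker M_out`. -/
def extEps (j k : ι) : Module.End K (𝒟.Alg K × 𝒟.CokerOut K j) :=
  (Algebra.lmul K (𝒟.Alg K) (𝒟.ε K k)).prodMap (if k = j then 𝒟.cokerEps K j else 0)

/-- The arrows acting on `Π ⊕ coker M_out`. -/
def extArrow (j k l : ι) (g : ℕ) : Module.End K (𝒟.Alg K × 𝒟.CokerOut K j) :=
  ((Algebra.lmul K (𝒟.Alg K) (𝒟.α K k l g)).prod (if k = j then 𝒟.cokerArrow K j l g else 0)) ∘ₗ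
    LinearMap.fst K _ _

theorem extE_apply (j k : ι) (a : 𝒟.Alg K) (u : 𝒟.CokerOut K j) :
    𝒟.extE K j k (a, u) = (𝒟.e K k * a, if k = j then u else 0) := by
  unfold extE; split_ifs <;> rfl

theorem extEps_apply (j k : ι) (a : 𝒟.Alg K) (u : 𝒟.CokerOut K j) :
    𝒟.extEps K j k (a, u) = (𝒟.ε K k * a, if k = j then 𝒟.cokerEps K j u else 0) := by
  unfold extEps; split_ifs <;> rfl

theorem extEps_pow_apply (j k : ι) (n : ℕ) (a : 𝒟.Alg K) (u : 𝒟.CokerOut K j) :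
    (𝒟.extEps K j k ^ n) (a, u) =
      (𝒟.ε K k ^ n * a, ((if k = j then 𝒟.cokerEps K j else 0) ^ n : Module.End K _) u) := by
  induction n with
  | zero => simp
  | succ n ih =>
    rw [pow_succ', Module.End.mul_apply, ih, extEps_apply, pow_succ', mul_assoc, pow_succ',
      Module.End.mul_apply]
    split_ifs <;> rfl

theorem extArrow_apply (j k l : ι) (g : ℕ) (a : 𝒟.Alg K) (u : 𝒟.CokerOut K j) :
    𝒟.extArrow K j k l g (a, u) =
      (𝒟.α K k l g * a, if k = j then 𝒟.cokerArrow K j l g a else 0) := by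
  unfold extArrow; split_ifs <;> rfl

/-- This makes Π ⊕ coker M_out a Π-module in which arrows into j also have a component in the
cokernel. The nontrivial points lie at j: commutation of loops and arrows holds by the definition of
ε_j on the middle term, and the mesh relation holds because the image of M_out has been divided out.
-/
theorem extRelations (j : ι) :
    𝒟.Relations (𝒟.extE K j) (𝒟.extEps K j) (𝒟.extArrow K j) := by
  have R := 𝒟.relations K
  constructor
  · intro k
    refine LinearMap.ext fun ⟨a, u⟩ => ?_
    rw [Module.End.mul_apply, extE_apply, extE_apply, ← mul_assoc, R.e_mul_self]
    split_ifs <;> rfl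
  · intro k l h
    refine LinearMap.ext fun ⟨a, u⟩ => ?_
    rw [Module.End.mul_apply, extE_apply, extE_apply, ← mul_assoc, R.e_mul_e k l h, zero_mul]
    split_ifs with h1 h2
    · exact absurd (h1.trans h2.symm) h
    · rfl
    · rfl
  · refine LinearMap.ext fun ⟨a, u⟩ => ?_
    rw [LinearMap.sum_apply]
    simp only [extE_apply]
    apply Prod.ext
    · rw [Prod.fst_sum]
      simp only
      rw [← Finset.sum_mul, R.sum_e, one_mul]
      rfl
    · rw [Prod.snd_sum]
      simp
  · intro k
    refine LinearMap.ext fun ⟨a, u⟩ => ?_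
    rw [Module.End.mul_apply, extEps_apply, extE_apply, ← mul_assoc, R.e_mul_ε]
    split_ifs <;> rfl
  · intro k
    refine LinearMap.ext fun ⟨a, u⟩ => ?_
    rw [Module.End.mul_apply, extEps_apply, extE_apply, extEps_apply, ← mul_assoc, R.ε_mul_e]
    split_ifs <;> rfl
  · intro k l g
    refine LinearMap.ext fun ⟨a, u⟩ => ?_
    rw [Module.End.mul_apply, extArrow_apply, extE_apply, ← mul_assoc, R.e_mul_α]
    split_ifs <;> rfl
  · intro k l g
    refine LinearMap.ext fun ⟨a, u⟩ => ?_
    rw [Module.End.mul_apply, extArrow_apply, extE_apply, extArrow_apply, ← mul_assoc, R.α_mul_e,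
      cokerArrow_e_mul]
  · intro k l g h
    refine LinearMap.ext fun ⟨a, u⟩ => ?_
    rw [extArrow_apply, R.α_eq_zero k l g h, zero_mul]
    split_ifs with hk
    · subst hk
      rw [cokerArrow, dif_neg h]
      rfl
    · rfl
  · intro k
    refine LinearMap.ext fun ⟨a, u⟩ => ?_
    rw [extEps_pow_apply, R.p1, zero_mul]
    refine Prod.ext rfl ?_
    dsimp only
    split_ifs with hk
    · subst hk
      induction u using Submodule.Quotient.induction_on with
      | H z => rw [cokerEps_pow_mk, tildeEps_pow_c]; rfl
    · have := 𝒟.one_le_c k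
      rw [zero_pow (by omega)]
      rfl
  · intro k l g h
    refine LinearMap.ext fun ⟨a, u⟩ => ?_
    rw [Module.End.mul_apply, Module.End.mul_apply, extArrow_apply, extEps_pow_apply,
      extEps_pow_apply, extArrow_apply, ← mul_assoc, R.p2 k l g h, mul_assoc]
    refine Prod.ext rfl ?_
    dsimp only
    split_ifs with hk
    · subst hk
      exact 𝒟.cokerEps_pow_f_cokerArrow K h a
    · rw [map_zero]
  · intro k
    refine LinearMap.ext fun ⟨a, u⟩ => ?_
    have h1 := congrArg (· * a) (R.p3 k)
    simp only [Finset.sum_mul, zero_mul, smul_mul_assoc] at h1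
    simp only [LinearMap.sum_apply, LinearMap.smul_apply, Module.End.mul_apply, extEps_pow_apply,
      extArrow_apply]
    apply Prod.ext
    · simp only [Prod.fst_sum, Prod.smul_fst]
      simp only [mul_assoc] at h1
      exact h1
    · simp only [Prod.snd_sum, Prod.smul_snd]
      by_cases hk : k = j
      · subst hk
        simp only [if_true]
        exact 𝒟.sum_cokerArrow K k a
      · simp only [if_neg hk, map_zero, smul_zero, Finset.sum_const_zero]
        rfl

theorem lift_extRelations_fst (j : ι) (a : 𝒟.Alg K) (y : 𝒟.Alg K × 𝒟.CokerOut K j) :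
    (lift K (𝒟.extRelations K j) a y).1 = a * y.1 := by
  induction a using alg_induction generalizing y with
  | algebraMap k => rw [AlgHom.commutes, ← Algebra.smul_def]; rfl
  | e i => rw [lift_e]; rfl
  | ε i => rw [lift_ε]; rfl
  | α i k g => rw [lift_α]; rfl
  | add a b ha hb => rw [map_add, LinearMap.add_apply, Prod.fst_add, ha, hb, add_mul]
  | mul a b ha hb => rw [map_mul, Module.End.mul_apply, ha, hb, mul_assoc]

theorem lift_extRelations_of_vertex {j k : ι} (h : k ≠ j) {z : 𝒟.Alg K} (hz : 𝒟.e K k * z = z) :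
    lift K (𝒟.extRelations K j) z (1, 0) = (z, 0) := by
  apply Prod.ext
  · rw [lift_extRelations_fst, mul_one]
  · rw [← hz, map_mul, lift_e, Module.End.mul_apply]
    generalize lift K (𝒟.extRelations K j) z (1, 0) = y
    obtain ⟨a, u⟩ := y
    rw [extE_apply, if_neg h]

/-- For the regular module, the kernel of `M_in` is the image of `M_out`. -/
theorem exists_outMap_eq (j : ι) (z : 𝒟.Tilde K (𝒟.Alg K) j)
    (hz : 𝒟.inMap K (𝒟.Alg K) j z = 0) : ∃ a, 𝒟.outMap K (𝒟.Alg K) j a = z := by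
  suffices h : (Submodule.Quotient.mk z : 𝒟.CokerOut K j) = 0 from
    (Submodule.Quotient.mk_eq_zero _).1 h
  -- Let M_in(z), as an element of Π, act on (1, 0): the second component is the class of z. As
  -- M_in(z) = 0, the class vanishes.
  have h0 : (lift K (𝒟.extRelations K j) (𝒟.inMap K (𝒟.Alg K) j z : 𝒟.Alg K) (1, 0)).2 = 0 := by
    rw [hz, Submodule.coe_zero, map_zero]
    rfl
  rw [← h0, coe_inMap, map_sum, LinearMap.sum_apply, Prod.snd_sum]
  have h1 := congrArg (Submodule.mkQ (LinearMap.range (𝒟.outMap K (𝒟.Alg K) j)))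
    (Finset.univ_sum_single z)
  rw [map_sum] at h1
  refine h1.symm.trans (Finset.sum_congr rfl fun t _ => ?_)
  rw [smul_eq_mul, mul_assoc, map_zsmul, map_mul, map_mul, map_pow, lift_ε, lift_α,
    LinearMap.smul_apply, Module.End.mul_apply, Module.End.mul_apply,
    lift_extRelations_of_vertex 𝒟 K (ne_of_neg t.1.2).symm ((𝒟.mem_vertexSpace K).1 (z t).2),
    extArrow_apply, extEps_pow_apply, Prod.smul_snd]
  simp only [if_true]
  rw [cokerEps_pow_cokerArrow 𝒟 K ⟨t.1.2, t.2.1.2⟩, smul_smul, sgn_mul_sgn, one_smul]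
  have h2 : 𝒟.toVertexSpace K t.1 (z t) = z t :=
    Subtype.ext ((𝒟.mem_vertexSpace K).1 (z t).2)
  rw [h2]
  rfl

omit [DecidableEq ι] in
theorem mem_P {i : ι} {a : 𝒟.Alg K} : a ∈ 𝒟.P K i ↔ a * 𝒟.e K i = a := by
  rw [P, Ideal.mem_span_singleton']
  constructor
  · rintro ⟨b, rfl⟩
    rw [mul_assoc, (𝒟.relations K).e_mul_self]
  · intro h
    exact ⟨a, h⟩

/-- For the module `Π e_i`, the kernel of `M_in` is the image of `M_out`. -/
theorem exists_outMap_eq_P (i j : ι) (z : 𝒟.Tilde K (𝒟.P K i) j)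
    (hz : 𝒟.inMap K (𝒟.P K i) j z = 0) : ∃ a, 𝒟.outMap K (𝒟.P K i) j a = z := by
  let φ : 𝒟.P K i →ₗ[𝒟.Alg K] 𝒟.Alg K := (𝒟.P K i).subtype
  -- Exactness for Π gives a preimage a. Right multiplication by e_i commutes with M_out and fixes
  -- the coordinates of z, so a e_i is a preimage in Π e_i.
  obtain ⟨a, ha⟩ := 𝒟.exists_outMap_eq K j (𝒟.tildeMap K φ j z) (by
    rw [inMap_tildeMap, hz, map_zero])
  have hae : 𝒟.e K j * (a : 𝒟.Alg K) = a := (𝒟.mem_vertexSpace K).1 a.2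
  refine ⟨⟨⟨a * 𝒟.e K i, ?_⟩, ?_⟩, ?_⟩
  · rw [mem_P, mul_assoc, (𝒟.relations K).e_mul_self]
  · rw [mem_vertexSpace]
    apply Subtype.ext
    change 𝒟.e K j * (a * 𝒟.e K i) = a * 𝒟.e K i
    rw [← mul_assoc, hae]
  · funext t
    apply Subtype.ext
    apply Subtype.ext
    have h1 := congrArg Subtype.val (congrFun ha t)
    rw [coe_outMap] at h1
    rw [coe_outMap]
    change _ * (a * 𝒟.e K i) = _
    rw [← mul_assoc]
    rw [smul_eq_mul] at h1
    rw [h1]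
    exact (𝒟.mem_P K).1 (z t : 𝒟.P K i).2

end Exactness

end GPA.CartanDatum

namespace GPA.CartanDatum

/-! ### Cyclic modules with extremal dimension vector -/

section Extremal

variable {ι : Type w} (𝒟 : CartanDatum ι) [Fintype ι]

/-- The integer `∏ c / c_k`. -/
def scale (k : ι) : ℕ := (∏ i, 𝒟.c i) / 𝒟.c k

theorem scale_mul_c (k : ι) : 𝒟.scale k * 𝒟.c k = ∏ i, 𝒟.c i :=
  Nat.div_mul_cancel (Finset.dvd_prod_of_mem _ (Finset.mem_univ k))

theorem scale_pos (k : ι) : 0 < 𝒟.scale k := by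
  refine Nat.pos_of_ne_zero fun h => ?_
  have := 𝒟.scale_mul_c k
  rw [h, zero_mul] at this
  exact Finset.prod_ne_zero_iff.2 (fun i _ => by have := 𝒟.one_le_c i; omega) this.symm

/-- Dimension counts at j involve the column numbers c_kj, while s_j involves the row numbers c_jk.
Rescaling dimension k by a constant multiple of 1 / c_k turns one into the other (`corootR_dimVec`).
-/
theorem scale_mul_C (j k : ι) : (𝒟.scale j : ℤ) * 𝒟.C k j = 𝒟.C j k * 𝒟.scale k := by
  have hj := 𝒟.one_le_c j
  have hk := 𝒟.one_le_c k
  have h1 : (𝒟.scale j : ℤ) * 𝒟.c j = 𝒟.scale k * 𝒟.c k := by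
    exact_mod_cast (𝒟.scale_mul_c j).trans (𝒟.scale_mul_c k).symm
  have h2 := 𝒟.symm j k
  have h3 : (𝒟.c k : ℤ) ≠ 0 := by omega
  refine mul_right_cancel₀ h3 ?_
  linear_combination (-(𝒟.scale j : ℤ)) * h2 + 𝒟.C j k * h1

variable (K : Type u) [Field K]

/-- The dimension vector of `M`, scaled so as to be a multiple of a rank vector. -/
def dimVec (M : Type v) [AddCommGroup M] [Module K M] [Module (𝒟.Alg K) M]
    [IsScalarTower K (𝒟.Alg K) M] : ι → ℤ :=
  fun k => 𝒟.scale k * Module.finrank K (𝒟.vertexSpace K M k)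

variable [DecidableEq ι]

/-- For `λ = -ϖ_i` and `w = s_{i_1} ⋯ s_{i_l}`, the vector `w λ - λ` of the root lattice. -/
def rvec (i : ι) : List ι → ι → ℤ
  | [] => 0
  | j :: l => 𝒟.s j (rvec i l) + (if j = i then 1 else 0 : ℤ) • Pi.single j 1

section

variable {𝒟 K} {M : Type v} [AddCommGroup M] [Module K M] [Module (𝒟.Alg K) M]
  [IsScalarTower K (𝒟.Alg K) M]

theorem eq_zero_of_vertexSpace_eq_bot (h : ∀ k, 𝒟.vertexSpace K M k = ⊥) (x : M) : x = 0 := by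
  rw [← sum_e_smul (𝒟 := 𝒟) (K := K) x]
  refine Finset.sum_eq_zero fun k _ => ?_
  have : 𝒟.e K k • x ∈ 𝒟.vertexSpace K M k := ⟨x, rfl⟩
  rwa [h, Submodule.mem_bot] at this

theorem finite_of_vertexSpace (h : ∀ k, Module.Finite K (𝒟.vertexSpace K M k)) :
    Module.Finite K M := by
  let φ : ((k : ι) → 𝒟.vertexSpace K M k) →ₗ[K] M :=
    ∑ k, (𝒟.vertexSpace K M k).subtype ∘ₗ LinearMap.proj k
  refine Module.Finite.of_surjective φ fun x => ⟨fun k => ⟨𝒟.e K k • x, x, rfl⟩, ?_⟩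
  simp only [φ, LinearMap.sum_apply]
  exact sum_e_smul (𝒟 := 𝒟) x

theorem finrank_vertexSpace_quotient [Module.Finite K M] (N : Submodule (𝒟.Alg K) M) (k : ι) :
    Module.finrank K (𝒟.vertexSpace K (M ⧸ N) k) + Module.finrank K (𝒟.vertexSpace K N k) =
      Module.finrank K (𝒟.vertexSpace K M k) := by
  rw [← LinearMap.finrank_range_add_finrank_ker (𝒟.vertexMap K N.mkQ k),
    LinearMap.range_eq_top.2 (𝒟.vertexMap_surjective K N.mkQ_surjective k), finrank_top]
  congr 1
  let φ := 𝒟.vertexMap K N.subtype k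
  have h1 : LinearMap.range φ = LinearMap.ker (𝒟.vertexMap K N.mkQ k) := by
    ext x
    rw [LinearMap.mem_ker]
    constructor
    · rintro ⟨y, rfl⟩
      apply Subtype.ext
      exact (Submodule.Quotient.mk_eq_zero N).2 (y : N).2
    · intro hx
      have h2 : (x : M) ∈ N := (Submodule.Quotient.mk_eq_zero N).1 (congrArg Subtype.val hx)
      exact ⟨⟨⟨x, h2⟩, (𝒟.mem_vertexSpace K).2 (Subtype.ext ((𝒟.mem_vertexSpace K).1 x.2))⟩, rfl⟩
  rw [← h1, LinearMap.finrank_range_of_inj (𝒟.vertexMap_injective K N.subtype_injective k)]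

theorem finrank_vertexSpace_idemTor [Module.Finite K M] (j k : ι) :
    Module.finrank K (𝒟.vertexSpace K (𝒟.idemTor K (M := M) j) k) =
      if k = j then Module.finrank K (LinearMap.ker (𝒟.outMap K M j)) else 0 := by
  split_ifs with h
  · subst h
    let φ := 𝒟.vertexMap K (𝒟.idemTor K (M := M) k).subtype k
    have h1 : LinearMap.range φ = LinearMap.ker (𝒟.outMap K M k) := by
      ext x
      rw [mem_ker_outMap]
      constructor
      · rintro ⟨y, rfl⟩
        exact (y : 𝒟.idemTor K (M := M) k).2
      · intro hx
        exact ⟨⟨⟨x, hx⟩, (𝒟.mem_vertexSpace K).2 (Subtype.ext ((𝒟.mem_vertexSpace K).1 x.2))⟩, rfl⟩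
    rw [← h1, LinearMap.finrank_range_of_inj (𝒟.vertexMap_injective K (Submodule.subtype_injective _) k)]
  · have h1 : 𝒟.vertexSpace K (𝒟.idemTor K (M := M) j) k = ⊥ := by
      rw [eq_bot_iff]
      intro x hx
      rw [mem_vertexSpace] at hx
      rw [Submodule.mem_bot, ← hx]
      apply Subtype.ext
      rw [Submodule.coe_smul, ← 𝒟.e_smul_of_mem_idemTor x.2, e_smul_e_smul_of_ne h]
      rfl
    rw [h1, finrank_bot]

theorem dimVec_idemTor_quotient [Module.Finite K M] (j : ι) :
    𝒟.dimVec K (M ⧸ 𝒟.idemTor K (M := M) j) = 𝒟.dimVec K M -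
      ((𝒟.scale j : ℤ) * Module.finrank K (LinearMap.ker (𝒟.outMap K M j))) • Pi.single j 1 := by
  funext k
  have h1 := finrank_vertexSpace_quotient (𝒟.idemTor K (M := M) j) k
  rw [finrank_vertexSpace_idemTor] at h1
  simp only [dimVec, Pi.sub_apply, Pi.smul_apply, smul_eq_mul]
  rw [← h1]
  by_cases hk : k = j
  · subst hk
    rw [if_pos rfl, Pi.single_eq_same]
    push_cast
    ring
  · rw [if_neg hk, Pi.single_eq_of_ne hk]
    push_cast
    ring

theorem corootR_dimVec (j : ι) : 𝒟.corootR j (𝒟.dimVec K M) =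
    𝒟.scale j * ∑ k, 𝒟.C k j * Module.finrank K (𝒟.vertexSpace K M k) := by
  rw [corootR_apply, Finset.mul_sum]
  refine Finset.sum_congr rfl fun k _ => ?_
  rw [← mul_assoc, scale_mul_C, dimVec, mul_assoc]

end

variable {K}

/-- Let T be the part of M killed by I_j. Passing from M to M / T reflects the dimension vector and
turns the defect z into s_j z + y α_j with y ≥ 0. Its pullback along the shorter word stays
nonnegative, since that of α_j is a positive root. For the empty word, dimensions force z = 0 and M
= 0. Going back, I_l x lies in T, so I_j I_l kills x. -/
theorem extremal_cyclic {i : ι} {l : List ι} (hl : 𝒟.IsReduced l) (M : Type v) [AddCommGroup M]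
    [Module K M] [Module (𝒟.Alg K) M] [IsScalarTower K (𝒟.Alg K) M] [Module.Finite K M] {x : M}
    (hx : 𝒟.e K i • x = x) (hgen : ∀ y : M, ∃ a : 𝒟.Alg K, a • x = y) (z : ι → ℤ)
    (hz : 0 ≤ (𝒟.weyl l).symm z)
    (hdim : 𝒟.dimVec K M = (∏ k, 𝒟.c k : ℤ) • 𝒟.rvec i l - z) :
    z = 0 ∧ ∀ a ∈ 𝒟.I K l, a • x = 0 := by
  induction l generalizing M z with
  | nil =>
    have h1 : ∀ k, z k = 0 ∧ Module.finrank K (𝒟.vertexSpace K M k) = 0 := by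
      intro k
      have h2 := congrFun hdim k
      have h3 := hz k
      change 0 ≤ z k at h3
      have h4 := 𝒟.scale_pos k
      simp only [dimVec, rvec, smul_zero, zero_sub, Pi.neg_apply] at h2
      have h5 : (0 : ℤ) ≤ 𝒟.scale k * Module.finrank K (𝒟.vertexSpace K M k) := by positivity
      have h6 : (𝒟.scale k : ℤ) * Module.finrank K (𝒟.vertexSpace K M k) = 0 := by omega
      refine ⟨by omega, ?_⟩
      rcases mul_eq_zero.1 h6 with h | h
      · omega
      · exact_mod_cast h
    refine ⟨funext fun k => (h1 k).1, fun a _ => ?_⟩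
    exact eq_zero_of_vertexSpace_eq_bot (𝒟 := 𝒟) (K := K)
      (fun k => Submodule.finrank_eq_zero.1 (h1 k).2) _
  | cons j l ih =>
    have hl' : 𝒟.IsReduced l := IsReduced.of_append_right 𝒟 (l := [j]) hl
    -- The excess of dim T over the bound of `finrank_idemTor_ge`, rescaled.
    set y : ℤ := 𝒟.scale j * Module.finrank K (LinearMap.ker (𝒟.outMap K M j)) -
      𝒟.corootR j (𝒟.dimVec K M) + (∏ k, 𝒟.c k : ℤ) * (if j = i then 1 else 0) with hy
    have hy0 : 0 ≤ y := by
      have h1 := 𝒟.finrank_idemTor_ge K hx hgen j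
      have h2 := mul_le_mul_of_nonneg_left h1 (Int.natCast_nonneg (𝒟.scale j))
      have h3 : (𝒟.scale j : ℤ) * 𝒟.c j = ∏ k, (𝒟.c k : ℤ) := by
        exact_mod_cast 𝒟.scale_mul_c j
      rw [mul_sub, ← corootR_dimVec] at h2
      split_ifs at h2 hy with hji
      · rw [h3] at h2; omega
      · omega
    have hs : 𝒟.s j (𝒟.dimVec K M) = (∏ k, 𝒟.c k : ℤ) • 𝒟.rvec i l -
        ((∏ k, 𝒟.c k : ℤ) * (if j = i then 1 else 0)) • Pi.single j 1 - 𝒟.s j z := by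
      rw [hdim, rvec, map_sub, map_smul, map_add, s_s, map_smul, s_single_self]
      module
    have hpos := hl.weyl_symm_single_nonneg
    have hsymm : ∀ v, (𝒟.weyl (j :: l)).symm v = (𝒟.weyl l).symm (𝒟.s j v) := by
      intro v
      rw [LinearEquiv.symm_apply_eq, weyl_cons_apply, LinearEquiv.apply_symm_apply, s_s]
    rw [hsymm] at hz
    obtain ⟨hz', hI⟩ := ih hl' (M ⧸ 𝒟.idemTor K (M := M) j)
      (x := Submodule.Quotient.mk x)
      (by rw [← Submodule.Quotient.mk_smul, hx])
      (fun q => by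
        obtain ⟨q, rfl⟩ := Submodule.Quotient.mk_surjective _ q
        obtain ⟨a, rfl⟩ := hgen q
        exact ⟨a, rfl⟩)
      (𝒟.s j z + y • Pi.single j 1)
      (by
        rw [map_add, map_smul]
        exact add_nonneg hz (smul_nonneg hy0 hpos))
      (by
        have h1 : 𝒟.dimVec K (M ⧸ 𝒟.idemTor K (M := M) j) = 𝒟.s j (𝒟.dimVec K M) +
            ((∏ k, 𝒟.c k : ℤ) * (if j = i then 1 else 0)) • Pi.single j 1 - y • Pi.single j 1 := by
          rw [dimVec_idemTor_quotient, s_apply, hy]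
          module
        rw [h1, hs]
        module)
    -- Pulled back along the shorter word, the new defect is a sum of two nonnegative vectors. It
    -- vanishes, so both summands do.
    have h1 := congrArg (𝒟.weyl l).symm hz'
    rw [map_add, map_smul, map_zero] at h1
    have h2 : (𝒟.weyl l).symm (𝒟.s j z) = 0 :=
      le_antisymm (by
        rw [← h1]
        exact le_add_of_nonneg_right (smul_nonneg hy0 hpos)) hz
    refine ⟨?_, ?_⟩
    · rw [LinearEquiv.map_eq_zero_iff, LinearEquiv.map_eq_zero_iff] at h2
      exact h2
    · intro a ha
      change a ∈ 𝒟.idemIdeal K j * 𝒟.I K l at ha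
      induction ha using Submodule.mul_induction_on' with
      | mem_mul_mem b hb a ha =>
        rw [mul_smul]
        exact (Submodule.Quotient.mk_eq_zero _).1 (hI a ha) b hb
      | add a _ b _ ha hb => rw [add_smul, ha, hb, add_zero]

/-- A nonzero part killed by I_j would make the quotient by it a cyclic module with defect a
positive multiple of α_j. As j :: l is reduced, that defect is admissible for `extremal_cyclic` and
hence zero. -/
theorem idemTor_eq_bot_of_extremal {i j : ι} {l : List ι} (hl : 𝒟.IsReduced (j :: l)) (M : Type v)
    [AddCommGroup M] [Module K M] [Module (𝒟.Alg K) M] [IsScalarTower K (𝒟.Alg K) M]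
    [Module.Finite K M] {x : M} (hx : 𝒟.e K i • x = x)
    (hgen : ∀ y : M, ∃ a : 𝒟.Alg K, a • x = y)
    (hdim : 𝒟.dimVec K M = (∏ k, 𝒟.c k : ℤ) • 𝒟.rvec i l) :
    𝒟.idemTor K (M := M) j = ⊥ := by
  set y : ℤ := (𝒟.scale j : ℤ) * Module.finrank K (LinearMap.ker (𝒟.outMap K M j)) with hy
  have h := (𝒟.extremal_cyclic (K := K) (i := i) (IsReduced.of_append_right 𝒟 (l := [j]) hl)
    (M ⧸ 𝒟.idemTor K (M := M) j) (x := Submodule.Quotient.mk x)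
    (by rw [← Submodule.Quotient.mk_smul, hx])
    (fun q => by
      obtain ⟨q, rfl⟩ := Submodule.Quotient.mk_surjective _ q
      obtain ⟨a, rfl⟩ := hgen q
      exact ⟨a, rfl⟩)
    (y • Pi.single j 1)
    (by
      rw [map_smul]
      exact smul_nonneg (by positivity) hl.weyl_symm_single_nonneg)
    (by rw [dimVec_idemTor_quotient, hdim])).1
  have h1 := congrFun h j
  rw [Pi.smul_apply, Pi.single_eq_same, smul_eq_mul, mul_one, hy, Pi.zero_apply] at h1
  have h2 := 𝒟.scale_pos j
  have h3 : Module.finrank K (LinearMap.ker (𝒟.outMap K M j)) = 0 := by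
    rcases mul_eq_zero.1 h1 with h | h
    · omega
    · exact_mod_cast h
  rw [Submodule.finrank_eq_zero] at h3
  rw [eq_bot_iff]
  intro x hx
  have h4 : (⟨x, (𝒟.mem_vertexSpace K).2 (𝒟.e_smul_of_mem_idemTor hx)⟩ :
      𝒟.vertexSpace K M j) ∈ LinearMap.ker (𝒟.outMap K M j) := 𝒟.mem_ker_outMap.2 hx
  rw [h3, Submodule.mem_bot] at h4
  exact congrArg Subtype.val h4

end Extremal

end GPA.CartanDatum

namespace GPA.CartanDatum

/-! ### The modules `Π e_i / I_w e_i` -/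

variable {K : Type u} [Field K]

/-- Two quotients of a module with the same kernel are isomorphic. -/
def equivOfKerEq {R Z A B : Type*} [Ring R] [AddCommGroup Z] [Module R Z] [AddCommGroup A]
    [Module R A] [AddCommGroup B] [Module R B] {a : Z →ₗ[R] A} {b : Z →ₗ[R] B}
    (ha : Function.Surjective a) (hb : Function.Surjective b)
    (h : LinearMap.ker a = LinearMap.ker b) : A ≃ₗ[R] B :=
  (a.quotKerEquivOfSurjective ha).symm ≪≫ₗ Submodule.quotEquivOfEq _ _ h ≪≫ₗ
    b.quotKerEquivOfSurjective hb

theorem finrank_of_surjective_of_comap_eq_ker {Z A B : Type*} [AddCommGroup Z] [Module K Z]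
    [AddCommGroup A] [Module K A] [AddCommGroup B] [Module K B] [Module.Finite K A]
    {a : Z →ₗ[K] A} {b : Z →ₗ[K] B} (ha : Function.Surjective a) (hb : Function.Surjective b)
    (R : Submodule K A) (hR : ∀ z, a z ∈ R ↔ b z = 0) :
    Module.Finite K B ∧ Module.finrank K B + Module.finrank K R = Module.finrank K A := by
  have hk : LinearMap.ker (R.mkQ ∘ₗ a) = LinearMap.ker b := by
    ext z
    rw [LinearMap.mem_ker, LinearMap.mem_ker, ← hR]
    exact Submodule.Quotient.mk_eq_zero R
  let κ := equivOfKerEq (a := R.mkQ ∘ₗ a) (b := b) (R.mkQ_surjective.comp ha) hb hk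
  exact ⟨Module.Finite.equiv κ, by rw [← κ.finrank_eq, R.finrank_quotient_add_finrank]⟩

/-! ### From P / L to P / I_j L -/

section Step

variable {ι : Type w} (𝒟 : CartanDatum ι) [Fintype ι] {K : Type u} [Field K]
variable {P : Type v} [AddCommGroup P] [Module K P] [Module (𝒟.Alg K) P]
  [IsScalarTower K (𝒟.Alg K) P] (L : Submodule (𝒟.Alg K) P) (j : ι)

theorem idemIdeal_smul_le : 𝒟.idemIdeal K j • L ≤ L :=
  Submodule.smul_le.2 fun a _ _ hn => L.smul_mem a hn

/-- The projection `P / I_j L → P / L`. -/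
def stepMap : (P ⧸ 𝒟.idemIdeal K j • L) →ₗ[𝒟.Alg K] P ⧸ L :=
  Submodule.factor (𝒟.idemIdeal_smul_le L j)

theorem stepMap_surjective : Function.Surjective (𝒟.stepMap L j) :=
  Submodule.factor_surjective (𝒟.idemIdeal_smul_le L j)

/-- Away from j nothing changes, because (1 - e_j) L is contained in I_j L. -/
theorem vertexMap_stepMap_injective {k : ι} (h : k ≠ j) :
    Function.Injective (𝒟.vertexMap K (𝒟.stepMap L j) k) := by
  rw [injective_iff_map_eq_zero]
  rintro ⟨x, hx⟩ hx0
  rw [mem_vertexSpace] at hx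
  obtain ⟨p, rfl⟩ := Submodule.Quotient.mk_surjective _ x
  have h1 : p ∈ L := (Submodule.Quotient.mk_eq_zero L).1 (congrArg Subtype.val hx0)
  apply Subtype.ext
  change Submodule.Quotient.mk p = (0 : P ⧸ _)
  rw [← hx, ← Submodule.Quotient.mk_smul, Submodule.Quotient.mk_eq_zero]
  exact 𝒟.mem_idemIdeal_smul_of_e_smul_eq_zero (L.smul_mem _ h1) (e_smul_e_smul_of_ne h.symm _)

variable {𝒟 j}

theorem mem_idemIdeal_smul_iff {p : P} (hp : p ∈ L) (he : 𝒟.e K j • p = p) :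
    p ∈ 𝒟.idemIdeal K j • L ↔
      ∃ z : 𝒟.Tilde K P j, (∀ t, (z t : P) ∈ L) ∧ (𝒟.inMap K P j z : P) = p := by
  constructor
  · intro h
    have h1 : ∀ q ∈ 𝒟.idemIdeal K j • L, ∃ q' : L, (q' : P) = q ∧
        q' ∈ 𝒟.idemIdeal K j • (⊤ : Submodule (𝒟.Alg K) L) := by
      intro q hq
      induction hq using Submodule.smul_induction_on' with
      | smul a ha n hn => exact ⟨a • ⟨n, hn⟩, rfl, Submodule.smul_mem_smul ha trivial⟩
      | add x _ y _ hx hy =>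
        obtain ⟨x', rfl, hx⟩ := hx
        obtain ⟨y', rfl, hy⟩ := hy
        exact ⟨x' + y', rfl, add_mem hx hy⟩
    obtain ⟨p', hp', h2⟩ := h1 p h
    have h3 := 𝒟.mem_range_inMap (K := K) (M := L) (j := j)
      (x := ⟨p', (𝒟.mem_vertexSpace K).2 (Subtype.ext (by
        rw [Submodule.coe_smul, hp', he]))⟩)
    obtain ⟨z, hz⟩ := h3.2 h2
    refine ⟨𝒟.tildeMap K L.subtype j z, fun t => (z t : L).2, ?_⟩
    rw [inMap_tildeMap, hz, coe_vertexMap]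
    exact hp'
  · rintro ⟨z, hz, rfl⟩
    rw [coe_inMap]
    refine sum_mem fun t _ => zsmul_mem ?_ _
    exact Submodule.smul_mem_smul
      (Ideal.mul_mem_left _ _ (𝒟.α_mem_idemIdeal' (ne_of_neg t.1.2).symm _ _)) (hz t)

variable (hP : ∀ z : 𝒟.Tilde K P j, 𝒟.inMap K P j z = 0 → ∃ a, 𝒟.outMap K P j a = z)
  (hL : ∀ p ∈ L, 𝒟.e K j • p = p → ∃ z, (𝒟.inMap K P j z : P) = p)

include hP in
-- Two tuples with the same value under M_in differ by an element of im M_out, by exactness for P.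
-- So M_in(z) is also the value of a tuple with entries in L exactly if z is, modulo L, in the image
-- of M_out.
theorem inMap_mem_step_iff (z : 𝒟.Tilde K P j) (hz : (𝒟.inMap K P j z : P) ∈ L) :
    (𝒟.inMap K P j z : P) ∈ 𝒟.idemIdeal K j • L ↔
      𝒟.tildeMap K L.mkQ j z ∈ LinearMap.range (𝒟.outMap K (P ⧸ L) j) := by
  rw [mem_idemIdeal_smul_iff L hz ((𝒟.mem_vertexSpace K).1 (𝒟.inMap K P j z).2)]
  constructor
  · rintro ⟨z', hz', h⟩
    obtain ⟨a, ha⟩ := hP (z - z') (by rw [map_sub, Subtype.ext h, sub_self])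
    refine ⟨𝒟.vertexMap K L.mkQ j a, ?_⟩
    rw [outMap_vertexMap, ha, map_sub, sub_eq_self]
    funext t
    apply Subtype.ext
    exact (Submodule.Quotient.mk_eq_zero L).2 (hz' t)
  · rintro ⟨x, hx⟩
    obtain ⟨a, rfl⟩ := 𝒟.vertexMap_surjective K L.mkQ_surjective j x
    rw [outMap_vertexMap] at hx
    refine ⟨z - 𝒟.outMap K P j a, fun t => ?_, ?_⟩
    · refine (Submodule.Quotient.mk_eq_zero L).1 ?_
      have := congrArg Subtype.val (congrFun hx t)
      simp only [tildeMap_apply, coe_vertexMap, Submodule.mkQ_apply] at this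
      change Submodule.Quotient.mk ((z t : P) - 𝒟.outMap K P j a t) = (0 : P ⧸ L)
      rw [Submodule.Quotient.mk_sub, this, sub_self]
    · rw [map_sub, inMap_outMap, sub_zero]

include hP hL in
-- The kernel of P / I_j L → P / L at j is the homology ker M_in / im M_out of P / L. Both are
-- quotients, with the same kernel, of the space of tuples z over P with M_in(z) in L: one through
-- reduction modulo L, the other through M_in.
theorem finrank_ker_stepMap [Module.Finite K (P ⧸ L)]
    (hout : Function.Injective (𝒟.outMap K (P ⧸ L) j)) :
    Module.Finite K (LinearMap.ker (𝒟.vertexMap K (𝒟.stepMap L j) j)) ∧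
    Module.finrank K (LinearMap.ker (𝒟.vertexMap K (𝒟.stepMap L j) j)) +
        Module.finrank K (𝒟.vertexSpace K (P ⧸ L) j) =
      Module.finrank K (LinearMap.ker (𝒟.inMap K (P ⧸ L) j)) := by
  let Z : Submodule K (𝒟.Tilde K P j) :=
    (LinearMap.ker (𝒟.inMap K (P ⧸ L) j)).comap (𝒟.tildeMap K L.mkQ j)
  have hZ : ∀ z, z ∈ Z ↔ (𝒟.inMap K P j z : P) ∈ L := by
    intro z
    change 𝒟.inMap K (P ⧸ L) j _ = 0 ↔ _
    rw [inMap_tildeMap, ← Submodule.Quotient.mk_eq_zero L, ← Submodule.coe_eq_zero]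
    rfl
  let R : Submodule K (LinearMap.ker (𝒟.inMap K (P ⧸ L) j)) :=
    (LinearMap.range (𝒟.outMap K (P ⧸ L) j)).submoduleOf _
  let a : Z →ₗ[K] LinearMap.ker (𝒟.inMap K (P ⧸ L) j) :=
    (𝒟.tildeMap K L.mkQ j).restrict (fun z hz => hz)
  let b : Z →ₗ[K] LinearMap.ker (𝒟.vertexMap K (𝒟.stepMap L j) j) :=
    (𝒟.vertexMap K (𝒟.idemIdeal K j • L).mkQ j ∘ₗ 𝒟.inMap K P j).restrict (fun z hz => by
      apply Subtype.ext
      exact (Submodule.Quotient.mk_eq_zero L).2 ((hZ z).1 hz))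
  have ha : Function.Surjective a := by
    rintro ⟨y, hy⟩
    obtain ⟨z, rfl⟩ := 𝒟.tildeMap_surjective K L.mkQ_surjective j y
    exact ⟨⟨z, hy⟩, rfl⟩
  have hb : Function.Surjective b := by
    rintro ⟨⟨x, hx⟩, hx0⟩
    obtain ⟨p, rfl⟩ := Submodule.Quotient.mk_surjective _ x
    have h1 : p ∈ L := (Submodule.Quotient.mk_eq_zero L).1 (congrArg Subtype.val hx0)
    obtain ⟨z, hz⟩ := hL (𝒟.e K j • p) (L.smul_mem _ h1) (e_smul_e_smul _ _)
    refine ⟨⟨z, (hZ z).2 (hz ▸ L.smul_mem _ h1)⟩, ?_⟩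
    apply Subtype.ext
    apply Subtype.ext
    change Submodule.Quotient.mk (𝒟.inMap K P j z : P) = (Submodule.Quotient.mk p : P ⧸ _)
    rw [hz, Submodule.Quotient.mk_smul]
    exact (𝒟.mem_vertexSpace K).1 hx
  have hab : ∀ z, a z ∈ R ↔ b z = 0 := by
    intro z
    have h1 : a z ∈ R ↔
        𝒟.tildeMap K L.mkQ j z ∈ LinearMap.range (𝒟.outMap K (P ⧸ L) j) := Iff.rfl
    have h2 : b z = 0 ↔ (𝒟.inMap K P j z : P) ∈ 𝒟.idemIdeal K j • L := by
      rw [← Submodule.coe_eq_zero, ← Submodule.coe_eq_zero]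
      exact Submodule.Quotient.mk_eq_zero _
    rw [h1, h2, inMap_mem_step_iff L hP z ((hZ z).1 z.2)]
  have h1 : Module.finrank K R = Module.finrank K (𝒟.vertexSpace K (P ⧸ L) j) := by
    have h2 : LinearMap.range (𝒟.outMap K (P ⧸ L) j) ≤ LinearMap.ker (𝒟.inMap K (P ⧸ L) j) := by
      rintro _ ⟨x, rfl⟩
      exact 𝒟.inMap_outMap K _ j x
    rw [(Submodule.submoduleOfEquivOfLe h2).finrank_eq, LinearMap.finrank_range_of_inj hout]
  rw [← h1]
  exact finrank_of_surjective_of_comap_eq_ker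
    (B := LinearMap.ker (𝒟.vertexMap K (𝒟.stepMap L j) j)) (b := b) ha hb R hab

include hP hL in
-- Under the identification of e_j (L / I_j L) with the homology of the complex of P / L, this is
-- `IsFreeNilp.homology`, stated on representatives in P.
theorem free_step (hout : Function.Injective (𝒟.outMap K (P ⧸ L) j))
    (hfree : ∀ k, IsFreeNilp (𝒟.c k) (𝒟.epsOn K (P ⧸ L) k))
    (hcoker : ∀ x : 𝒟.vertexSpace K (P ⧸ L) j,
      𝒟.epsOn K (P ⧸ L) j x ∈ LinearMap.range (𝒟.inMap K (P ⧸ L) j) →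
      ∃ y, x - (𝒟.epsOn K (P ⧸ L) j ^ (𝒟.c j - 1)) y ∈ LinearMap.range (𝒟.inMap K (P ⧸ L) j))
    {p : P} (hp : p ∈ L) (hep : 𝒟.e K j • p = p) (hεp : 𝒟.ε K j • p ∈ 𝒟.idemIdeal K j • L) :
    ∃ p' ∈ L, 𝒟.e K j • p' = p' ∧ p - 𝒟.ε K j ^ (𝒟.c j - 1) • p' ∈ 𝒟.idemIdeal K j • L := by
  obtain ⟨z, rfl⟩ := hL p hp hep
  have hker : ∀ z : 𝒟.Tilde K P j, (𝒟.inMap K P j z : P) ∈ L ↔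
      𝒟.inMap K (P ⧸ L) j (𝒟.tildeMap K L.mkQ j z) = 0 := by
    intro z
    rw [inMap_tildeMap, ← Submodule.Quotient.mk_eq_zero L, ← Submodule.coe_eq_zero]
    rfl
  have h1 : 𝒟.ε K j • (𝒟.inMap K P j z : P) = 𝒟.inMap K P j (𝒟.tildeEps K P j z) := by
    rw [inMap_tildeEps]; rfl
  obtain ⟨z', hz', hzz'⟩ := (hfree j).homology (𝒟.isFreeNilp_tildeEps K (P ⧸ L) j hfree)
    (𝒟.one_le_c j) (𝒟.epsOn_pow K (P ⧸ L) j) (𝒟.tildeEps_pow_c K (P ⧸ L) j) hout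
    (𝒟.inMap_outMap K _ j) (𝒟.outMap_epsOn K _ j) (𝒟.inMap_tildeEps K _ j) hcoker
    (𝒟.tildeMap K L.mkQ j z) ((hker z).1 hp) (by
      rw [← tildeMap_tildeEps, ← inMap_mem_step_iff L hP]
      · rw [← h1]; exact hεp
      · rw [← h1]; exact L.smul_mem _ hp)
  obtain ⟨y, rfl⟩ := 𝒟.tildeMap_surjective K L.mkQ_surjective j z'
  have hpow : ∀ n, (𝒟.inMap K P j ((𝒟.tildeEps K P j ^ n) y) : P) =
      𝒟.ε K j ^ n • (𝒟.inMap K P j y : P) := by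
    intro n
    rw [pow_apply_comm_of_comp (𝒟.inMap_tildeEps K P j), coe_epsOn_pow]
  have hy : (𝒟.inMap K P j y : P) ∈ L := (hker y).2 hz'
  refine ⟨𝒟.inMap K P j y, hy, (𝒟.mem_vertexSpace K).1 (𝒟.inMap K P j y).2, ?_⟩
  have h2 : (𝒟.inMap K P j z : P) - 𝒟.ε K j ^ (𝒟.c j - 1) • (𝒟.inMap K P j y : P) =
      𝒟.inMap K P j (z - (𝒟.tildeEps K P j ^ (𝒟.c j - 1)) y) := by
    rw [map_sub, Submodule.coe_sub, hpow]
  rw [h2, inMap_mem_step_iff L hP]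
  · rw [map_sub, pow_apply_comm_of_comp (𝒟.tildeMap_tildeEps K L.mkQ j)]
    exact hzz'
  · rw [← h2]
    exact L.sub_mem hp (L.smul_mem _ hy)

end Step

/-! ### The quotient Π / I_i ≅ H_i and the module E_i -/

section VertexIdeal

variable {ι : Type w} (𝒟 : CartanDatum ι) [Fintype ι] (K : Type u) [Field K]

theorem e_smul_E (i : ι) (x : 𝒟.E K i) : 𝒟.e K i • x = x := by
  change 𝒟.toE K i (𝒟.e K i) * (show TruncPoly K (𝒟.c i) from x) = x
  rw [toE, toVertex, lift_e, if_pos rfl, one_mul]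

theorem toE_e (i : ι) : 𝒟.toE K i (𝒟.e K i) = 1 := by
  rw [toE, toVertex, lift_e, if_pos rfl]

theorem toE_ε (i : ι) : 𝒟.toE K i (𝒟.ε K i) = truncX K (𝒟.c i) := by
  rw [toE, toVertex, lift_ε, if_pos rfl]
  rfl

theorem toE_vertexHom (i : ι) (h : TruncPoly K (𝒟.c i)) :
    𝒟.toE K i (𝒟.vertexHom K i h) = h := by
  have : (𝒟.toE K i).comp (𝒟.vertexHom K i) = AlgHom.id K _ :=
    algHom_ext_truncPoly (by simp [toE_ε])
  exact DFunLike.congr_fun this h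

theorem e_mem_idemIdeal {i j : ι} (h : j ≠ i) : 𝒟.e K j ∈ 𝒟.idemIdeal K i :=
  Submodule.subset_span ⟨𝒟.e K j, 1, by
    rw [mul_one, mul_sub, mul_one, (𝒟.relations K).e_mul_e j i h, sub_zero]⟩

theorem ε_mem_idemIdeal {i j : ι} (h : j ≠ i) : 𝒟.ε K j ∈ 𝒟.idemIdeal K i := by
  rw [← (𝒟.relations K).e_mul_ε]
  exact Ideal.mul_mem_right _ _ (𝒟.e_mem_idemIdeal K h)

/-- Modulo I_i the idempotent e_i becomes 1, while all arrows and all generators at other vertices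
vanish. So only polynomials in ε_i remain, and Π / I_i is H_i. -/
theorem sub_vertexHom_toE_mem (i : ι) (a : 𝒟.Alg K) :
    a - 𝒟.vertexHom K i (𝒟.toE K i a) ∈ 𝒟.idemIdeal K i := by
  induction a using alg_induction with
  | algebraMap k => rw [AlgHom.commutes, AlgHom.commutes, sub_self]; exact zero_mem _
  | e j =>
    by_cases h : j = i
    · subst h
      rw [toE_e, map_one, ← neg_sub]
      exact neg_mem (𝒟.one_sub_e_mem j)
    · rw [toE, toVertex, lift_e, if_neg h, map_zero, sub_zero]
      exact 𝒟.e_mem_idemIdeal K h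
  | ε j =>
    by_cases h : j = i
    · subst h
      rw [toE_ε, vertexHom_truncX, sub_self]
      exact zero_mem _
    · rw [toE, toVertex, lift_ε, if_neg h, map_zero, sub_zero]
      exact 𝒟.ε_mem_idemIdeal K h
  | α j k g =>
    rw [toE, toVertex, lift_α, map_zero, sub_zero]
    by_cases h : j = i
    · subst h
      by_cases hk : k = j
      · subst hk; rw [α_self]; exact zero_mem _
      · exact 𝒟.α_mem_idemIdeal' hk _ _
    · exact 𝒟.α_mem_idemIdeal h _ _
  | add a b ha hb =>
    rw [map_add, map_add, add_sub_add_comm]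
    exact add_mem ha hb
  | mul a b ha hb =>
    rw [map_mul, map_mul]
    have h : a * b - 𝒟.vertexHom K i (𝒟.toE K i a) * 𝒟.vertexHom K i (𝒟.toE K i b) =
        (a - 𝒟.vertexHom K i (𝒟.toE K i a)) * b +
          𝒟.vertexHom K i (𝒟.toE K i a) * (b - 𝒟.vertexHom K i (𝒟.toE K i b)) := by noncomm_ring
    rw [h]
    exact add_mem (Ideal.mul_mem_right _ _ ha) (Ideal.mul_mem_left _ _ hb)

theorem mem_idemIdeal_iff {i : ι} {a : 𝒟.Alg K} : a ∈ 𝒟.idemIdeal K i ↔ 𝒟.toE K i a = 0 := by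
  constructor
  · intro h
    induction h using Submodule.span_induction with
    | mem a ha =>
      obtain ⟨b, b', rfl⟩ := ha
      rw [map_mul, map_mul, map_sub, map_one, toE_e, sub_self, mul_zero, zero_mul]
    | zero => exact map_zero _
    | add a b _ _ ha hb => rw [map_add, ha, hb, add_zero]
    | smul b a _ ha => rw [smul_eq_mul, map_mul, ha, mul_zero]
  · intro h
    have := 𝒟.sub_vertexHom_toE_mem K i a
    rwa [h, map_zero, sub_zero] at this

theorem isFreeNilp_epsOn_E (i k : ι) : IsFreeNilp (𝒟.c k) (𝒟.epsOn K (𝒟.E K i) k) := by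
  intro x hx
  by_cases h : k = i
  · subst h
    have h1 : truncX K (𝒟.c k) ^ 1 * (show TruncPoly K (𝒟.c k) from x.1) = 0 := by
      have := congrArg Subtype.val hx
      rw [coe_epsOn] at this
      rw [pow_one, ← toE_ε]
      exact this
    obtain ⟨y, hy⟩ := (truncX_pow_mul_eq_zero_iff (𝒟.one_le_c k) _).1 h1
    refine ⟨⟨y, (𝒟.mem_vertexSpace K).2 (𝒟.e_smul_E K k y)⟩, Subtype.ext ?_⟩
    rw [coe_epsOn_pow]
    change _ = 𝒟.toE K k (𝒟.ε K k ^ (𝒟.c k - 1)) * y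
    rw [map_pow, toE_ε]
    exact hy
  · refine ⟨0, ?_⟩
    rw [map_zero]
    apply Subtype.ext
    rw [← (𝒟.mem_vertexSpace K).1 x.2, ← 𝒟.e_smul_E K i x.1, e_smul_e_smul_of_ne h]
    rfl

theorem finrank_vertexSpace_E [DecidableEq ι] (i k : ι) :
    Module.finrank K (𝒟.vertexSpace K (𝒟.E K i) k) = if k = i then 𝒟.c k else 0 := by
  by_cases h : k = i
  · subst h
    have : 𝒟.vertexSpace K (𝒟.E K k) k = ⊤ := by
      rw [eq_top_iff]
      exact fun x _ => (𝒟.mem_vertexSpace K).2 (𝒟.e_smul_E K k x)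
    rw [this, finrank_top, if_pos rfl]
    exact finrank_truncPoly
  · have : 𝒟.vertexSpace K (𝒟.E K i) k = ⊥ := by
      rw [eq_bot_iff]
      intro x hx
      rw [mem_vertexSpace] at hx
      rw [Submodule.mem_bot, ← hx, ← 𝒟.e_smul_E K i x, e_smul_e_smul_of_ne h]
    rw [this, finrank_bot, if_neg h]

instance (i : ι) : Module.Finite K (𝒟.E K i) := finite_truncPoly

variable {K}
variable {M : Type v} [AddCommGroup M] [Module K M] [Module (𝒟.Alg K) M]
  [IsScalarTower K (𝒟.Alg K) M]

theorem ker_vertexMap_toE {i : ι} (φ : M →ₗ[𝒟.Alg K] 𝒟.E K i)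
    (hker : LinearMap.ker φ = 𝒟.idemIdeal K i • (⊤ : Submodule (𝒟.Alg K) M)) :
    LinearMap.ker (𝒟.vertexMap K φ i) = LinearMap.range (𝒟.inMap K M i) := by
  ext x
  rw [mem_range_inMap, ← hker, LinearMap.mem_ker, LinearMap.mem_ker, ← coe_vertexMap,
    Submodule.coe_eq_zero]

/-- The cokernel of M_in at i is the part at i of M / I_i M ≅ E_i, which is free of rank one over
H_i. -/
theorem coker_inMap_of_toE {i : ι} (φ : M →ₗ[𝒟.Alg K] 𝒟.E K i) (hφ : Function.Surjective φ)
    (hker : LinearMap.ker φ = 𝒟.idemIdeal K i • (⊤ : Submodule (𝒟.Alg K) M))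
    (x : 𝒟.vertexSpace K M i) (hx : 𝒟.epsOn K M i x ∈ LinearMap.range (𝒟.inMap K M i)) :
    ∃ y, x - (𝒟.epsOn K M i ^ (𝒟.c i - 1)) y ∈ LinearMap.range (𝒟.inMap K M i) := by
  rw [← ker_vertexMap_toE 𝒟 φ hker] at hx ⊢
  rw [LinearMap.mem_ker, vertexMap_epsOn] at hx
  obtain ⟨y, hy⟩ := 𝒟.isFreeNilp_epsOn_E K i i _ hx
  obtain ⟨y, rfl⟩ := 𝒟.vertexMap_surjective K hφ i y
  refine ⟨y, ?_⟩
  rw [LinearMap.mem_ker, map_sub, pow_apply_comm_of_comp (𝒟.vertexMap_epsOn K φ i), ← hy, sub_self]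

theorem finrank_range_inMap_of_toE [Module.Finite K M] {i : ι} (φ : M →ₗ[𝒟.Alg K] 𝒟.E K i)
    (hφ : Function.Surjective φ)
    (hker : LinearMap.ker φ = 𝒟.idemIdeal K i • (⊤ : Submodule (𝒟.Alg K) M)) :
    𝒟.c i + Module.finrank K (LinearMap.range (𝒟.inMap K M i)) =
      Module.finrank K (𝒟.vertexSpace K M i) := by
  classical
  rw [← LinearMap.finrank_range_add_finrank_ker (𝒟.vertexMap K φ i), ker_vertexMap_toE 𝒟 φ hker,
    LinearMap.range_eq_top.2 (𝒟.vertexMap_surjective K hφ i), finrank_top, finrank_vertexSpace_E,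
    if_pos rfl]

end VertexIdeal

end GPA.CartanDatum

namespace GPA.CartanDatum

/-! ### Transport along homomorphisms that are bijective at a vertex -/

section Transport

variable {ι : Type w} (𝒟 : CartanDatum ι) [Fintype ι] {K : Type u} [Field K]
variable {M : Type v} [AddCommGroup M] [Module K M] [Module (𝒟.Alg K) M]
  [IsScalarTower K (𝒟.Alg K) M]
variable {N : Type*} [AddCommGroup N] [Module K N] [Module (𝒟.Alg K) N]
  [IsScalarTower K (𝒟.Alg K) N]

theorem isFreeNilp_of_bijective {φ : M →ₗ[𝒟.Alg K] N} {k : ι}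
    (h : Function.Bijective (𝒟.vertexMap K φ k)) (hN : IsFreeNilp (𝒟.c k) (𝒟.epsOn K N k)) :
    IsFreeNilp (𝒟.c k) (𝒟.epsOn K M k) :=
  hN.extension (𝒟.one_le_c k) (𝒟.epsOn_pow K M k) h.2 (𝒟.vertexMap_epsOn K φ k) fun x hx _ =>
    ⟨0, map_zero _, by rw [map_zero]; exact h.1 (hx.trans (map_zero _).symm)⟩

theorem bijective_vertexMap (φ : M ≃ₗ[𝒟.Alg K] N) (k : ι) :
    Function.Bijective (𝒟.vertexMap K (φ : M →ₗ[𝒟.Alg K] N) k) :=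
  ⟨𝒟.vertexMap_injective K φ.injective k, 𝒟.vertexMap_surjective K φ.surjective k⟩

theorem finrank_vertexSpace_of_bijective {φ : M →ₗ[𝒟.Alg K] N} {k : ι}
    (h : Function.Bijective (𝒟.vertexMap K φ k)) :
    Module.finrank K (𝒟.vertexSpace K M k) = Module.finrank K (𝒟.vertexSpace K N k) :=
  (LinearEquiv.ofBijective _ h).finrank_eq

end Transport

/-! ### Local freeness and rank vector of Π e_i / I_w e_i -/

section QP

variable {ι : Type w} (𝒟 : CartanDatum ι) [Fintype ι] (K : Type u) [Field K]

/-- `I_w e_i`, as a submodule of `Π e_i`. -/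
abbrev subP (i : ι) (l : List ι) : Submodule (𝒟.Alg K) (𝒟.P K i) :=
  (𝒟.I K l).submoduleOf (𝒟.P K i)

/-- The module `Π e_i / I_w e_i`. -/
abbrev QP (i : ι) (l : List ι) : Type _ := 𝒟.P K i ⧸ 𝒟.subP K i l

/-- The generator of `Π e_i`. -/
def genP (i : ι) : 𝒟.P K i := ⟨𝒟.e K i, (𝒟.mem_P K).2 ((𝒟.relations K).e_mul_self i)⟩

theorem e_smul_genP (i : ι) : 𝒟.e K i • 𝒟.genP K i = 𝒟.genP K i :=
  Subtype.ext ((𝒟.relations K).e_mul_self i)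

variable {K}

theorem smul_genP (i : ι) (p : 𝒟.P K i) : (p : 𝒟.Alg K) • 𝒟.genP K i = p :=
  Subtype.ext ((𝒟.mem_P K).1 p.2)

theorem I_cons (j : ι) (l : List ι) : 𝒟.I K (j :: l) = 𝒟.idemIdeal K j * 𝒟.I K l := rfl

theorem smul_mem_idemIdeal_smul_subP {i j : ι} {l : List ι} {a : 𝒟.Alg K}
    (ha : a ∈ 𝒟.I K (j :: l)) : a • 𝒟.genP K i ∈ 𝒟.idemIdeal K j • 𝒟.subP K i l := by
  rw [I_cons] at ha
  induction ha using Submodule.mul_induction_on' with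
  | mem_mul_mem b hb a ha =>
    rw [mul_smul]
    exact Submodule.smul_mem_smul hb (Ideal.mul_mem_right _ _ ha)
  | add a _ b _ ha hb => rw [add_smul]; exact add_mem ha hb

theorem subP_cons (i j : ι) (l : List ι) :
    𝒟.subP K i (j :: l) = 𝒟.idemIdeal K j • 𝒟.subP K i l := by
  apply le_antisymm
  · intro p hp
    rw [← 𝒟.smul_genP i p]
    exact 𝒟.smul_mem_idemIdeal_smul_subP hp
  · rw [Submodule.smul_le]
    intro a ha n hn
    exact Ideal.mul_mem_mul ha hn

theorem e_mem_I {i : ι} {l : List ι} (h : i ∉ l) : 𝒟.e K i ∈ 𝒟.I K l := by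
  induction l with
  | nil => trivial
  | cons j l ih =>
    rw [List.mem_cons, not_or] at h
    rw [← (𝒟.relations K).e_mul_self i]
    exact Ideal.mul_mem_mul (𝒟.e_mem_idemIdeal K h.1) (ih h.2)

theorem subP_eq_top {i : ι} {l : List ι} (h : i ∉ l) : 𝒟.subP K i l = ⊤ := by
  rw [eq_top_iff]
  intro p _
  rw [← 𝒟.smul_genP i p]
  exact Ideal.mul_mem_left _ _ (𝒟.e_mem_I h)

theorem I_le_idemIdeal {i : ι} {l : List ι} (h : i ∈ l) : 𝒟.I K l ≤ 𝒟.idemIdeal K i := by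
  induction l with
  | nil => simp at h
  | cons j l ih =>
    rw [I_cons, Ideal.mul_le]
    intro a ha b hb
    rcases List.mem_cons.1 h with rfl | h
    · exact Ideal.mul_mem_right _ _ ha
    · exact Ideal.mul_mem_left _ _ (ih h hb)

variable (K) in
/-- The projection `Π e_i → E_i`. -/
def PtoE (i : ι) : 𝒟.P K i →ₗ[𝒟.Alg K] 𝒟.E K i where
  toFun p := (𝒟.toE K i p : TruncPoly K (𝒟.c i))
  map_add' _ _ := map_add (𝒟.toE K i) _ _
  map_smul' _ _ := map_mul (𝒟.toE K i) _ _

theorem PtoE_apply (i : ι) (p : 𝒟.P K i) : 𝒟.PtoE K i p = 𝒟.toE K i p := rfl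

theorem PtoE_surjective (i : ι) : Function.Surjective (𝒟.PtoE K i) := by
  intro (x : TruncPoly K (𝒟.c i))
  refine ⟨𝒟.vertexHom K i x • 𝒟.genP K i, ?_⟩
  have h : 𝒟.toE K i (𝒟.vertexHom K i x * 𝒟.e K i) = x := by
    rw [map_mul, toE_vertexHom, toE_e, mul_one]
  exact h

theorem ker_PtoE (i : ι) : LinearMap.ker (𝒟.PtoE K i) = 𝒟.idemIdeal K i • ⊤ := by
  apply le_antisymm
  · intro p hp
    have h1 : (p : 𝒟.Alg K) ∈ 𝒟.idemIdeal K i := (𝒟.mem_idemIdeal_iff K).2 hp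
    rw [← 𝒟.smul_genP i p]
    exact Submodule.smul_mem_smul h1 Submodule.mem_top
  · rw [Submodule.smul_le]
    intro a ha n _
    rw [LinearMap.mem_ker, PtoE_apply, Submodule.coe_smul, smul_eq_mul, map_mul,
      (𝒟.mem_idemIdeal_iff K).1 ha, zero_mul]
    rfl

theorem QP_cyclic (i : ι) (l : List ι) (y : 𝒟.QP K i l) :
    ∃ a : 𝒟.Alg K, a • (Submodule.Quotient.mk (𝒟.genP K i) : 𝒟.QP K i l) = y := by
  obtain ⟨p, rfl⟩ := Submodule.Quotient.mk_surjective _ y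
  exact ⟨p, by rw [← Submodule.Quotient.mk_smul, smul_genP]⟩

variable (K) in
theorem QP_gen (i : ι) (l : List ι) :
    𝒟.e K i • (Submodule.Quotient.mk (𝒟.genP K i) : 𝒟.QP K i l) =
      Submodule.Quotient.mk (𝒟.genP K i) := by
  rw [← Submodule.Quotient.mk_smul, e_smul_genP]

/-- The projection `Π e_i / I_w e_i → E_i`. -/
def QPtoE {i : ι} {l : List ι} (h : i ∈ l) : 𝒟.QP K i l →ₗ[𝒟.Alg K] 𝒟.E K i :=
  (𝒟.subP K i l).liftQ (𝒟.PtoE K i) fun _ hp =>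
    (𝒟.mem_idemIdeal_iff K).1 (𝒟.I_le_idemIdeal h hp)

theorem QPtoE_surjective {i : ι} {l : List ι} (h : i ∈ l) :
    Function.Surjective (𝒟.QPtoE (K := K) h) := by
  intro x
  obtain ⟨p, rfl⟩ := 𝒟.PtoE_surjective i x
  exact ⟨Submodule.Quotient.mk p, rfl⟩

theorem ker_QPtoE {i : ι} {l : List ι} (h : i ∈ l) :
    LinearMap.ker (𝒟.QPtoE (K := K) h) = 𝒟.idemIdeal K i • ⊤ := by
  apply le_antisymm
  · intro x hx
    obtain ⟨p, rfl⟩ := Submodule.Quotient.mk_surjective _ x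
    have h1 : p ∈ LinearMap.ker (𝒟.PtoE K i) := hx
    rw [ker_PtoE] at h1
    induction h1 using Submodule.smul_induction_on' with
    | smul a ha n hn =>
      exact Submodule.smul_mem_smul (N := (⊤ : Submodule (𝒟.Alg K) (𝒟.QP K i l)))
        (n := Submodule.Quotient.mk n) ha Submodule.mem_top
    | add x hx' y hy' hx'' hy'' =>
      rw [← ker_PtoE] at hx' hy'
      exact add_mem (hx'' hx') (hy'' hy')
  · rw [Submodule.smul_le]
    intro a ha n _
    rw [LinearMap.mem_ker, map_smul]
    change 𝒟.toE K i a * (show TruncPoly K (𝒟.c i) from 𝒟.QPtoE h n) = 0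
    rw [(𝒟.mem_idemIdeal_iff K).1 ha, zero_mul]

theorem rvec_eq_zero [DecidableEq ι] {i : ι} {l : List ι} (h : i ∉ l) : 𝒟.rvec i l = 0 := by
  induction l with
  | nil => rfl
  | cons j l ih =>
    rw [List.mem_cons, not_or] at h
    rw [rvec, ih h.2, if_neg (Ne.symm h.1), map_zero, zero_smul, add_zero]

variable (K) in
/-- `Π e_i / I_w e_i` is locally free with rank vector `w λ - λ` for `λ = -ϖ_i`. -/
structure IsExtremal [DecidableEq ι] (i : ι) (l : List ι) : Prop where
  finite : Module.Finite K (𝒟.QP K i l)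
  free : ∀ k, IsFreeNilp (𝒟.c k) (𝒟.epsOn K (𝒟.QP K i l) k)
  rank : ∀ k, (Module.finrank K (𝒟.vertexSpace K (𝒟.QP K i l) k) : ℤ) = 𝒟.c k * 𝒟.rvec i l k

variable [DecidableEq ι]

theorem IsExtremal.dimVec_eq {i : ι} {l : List ι} (h : 𝒟.IsExtremal K i l) :
    𝒟.dimVec K (𝒟.QP K i l) = (∏ k, 𝒟.c k : ℤ) • 𝒟.rvec i l := by
  funext k
  have h1 : (𝒟.scale k : ℤ) * 𝒟.c k = ∏ k, (𝒟.c k : ℤ) := by exact_mod_cast 𝒟.scale_mul_c k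
  rw [dimVec, h.rank, ← mul_assoc, h1]
  rfl

theorem isExtremal_of_subP_eq_top {i : ι} {l : List ι} (h : i ∉ l) : 𝒟.IsExtremal K i l := by
  have : Subsingleton (𝒟.QP K i l) :=
    Submodule.Quotient.subsingleton_iff.2 (𝒟.subP_eq_top h)
  refine ⟨inferInstance, fun k x _ => ⟨0, Subsingleton.elim _ _⟩, fun k => ?_⟩
  rw [Module.finrank_zero_of_subsingleton, rvec_eq_zero 𝒟 h]
  simp

theorem exists_inMap_eq_of_ne {M : Type v} [AddCommGroup M] [Module K M] [Module (𝒟.Alg K) M]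
    [IsScalarTower K (𝒟.Alg K) M] {i j : ι} {x : M} (hx : 𝒟.e K i • x = x)
    (hgen : ∀ y : M, ∃ a : 𝒟.Alg K, a • x = y) (hij : j ≠ i) :
    LinearMap.range (𝒟.inMap K M j) = ⊤ := by
  rw [eq_top_iff]
  rintro ⟨p, hp⟩ _
  have h1 := 𝒟.vertexSpace_le_of_cyclic K hx hgen j p ((𝒟.mem_vertexSpace K).1 hp)
  rw [if_neg hij, sup_bot_eq] at h1
  obtain ⟨y, hy, rfl⟩ := h1
  exact hy

section Inductive

variable {i j : ι} {l : List ι}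

/-- For j ≠ i the generator e_i contributes nothing at j, so M_in is onto. For j = i the occurrence
of i in l puts I_l inside I_i, and the part of I_i e_i at i is the image of M_in. -/
theorem exists_inMap_eq_of_mem_subP (hi : i ∈ l) (p : 𝒟.P K i) (hp : p ∈ 𝒟.subP K i l)
    (hep : 𝒟.e K j • p = p) : ∃ z, (𝒟.inMap K (𝒟.P K i) j z : 𝒟.P K i) = p := by
  suffices h : (⟨p, (𝒟.mem_vertexSpace K).2 hep⟩ : 𝒟.vertexSpace K (𝒟.P K i) j) ∈
      LinearMap.range (𝒟.inMap K (𝒟.P K i) j) by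
    obtain ⟨z, hz⟩ := h
    exact ⟨z, congrArg Subtype.val hz⟩
  by_cases hij : j = i
  · subst hij
    rw [mem_range_inMap, ← ker_PtoE]
    exact (𝒟.mem_idemIdeal_iff K).1 (𝒟.I_le_idemIdeal hi hp)
  · rw [𝒟.exists_inMap_eq_of_ne (𝒟.e_smul_genP K i) (fun y => ⟨y, 𝒟.smul_genP i y⟩) hij]
    trivial

/-- This is where reducedness of j :: l enters the induction: a nonzero kernel would be a part of
the module killed by I_j. -/
theorem outMap_QP_injective (hl : 𝒟.IsReduced (j :: l)) (h : 𝒟.IsExtremal K i l) :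
    Function.Injective (𝒟.outMap K (𝒟.QP K i l) j) := by
  have := h.finite
  have h1 := 𝒟.idemTor_eq_bot_of_extremal hl (𝒟.QP K i l) (𝒟.QP_gen K i l) (𝒟.QP_cyclic i l)
    (IsExtremal.dimVec_eq 𝒟 h)
  rw [← LinearMap.ker_eq_bot, eq_bot_iff]
  intro x hx
  rw [mem_ker_outMap, h1, Submodule.mem_bot] at hx
  exact Subtype.ext hx

theorem coker_inMap_QP (hi : i ∈ l) (x : 𝒟.vertexSpace K (𝒟.QP K i l) j)
    (hx : 𝒟.epsOn K (𝒟.QP K i l) j x ∈ LinearMap.range (𝒟.inMap K (𝒟.QP K i l) j)) :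
    ∃ y, x - (𝒟.epsOn K (𝒟.QP K i l) j ^ (𝒟.c j - 1)) y ∈
      LinearMap.range (𝒟.inMap K (𝒟.QP K i l) j) := by
  by_cases hij : j = i
  · subst hij
    exact 𝒟.coker_inMap_of_toE (𝒟.QPtoE hi) (𝒟.QPtoE_surjective hi) (𝒟.ker_QPtoE hi) x hx
  · refine ⟨0, ?_⟩
    rw [𝒟.exists_inMap_eq_of_ne (𝒟.QP_gen K i l) (𝒟.QP_cyclic i l) hij]
    trivial

theorem finrank_range_inMap_QP (hi : i ∈ l) [Module.Finite K (𝒟.QP K i l)] :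
    (if j = i then 𝒟.c j else 0) + Module.finrank K (LinearMap.range (𝒟.inMap K (𝒟.QP K i l) j)) =
      Module.finrank K (𝒟.vertexSpace K (𝒟.QP K i l) j) := by
  by_cases hij : j = i
  · subst hij
    rw [if_pos rfl]
    exact 𝒟.finrank_range_inMap_of_toE (𝒟.QPtoE hi) (𝒟.QPtoE_surjective hi) (𝒟.ker_QPtoE hi)
  · rw [𝒟.exists_inMap_eq_of_ne (𝒟.QP_gen K i l) (𝒟.QP_cyclic i l) hij, finrank_top, if_neg hij,
      zero_add]

theorem free_step_QP (hl : 𝒟.IsReduced (j :: l)) (h : 𝒟.IsExtremal K i l) (hi : i ∈ l)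
    {p : 𝒟.P K i} (hp : p ∈ 𝒟.subP K i l) (hep : 𝒟.e K j • p = p)
    (hεp : 𝒟.ε K j • p ∈ 𝒟.idemIdeal K j • 𝒟.subP K i l) :
    ∃ p' ∈ 𝒟.subP K i l, 𝒟.e K j • p' = p' ∧
      p - 𝒟.ε K j ^ (𝒟.c j - 1) • p' ∈ 𝒟.idemIdeal K j • 𝒟.subP K i l :=
  free_step (𝒟.subP K i l) (𝒟.exists_outMap_eq_P K i j)
    (𝒟.exists_inMap_eq_of_mem_subP hi) (𝒟.outMap_QP_injective hl h) h.free (𝒟.coker_inMap_QP hi)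
    hp hep hεp

/-- The dimension of the middle term is 2 d_j - ∑ c_kj d_k and the rank of M_in is d_j - δ_ij c_j.
With d_k = c_k r_k the difference is c_j (r_j - ⟨r, α_j^∨⟩ + δ_ij), the j-th coordinate of s_j r +
δ_ij α_j times c_j. -/
theorem rank_step [Module.Finite K (𝒟.QP K i l)]
    (h : ∀ k, (Module.finrank K (𝒟.vertexSpace K (𝒟.QP K i l) k) : ℤ) = 𝒟.c k * 𝒟.rvec i l k)
    (hi : i ∈ l) : (Module.finrank K (LinearMap.ker (𝒟.inMap K (𝒟.QP K i l) j)) : ℤ) =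
      𝒟.c j * 𝒟.rvec i (j :: l) j := by
  have h1 := LinearMap.finrank_range_add_finrank_ker (𝒟.inMap K (𝒟.QP K i l) j)
  have h2 := 𝒟.finrank_tilde K (M := 𝒟.QP K i l) j
  have h3 := 𝒟.finrank_range_inMap_QP (K := K) (j := j) hi
  have h4 : ∑ k, 𝒟.C k j * (Module.finrank K (𝒟.vertexSpace K (𝒟.QP K i l) k) : ℤ) =
      𝒟.c j * 𝒟.corootR j (𝒟.rvec i l) := by
    rw [corootR_apply, Finset.mul_sum]
    refine Finset.sum_congr rfl fun k _ => ?_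
    have h5 := 𝒟.symm j k
    rw [h]
    linear_combination (-𝒟.rvec i l k) * h5
  rw [h4, h] at h2
  have h5 : ((if j = i then 𝒟.c j else 0 : ℕ) : ℤ) +
      Module.finrank K (LinearMap.range (𝒟.inMap K (𝒟.QP K i l) j)) = 𝒟.c j * 𝒟.rvec i l j := by
    rw [← h]; exact_mod_cast h3
  have h6 : 𝒟.rvec i (j :: l) j =
      𝒟.rvec i l j - 𝒟.corootR j (𝒟.rvec i l) + (if j = i then 1 else 0) := by
    rw [rvec, s_apply]
    split_ifs <;> simp
  have h7 : ((if j = i then 𝒟.c j else 0 : ℕ) : ℤ) = 𝒟.c j * (if j = i then 1 else 0) := by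
    split_ifs <;> simp
  have h8 : (Module.finrank K (LinearMap.range (𝒟.inMap K (𝒟.QP K i l) j)) : ℤ) +
      Module.finrank K (LinearMap.ker (𝒟.inMap K (𝒟.QP K i l) j)) =
      Module.finrank K (𝒟.Tilde K (𝒟.QP K i l) j) := by exact_mod_cast h1
  rw [h6]
  rw [h7] at h5
  linear_combination h8 + h2 - h5

/-- Only the vertex j changes. There the new module is an extension of the old one by the homology
of its complex, which is free and has the dimension of ker M_in minus that of the old vertex space.
-/
theorem isExtremal_step (hl : 𝒟.IsReduced (j :: l)) (h : 𝒟.IsExtremal K i l) (hi : i ∈ l) :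
    𝒟.IsExtremal K i (j :: l) := by
  have hfin := h.finite
  have hout := 𝒟.outMap_QP_injective hl h
  obtain ⟨hkfin, hk⟩ := finrank_ker_stepMap (𝒟.subP K i l) (𝒟.exists_outMap_eq_P K i j)
    (𝒟.exists_inMap_eq_of_mem_subP hi) hout
  have hrk := 𝒟.rank_step h.rank hi (j := j)
  suffices h1 : Module.Finite K (𝒟.P K i ⧸ 𝒟.idemIdeal K j • 𝒟.subP K i l) ∧
      (∀ k, IsFreeNilp (𝒟.c k) (𝒟.epsOn K (𝒟.P K i ⧸ 𝒟.idemIdeal K j • 𝒟.subP K i l) k)) ∧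
      (∀ k, (Module.finrank K (𝒟.vertexSpace K (𝒟.P K i ⧸ 𝒟.idemIdeal K j • 𝒟.subP K i l) k) : ℤ) =
        𝒟.c k * 𝒟.rvec i (j :: l) k) by
    rw [← subP_cons] at h1
    exact ⟨h1.1, h1.2.1, h1.2.2⟩
  have hsurj := fun k =>
    𝒟.vertexMap_surjective K (𝒟.stepMap_surjective (𝒟.subP K i l) j) k
  have hbij : ∀ k ≠ j, Function.Bijective (𝒟.vertexMap K (𝒟.stepMap (𝒟.subP K i l) j) k) :=
    fun k hkj => ⟨𝒟.vertexMap_stepMap_injective _ j hkj, hsurj k⟩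
  have hfink : ∀ k, Module.Finite K
      (𝒟.vertexSpace K (𝒟.P K i ⧸ 𝒟.idemIdeal K j • 𝒟.subP K i l) k) := by
    intro k
    by_cases hkj : k = j
    · subst hkj
      have : Module.Finite K (_ ⧸ LinearMap.ker (𝒟.vertexMap K (𝒟.stepMap (𝒟.subP K i l) k) k)) :=
        Module.Finite.equiv (LinearMap.quotKerEquivOfSurjective _ (hsurj k)).symm
      exact Module.Finite.of_submodule_quotient
        (LinearMap.ker (𝒟.vertexMap K (𝒟.stepMap (𝒟.subP K i l) k) k))
    · exact Module.Finite.equiv (LinearEquiv.ofBijective _ (hbij k hkj)).symm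
  refine ⟨finite_of_vertexSpace (𝒟 := 𝒟) hfink, fun k => ?_, fun k => ?_⟩
  · by_cases hkj : k = j
    · subst hkj
      refine (h.free k).extension (𝒟.one_le_c k) (𝒟.epsOn_pow K _ k) (hsurj k)
        (𝒟.vertexMap_epsOn K (𝒟.stepMap (𝒟.subP K i l) k) k) ?_
      rintro ⟨x, hx⟩ hx0 hεx
      obtain ⟨p, rfl⟩ := Submodule.Quotient.mk_surjective _ x
      have h1 : p ∈ 𝒟.subP K i l := (Submodule.Quotient.mk_eq_zero _).1 (congrArg Subtype.val hx0)
      rw [mem_vertexSpace] at hx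
      obtain ⟨p', hp', hep', h2⟩ := 𝒟.free_step_QP hl h hi (p := 𝒟.e K k • p)
        (Submodule.smul_mem _ _ h1) (e_smul_e_smul k p) (by
          rw [ε_smul_e_smul]
          exact (Submodule.Quotient.mk_eq_zero _).1 (congrArg Subtype.val hεx))
      refine ⟨⟨Submodule.Quotient.mk p', (𝒟.mem_vertexSpace K).2 (by
        rw [← Submodule.Quotient.mk_smul, hep'])⟩, ?_, ?_⟩
      · apply Subtype.ext
        exact (Submodule.Quotient.mk_eq_zero _).2 hp'
      · apply Subtype.ext
        rw [coe_epsOn_pow]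
        rw [← Submodule.Quotient.mk_eq_zero, Submodule.Quotient.mk_sub, sub_eq_zero,
          Submodule.Quotient.mk_smul, hx, Submodule.Quotient.mk_smul] at h2
        exact h2
    · exact 𝒟.isFreeNilp_of_bijective (hbij k hkj) (h.free k)
  · by_cases hkj : k = j
    · subst hkj
      have h1 := LinearMap.finrank_range_add_finrank_ker
        (𝒟.vertexMap K (𝒟.stepMap (𝒟.subP K i l) k) k)
      rw [LinearMap.range_eq_top.2 (hsurj k), finrank_top, add_comm, hk] at h1
      rw [← hrk, h1]
    · rw [𝒟.finrank_vertexSpace_of_bijective (hbij k hkj), h.rank]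
      congr 1
      rw [rvec, Pi.add_apply, s_apply_of_ne _ hkj, Pi.smul_apply, Pi.single_eq_of_ne hkj, smul_zero,
        add_zero]

/-- The general step does not apply to L = Π e_i, whose generator is not in the image of M_in at i.
The rightmost letter i has to be treated directly and produces E_i. -/
theorem isExtremal_base (hi : i ∉ l) : 𝒟.IsExtremal K i (i :: l) := by
  have h0 : 𝒟.subP K i (i :: l) = LinearMap.ker (𝒟.PtoE K i) := by
    rw [subP_cons, subP_eq_top 𝒟 hi, ker_PtoE]
  let e : 𝒟.QP K i (i :: l) ≃ₗ[𝒟.Alg K] 𝒟.E K i :=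
    Submodule.quotEquivOfEq _ _ h0 ≪≫ₗ
      (𝒟.PtoE K i).quotKerEquivOfSurjective (𝒟.PtoE_surjective i)
  refine ⟨Module.Finite.equiv (e.restrictScalars K).symm, fun k => ?_, fun k => ?_⟩
  · exact 𝒟.isFreeNilp_of_bijective (𝒟.bijective_vertexMap e k) (𝒟.isFreeNilp_epsOn_E K i k)
  · rw [𝒟.finrank_vertexSpace_of_bijective (𝒟.bijective_vertexMap e k), finrank_vertexSpace_E,
      rvec, rvec_eq_zero 𝒟 hi, if_pos rfl, map_zero, zero_add, one_smul]
    by_cases hk : k = i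
    · subst hk; simp
    · simp [hk]

end Inductive

theorem isExtremal_of_isReduced (i : ι) {l : List ι} (hl : 𝒟.IsReduced l) :
    𝒟.IsExtremal K i l := by
  induction l with
  | nil => exact 𝒟.isExtremal_of_subP_eq_top (by simp)
  | cons j l ih =>
    by_cases hi : i ∈ l
    · exact 𝒟.isExtremal_step hl (ih (IsReduced.of_append_right 𝒟 (l := [j]) hl)) hi
    · by_cases hij : i = j
      · subst hij
        exact 𝒟.isExtremal_base hi
      · exact 𝒟.isExtremal_of_subP_eq_top (by simp [hi, hij])

/-- The successive quotients `I_w e_i / I_j I_w e_i` are free over `H_j`. -/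
theorem free_subP_quotient (i : ι) {j : ι} {l : List ι} (hl : 𝒟.IsReduced (j :: l)) {p : 𝒟.P K i}
    (hp : p ∈ 𝒟.subP K i l) (hep : 𝒟.e K j • p = p) (hεp : 𝒟.ε K j • p ∈ 𝒟.subP K i (j :: l)) :
    ∃ p' ∈ 𝒟.subP K i l, 𝒟.e K j • p' = p' ∧
      p - 𝒟.ε K j ^ (𝒟.c j - 1) • p' ∈ 𝒟.subP K i (j :: l) := by
  by_cases hi : i ∈ l
  · rw [subP_cons] at hεp ⊢
    exact 𝒟.free_step_QP hl
      (𝒟.isExtremal_of_isReduced i (IsReduced.of_append_right 𝒟 (l := [j]) hl)) hi hp hep hεp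
  by_cases hij : i = j
  · subst hij
    have h0 : 𝒟.subP K i (i :: l) = LinearMap.ker (𝒟.PtoE K i) := by
      rw [subP_cons, subP_eq_top 𝒟 hi, ker_PtoE]
    rw [h0] at hεp ⊢
    rw [subP_eq_top 𝒟 hi]
    obtain ⟨y, hy⟩ := 𝒟.isFreeNilp_epsOn_E K i i (𝒟.vertexMap K (𝒟.PtoE K i) i
      ⟨p, (𝒟.mem_vertexSpace K).2 hep⟩) (by
        rw [← vertexMap_epsOn]
        exact Subtype.ext hεp)
    obtain ⟨q, rfl⟩ := 𝒟.vertexMap_surjective K (𝒟.PtoE_surjective i) i y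
    refine ⟨q, trivial, (𝒟.mem_vertexSpace K).1 q.2, ?_⟩
    have h1 := congrArg Subtype.val hy
    rw [coe_epsOn_pow, coe_vertexMap, coe_vertexMap, ← map_smul] at h1
    rw [LinearMap.mem_ker, map_sub, h1, sub_self]
  · refine ⟨0, zero_mem _, smul_zero _, ?_⟩
    rw [subP_eq_top 𝒟 (l := j :: l) (by simp [hi, hij])]
    trivial

end QP

end GPA.CartanDatum

namespace GPA.CartanDatum

/-! ### Rank vectors and freeness -/

section RankVector

variable {ι : Type w} (𝒟 : CartanDatum ι) [Fintype ι] {K : Type u} [Field K]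
variable {M : Type v} [AddCommGroup M] [Module K M] [Module (𝒟.Alg K) M]
  [IsScalarTower K (𝒟.Alg K) M]

theorem nontrivial_truncPoly (k : ι) : Nontrivial (TruncPoly K (𝒟.c k)) :=
  ⟨_, _, truncX_pow_pred_ne_zero (𝒟.one_le_c k)⟩

theorem isScalarTower_vertexModule (k : ι) :
    letI := 𝒟.vertexModule K M k
    IsScalarTower K (TruncPoly K (𝒟.c k)) (𝒟.vertexSpace K M k) := by
  let := 𝒟.vertexModule K M k
  refine ⟨fun a h x => ?_⟩
  change truncLift (𝒟.epsOn K M k) (𝒟.epsOn_pow K M k) (a • h) x =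
    a • truncLift (𝒟.epsOn K M k) (𝒟.epsOn_pow K M k) h x
  rw [map_smul]
  rfl

theorem vertexModule_pow_smul (k : ι) (n : ℕ) (x : 𝒟.vertexSpace K M k) :
    letI := 𝒟.vertexModule K M k
    truncX K (𝒟.c k) ^ n • x = (𝒟.epsOn K M k ^ n) x := by
  let := 𝒟.vertexModule K M k
  change truncLift (𝒟.epsOn K M k) (𝒟.epsOn_pow K M k) (truncX K (𝒟.c k) ^ n) x = _
  rw [map_pow, truncLift_truncX]

theorem hasRankVector_of_isFreeNilp {r : ι → ℕ}
    (hfin : ∀ k, Module.Finite K (𝒟.vertexSpace K M k))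
    (hfree : ∀ k, IsFreeNilp (𝒟.c k) (𝒟.epsOn K M k))
    (hr : ∀ k, Module.finrank K (𝒟.vertexSpace K M k) = 𝒟.c k * r k) :
    𝒟.HasRankVector K M r := by
  intro k
  let := 𝒟.vertexModule K M k
  have := 𝒟.isScalarTower_vertexModule (K := K) (M := M) k
  have := 𝒟.nontrivial_truncPoly (K := K) k
  have := hfin k
  have h1 : Module.Free (TruncPoly K (𝒟.c k)) (𝒟.vertexSpace K M k) := by
    refine free_of_isFreeNilp (𝒟.one_le_c k) fun x hx => ?_
    have h2 := 𝒟.vertexModule_pow_smul k 1 x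
    rw [pow_one, pow_one] at h2
    obtain ⟨y, hy⟩ := hfree k x (h2.symm.trans hx)
    exact ⟨y, hy.trans (𝒟.vertexModule_pow_smul k _ y).symm⟩
  have h3 : Module.Finite (TruncPoly K (𝒟.c k)) (𝒟.vertexSpace K M k) :=
    Module.Finite.of_restrictScalars_finite K _ _
  refine ⟨h1, h3, ?_⟩
  have h4 := Module.finrank_mul_finrank K (TruncPoly K (𝒟.c k)) (𝒟.vertexSpace K M k)
  rw [finrank_truncPoly, hr] at h4
  exact Nat.eq_of_mul_eq_mul_left (𝒟.one_le_c k) h4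

variable {𝒟} in
theorem HasRankVector.finite_vertexSpace {r : ι → ℕ} (h : 𝒟.HasRankVector K M r) (k : ι) :
    Module.Finite K (𝒟.vertexSpace K M k) := by
  let := 𝒟.vertexModule K M k
  have := 𝒟.isScalarTower_vertexModule (K := K) (M := M) k
  have := 𝒟.nontrivial_truncPoly (K := K) k
  obtain ⟨h1, h2, h3⟩ := h k
  exact Module.Finite.trans (TruncPoly K (𝒟.c k)) _

variable {𝒟} in
theorem HasRankVector.finrank_eq {r : ι → ℕ} (h : 𝒟.HasRankVector K M r) (k : ι) :
    Module.finrank K (𝒟.vertexSpace K M k) = 𝒟.c k * r k := by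
  let := 𝒟.vertexModule K M k
  have := 𝒟.isScalarTower_vertexModule (K := K) (M := M) k
  have := 𝒟.nontrivial_truncPoly (K := K) k
  obtain ⟨h1, h2, h3⟩ := h k
  rw [← Module.finrank_mul_finrank K (TruncPoly K (𝒟.c k)) (𝒟.vertexSpace K M k),
    finrank_truncPoly, h3]

variable {𝒟} in
/-- If `e_k M` is free of rank one, there is a linear form on it without `H_k`-submodules in its
kernel. -/
theorem HasRankVector.exists_dual {r : ι → ℕ} (h : 𝒟.HasRankVector K M r) {k : ι} (hk : r k = 1) :
    ∃ τ : Module.Dual K (𝒟.vertexSpace K M k),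
      ∀ y, (∀ n, τ ((𝒟.epsOn K M k ^ n) y) = 0) → y = 0 := by
  have hdim := h.finrank_eq k
  let := 𝒟.vertexModule K M k
  have := 𝒟.isScalarTower_vertexModule (K := K) (M := M) k
  have := 𝒟.nontrivial_truncPoly (K := K) k
  obtain ⟨h1, h2, h3⟩ := h k
  rw [hk] at h3
  let E : 𝒟.vertexSpace K M k ≃ₗ[TruncPoly K (𝒟.c k)] TruncPoly K (𝒟.c k) :=
    (Module.finBasisOfFinrankEq _ _ h3).equivFun ≪≫ₗ LinearEquiv.funUnique (Fin 1) _ _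
  -- The element z spans the socle of e_k M over K. Every nonzero H_k-submodule contains it, so any
  -- form with τ z ≠ 0 will do.
  let z := E.symm (truncX K (𝒟.c k) ^ (𝒟.c k - 1))
  have hz : z ≠ 0 := by
    intro h0
    exact truncX_pow_pred_ne_zero (𝒟.one_le_c k) (E.symm.map_eq_zero_iff.1 h0)
  obtain ⟨τ, hτ⟩ : ∃ τ : Module.Dual K (𝒟.vertexSpace K M k), τ z ≠ 0 := by
    by_contra! h0
    exact hz ((Module.forall_dual_apply_eq_zero_iff K z).1 h0)
  refine ⟨τ, fun y hy => ?_⟩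
  suffices h5 : ∀ a ≤ 𝒟.c k, ∃ h', E y = truncX K (𝒟.c k) ^ a * h' by
    obtain ⟨h', h6⟩ := h5 _ le_rfl
    rwa [truncX_pow, zero_mul, E.map_eq_zero_iff] at h6
  intro a ha
  induction a with
  | zero => exact ⟨E y, by rw [pow_zero, one_mul]⟩
  | succ a ih =>
    obtain ⟨h', h6⟩ := ih (by omega)
    obtain ⟨b, h'', rfl⟩ := exists_eq_algebraMap_add_truncX_mul h'
    have h7 : (𝒟.epsOn K M k ^ (𝒟.c k - 1 - a)) y = b • z := by
      rw [← vertexModule_pow_smul]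
      apply E.injective
      rw [map_smul, h6, smul_eq_mul, ← mul_assoc, ← pow_add,
        show 𝒟.c k - 1 - a + a = 𝒟.c k - 1 by omega, mul_add, ← mul_assoc, ← pow_succ,
        show 𝒟.c k - 1 + 1 = 𝒟.c k by omega, truncX_pow, zero_mul, add_zero]
      have h8 : b • z = algebraMap K (TruncPoly K (𝒟.c k)) b • z := (algebraMap_smul _ b z).symm
      rw [h8, map_smul, LinearEquiv.apply_symm_apply, smul_eq_mul, mul_comm]
    have h8 := hy (𝒟.c k - 1 - a)
    rw [h7, map_smul, smul_eq_mul, mul_eq_zero, or_iff_left hτ] at h8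
    refine ⟨h'', ?_⟩
    rw [h6, h8, map_zero, zero_add, pow_succ, mul_assoc]

end RankVector

/-! ### Filtrations by generalized simple modules -/

section Step

variable {ι : Type w} (𝒟 : CartanDatum ι) [Fintype ι] (K : Type u) [Field K]
variable {M : Type v} [AddCommGroup M] [Module (𝒟.Alg K) M]

/-- `N ⊆ N'` with `N' / N` isomorphic to a generalized simple module. -/
def EStep (N N' : Submodule (𝒟.Alg K) M) : Prop :=
  N ≤ N' ∧ ∃ j, Nonempty ((N' ⧸ N.submoduleOf N') ≃ₗ[𝒟.Alg K] 𝒟.E K j)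

theorem isEFiltered_of_reflTransGen
    (h : Relation.ReflTransGen (𝒟.EStep K) (⊥ : Submodule (𝒟.Alg K) M) ⊤) :
    𝒟.IsEFiltered K M := by
  suffices h' : ∀ N : Submodule (𝒟.Alg K) M, Relation.ReflTransGen (𝒟.EStep K) ⊥ N →
      ∃ (n : ℕ) (F : ℕ → Submodule (𝒟.Alg K) M), F 0 = ⊥ ∧ F n = N ∧
        ∀ k < n, 𝒟.EStep K (F k) (F (k + 1)) from h' _ h
  intro N hN
  induction hN with
  | refl => exact ⟨0, fun _ => ⊥, rfl, rfl, fun k hk => absurd hk (Nat.not_lt_zero k)⟩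
  | @tail N N' _ hs ih =>
    obtain ⟨n, F, h0, hn, hF⟩ := ih
    refine ⟨n + 1, fun m => if m ≤ n then F m else N', by simpa using h0, by simp, fun k hk => ?_⟩
    by_cases hkn : k < n
    · have h1 : k ≤ n := hkn.le
      have h2 : k + 1 ≤ n := hkn
      simp only [h1, h2, if_true]
      exact hF k hkn
    · obtain rfl : k = n := by omega
      simp only [le_refl, if_true, show ¬ k + 1 ≤ k by omega, if_false]
      rwa [hn]

theorem eStep_bot_range {j : ι} {f : 𝒟.E K j →ₗ[𝒟.Alg K] M} (hf : Function.Injective f) :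
    𝒟.EStep K ⊥ (LinearMap.range f) := by
  refine ⟨bot_le, j, ⟨Submodule.quotEquivOfEqBot _ ?_ ≪≫ₗ (LinearEquiv.ofInjective f hf).symm⟩⟩
  exact LinearMap.ker_eq_bot.2 (Submodule.subtype_injective _)

variable {K}

theorem smul_sub_vertexHom_smul_mem {j : ι} {N N' : Submodule (𝒟.Alg K) M}
    (hI : ∀ a ∈ 𝒟.idemIdeal K j, ∀ n ∈ N', a • n ∈ N) (a : 𝒟.Alg K) {n : M} (hn : n ∈ N') :
    a • n - 𝒟.vertexHom K j (𝒟.toE K j a) • n ∈ N := by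
  rw [← sub_smul]
  exact hI _ (𝒟.sub_vertexHom_toE_mem K j a) n hn

theorem eStep_of_generator {j : ι} {N N' : Submodule (𝒟.Alg K) M} (hN : N ≤ N')
    (hI : ∀ a ∈ 𝒟.idemIdeal K j, ∀ n ∈ N', a • n ∈ N) {y : M} (hy : y ∈ N')
    (hgen : ∀ x ∈ N', ∃ h, x - 𝒟.vertexHom K j h • y ∈ N)
    (hinj : ∀ h, 𝒟.vertexHom K j h • y ∈ N → h = 0) : 𝒟.EStep K N N' := by
  have hmem : ∀ h, 𝒟.vertexHom K j h • y ∈ N' := fun h => N'.smul_mem _ hy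
  let φ : 𝒟.E K j →ₗ[𝒟.Alg K] N' ⧸ N.submoduleOf N' :=
    { toFun := fun h => Submodule.Quotient.mk ⟨𝒟.vertexHom K j h • y, hmem h⟩
      map_add' := fun h h' => by
        rw [← Submodule.Quotient.mk_add]
        congr 1
        apply Subtype.ext
        exact (congrArg (· • y) (map_add (𝒟.vertexHom K j) h h')).trans (add_smul _ _ y)
      map_smul' := fun a h => by
        rw [RingHom.id_apply, ← Submodule.Quotient.mk_smul, eq_comm, Submodule.Quotient.eq]
        have h1 : 𝒟.vertexHom K j (𝒟.toE K j a) • 𝒟.vertexHom K j h • y =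
            𝒟.vertexHom K j (show TruncPoly K (𝒟.c j) from a • h) • y := by
          rw [← mul_smul]
          exact congrArg (· • y) (map_mul (𝒟.vertexHom K j) _ _).symm
        have h2 := 𝒟.smul_sub_vertexHom_smul_mem hI a (hmem h)
        rw [h1] at h2
        exact h2 }
  refine ⟨hN, j, ⟨(LinearEquiv.ofBijective φ ⟨?_, ?_⟩).symm⟩⟩
  · rw [← LinearMap.ker_eq_bot, eq_bot_iff]
    intro h hh
    exact hinj h ((Submodule.Quotient.mk_eq_zero (N.submoduleOf N')).1 hh)
  · intro x
    obtain ⟨⟨x, hx⟩, rfl⟩ := Submodule.Quotient.mk_surjective _ x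
    obtain ⟨h, hh⟩ := hgen x hx
    refine ⟨h, ((Submodule.Quotient.eq _).2 ?_).symm⟩
    exact hh

theorem e_smul_vertexHom_smul {j : ι} {y : M} (hy : 𝒟.e K j • y = y) (h : TruncPoly K (𝒟.c j)) :
    𝒟.e K j • 𝒟.vertexHom K j h • y = 𝒟.vertexHom K j h • y := by
  rw [← mul_smul, ← vertexHom_comm, mul_smul, hy]

theorem vertexHom_truncX_pow_mul (j : ι) (n : ℕ) (h : TruncPoly K (𝒟.c j)) :
    𝒟.vertexHom K j (truncX K (𝒟.c j) ^ n * h) = 𝒟.ε K j ^ n * 𝒟.vertexHom K j h := by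
  rw [map_mul, map_pow, vertexHom_truncX]

/-- A subquotient concentrated at the vertex `j` that is free over `H_j` is filtered by
copies of `E_j`. -/
theorem reflTransGen_eStep [IsNoetherian (𝒟.Alg K) M] {j : ι} {N N' : Submodule (𝒟.Alg K) M}
    (hN : N ≤ N') (hI : ∀ a ∈ 𝒟.idemIdeal K j, ∀ n ∈ N', a • n ∈ N)
    (hfree : ∀ p ∈ N', 𝒟.e K j • p = p → 𝒟.ε K j • p ∈ N →
      ∃ p' ∈ N', 𝒟.e K j • p' = p' ∧ p - 𝒟.ε K j ^ (𝒟.c j - 1) • p' ∈ N) :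
    Relation.ReflTransGen (𝒟.EStep K) N N' := by
  induction N using WellFoundedGT.induction with
  | _ N ih =>
  by_cases hNN : N' ≤ N
  · rw [le_antisymm hN hNN]
  obtain ⟨x, hx, hxN⟩ := Set.not_subset.1 hNN
  have hx1 : 𝒟.e K j • x ∉ N := by
    intro h
    have h1 := hI _ (𝒟.one_sub_e_mem j) x hx
    rw [sub_smul, one_smul] at h1
    exact hxN (by simpa using N.add_mem h1 h)
  have hc := 𝒟.one_le_c j
  -- The last power of ε_j that does not move e_j x into N gives an element killed by ε_j modulo N.
  -- By freeness it is ε_j^(c_j - 1) y modulo N, so y generates a copy of H_j in N' / N.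
  obtain ⟨y, hy, hey, hyN⟩ : ∃ y ∈ N', 𝒟.e K j • y = y ∧ 𝒟.ε K j ^ (𝒟.c j - 1) • y ∉ N := by
    classical
    have hex : ∃ m, 𝒟.ε K j ^ m • 𝒟.e K j • x ∈ N :=
      ⟨𝒟.c j, by rw [(𝒟.relations K).p1, zero_smul]; exact N.zero_mem⟩
    obtain ⟨m, hm⟩ : ∃ m, Nat.find hex = m + 1 := by
      refine Nat.exists_eq_succ_of_ne_zero fun h0 => hx1 ?_
      have := Nat.find_spec hex
      rwa [h0, pow_zero, one_smul] at this
    have h1 := Nat.find_spec hex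
    have h2 : 𝒟.ε K j ^ m • 𝒟.e K j • x ∉ N := Nat.find_min hex (by omega)
    have h3 := 𝒟.e_smul_vertexHom_smul (e_smul_e_smul j x) (truncX K (𝒟.c j) ^ m)
    rw [map_pow, vertexHom_truncX] at h3
    obtain ⟨y, hy, hey, h4⟩ := hfree _ (N'.smul_mem _ (N'.smul_mem _ hx)) h3 (by
      rw [← mul_smul, ← pow_succ', ← hm]; exact h1)
    refine ⟨y, hy, hey, fun h5 => h2 ?_⟩
    simpa using N.add_mem h4 h5
  have hinj : ∀ h, 𝒟.vertexHom K j h • y ∈ N → h = 0 := by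
    intro h hh
    suffices h5 : ∀ a ≤ 𝒟.c j, ∃ h', h = truncX K (𝒟.c j) ^ a * h' by
      obtain ⟨h', h6⟩ := h5 _ le_rfl
      rwa [truncX_pow, zero_mul] at h6
    intro a ha
    induction a with
    | zero => exact ⟨h, by rw [pow_zero, one_mul]⟩
    | succ a iha =>
      obtain ⟨h', h6⟩ := iha (by omega)
      obtain ⟨b, h'', rfl⟩ := exists_eq_algebraMap_add_truncX_mul h'
      have h7 : truncX K (𝒟.c j) ^ (𝒟.c j - 1 - a) * h =
          truncX K (𝒟.c j) ^ (𝒟.c j - 1) * algebraMap K _ b := by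
        rw [h6, ← mul_assoc, ← pow_add, show 𝒟.c j - 1 - a + a = 𝒟.c j - 1 by omega, mul_add,
          ← mul_assoc, ← pow_succ, show 𝒟.c j - 1 + 1 = 𝒟.c j by omega, truncX_pow, zero_mul,
          add_zero]
      have h8 : 𝒟.vertexHom K j (truncX K (𝒟.c j) ^ (𝒟.c j - 1 - a) * h) • y ∈ N := by
        rw [map_mul, mul_smul]
        exact N.smul_mem _ hh
      have hb : b = 0 := by
        by_contra hb
        rw [h7, vertexHom_truncX_pow_mul, AlgHom.commutes] at h8
        have h9 := N.smul_mem (algebraMap K (𝒟.Alg K) b⁻¹) h8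
        rw [← mul_smul, (Algebra.commutes b _).symm, ← mul_assoc, ← map_mul, inv_mul_cancel₀ hb,
          map_one, one_mul] at h9
        exact hyN h9
      refine ⟨h'', ?_⟩
      rw [h6, hb, map_zero, zero_add, pow_succ, mul_assoc]
  let N₁ := N ⊔ Submodule.span (𝒟.Alg K) {y}
  have hmem : ∀ x, x ∈ N₁ ↔ ∃ h, x - 𝒟.vertexHom K j h • y ∈ N := by
    intro x
    constructor
    · intro h
      obtain ⟨n, hn, m, hm, rfl⟩ := Submodule.mem_sup.1 h
      obtain ⟨a, rfl⟩ := Submodule.mem_span_singleton.1 hm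
      refine ⟨𝒟.toE K j a, ?_⟩
      rw [add_sub_assoc]
      exact N.add_mem hn (𝒟.smul_sub_vertexHom_smul_mem hI a hy)
    · rintro ⟨h, hh⟩
      have h1 := Submodule.add_mem _ (le_sup_left (b := Submodule.span (𝒟.Alg K) {y}) hh)
        (le_sup_right (a := N) (Submodule.smul_mem _ (𝒟.vertexHom K j h)
          (Submodule.mem_span_singleton_self y)))
      rwa [sub_add_cancel] at h1
  have hN₁ : N₁ ≤ N' := sup_le hN ((Submodule.span_singleton_le_iff_mem _ _).2 hy)
  have hyN₁ : y ∈ N₁ := le_sup_right (a := N) (Submodule.mem_span_singleton_self y)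
  have hstep : 𝒟.EStep K N N₁ :=
    𝒟.eStep_of_generator le_sup_left (fun a ha n hn => hI a ha n (hN₁ hn)) hyN₁
      (fun x hx => (hmem x).1 hx) hinj
  refine Relation.ReflTransGen.head hstep (ih N₁ (lt_of_le_of_ne le_sup_left fun h => hyN ?_) hN₁
    (fun a ha n hn => (le_sup_left : N ≤ N₁) (hI a ha n hn)) ?_)
  · rw [h]; exact N₁.smul_mem _ hyN₁
  · intro p hp hep hεp
    -- The quotient N' / N₁ is again free: if ε_j p ≡ h y modulo N, then ε_j^(c_j - 1) h = 0, so h =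
    -- ε_j h', and freeness of N' / N applies to p - h' y.
    obtain ⟨h, hh⟩ := (hmem _).1 hεp
    have h1 := N.smul_mem (𝒟.ε K j ^ (𝒟.c j - 1)) hh
    rw [smul_sub, ← mul_smul, ← pow_succ, show 𝒟.c j - 1 + 1 = 𝒟.c j by omega,
      (𝒟.relations K).p1, zero_smul, zero_sub, neg_mem_iff, ← mul_smul,
      ← vertexHom_truncX_pow_mul] at h1
    obtain ⟨h', rfl⟩ := (truncX_pow_mul_eq_zero_iff (by omega) h).1 (hinj _ h1)
    rw [show 𝒟.c j - (𝒟.c j - 1) = 1 by omega, vertexHom_truncX_pow_mul, pow_one, mul_smul,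
      ← smul_sub] at hh
    obtain ⟨p', hp', hep', h2⟩ := hfree _ (N'.sub_mem hp (N'.smul_mem _ hy))
      (by rw [smul_sub, hep, e_smul_vertexHom_smul 𝒟 hey]) hh
    refine ⟨p', hp', hep', (hmem _).2 ⟨h', ?_⟩⟩
    rwa [sub_right_comm]

end Step

end GPA.CartanDatum

namespace GPA.CartanDatum

/-! ### Socle elements and the submodules sub_j -/

section Socle

variable {ι : Type w} (𝒟 : CartanDatum ι) [Fintype ι] {K : Type u} [Field K]
variable {M : Type v} [AddCommGroup M] [Module K M] [Module (𝒟.Alg K) M]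
  [IsScalarTower K (𝒟.Alg K) M]

theorem toS_e_self (j : ι) : 𝒟.toS K j (𝒟.e K j) = 1 := by simp [toS, toVertex]

theorem toS_e_of_ne {i j : ι} (h : i ≠ j) : 𝒟.toS K j (𝒟.e K i) = 0 := by
  simp [toS, toVertex, h]

theorem toS_ε (i j : ι) : 𝒟.toS K j (𝒟.ε K i) = 0 := by simp [toS, toVertex]

theorem toS_α (j i k : ι) (g : ℕ) : 𝒟.toS K j (𝒟.α K i k g) = 0 := by simp [toS, toVertex]

theorem toE_α (j i k : ι) (g : ℕ) : 𝒟.toE K j (𝒟.α K i k g) = 0 := by simp [toE, toVertex]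

theorem smul_eq_toS_smul {j : ι} {x : M} (he : 𝒟.e K j • x = x) (hε : 𝒟.ε K j • x = 0)
    (hα : ∀ k g, 𝒟.α K k j g • x = 0) (a : 𝒟.Alg K) : a • x = 𝒟.toS K j a • x := by
  induction a using alg_induction with
  | algebraMap k => rw [AlgHom.commutes, algebraMap_smul, Algebra.algebraMap_self, RingHom.id_apply]
  | e i =>
    by_cases h : i = j
    · subst h; rw [he, toS_e_self, one_smul]
    · rw [toS_e_of_ne 𝒟 h, zero_smul, ← he, e_smul_e_smul_of_ne h]
  | ε i =>
    rw [toS_ε, zero_smul]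
    by_cases h : i = j
    · subst h; exact hε
    · exact ε_smul_of_ne h he
  | α i k g =>
    rw [toS_α, zero_smul]
    by_cases h : k = j
    · subst h; exact hα i g
    · exact α_smul_of_ne h g he
  | add a b ha hb => rw [add_smul, ha, hb, map_add, add_smul]
  | mul a b ha hb => rw [mul_smul, hb, smul_comm, ha, map_mul, mul_comm, mul_smul]

/-- The homomorphism from `S_j` defined by a socle element. -/
def ofSocle {j : ι} {x : M} (hx : ∀ a, a • x = 𝒟.toS K j a • x) : 𝒟.S K j →ₗ[𝒟.Alg K] M where
  toFun k := (show K from k) • x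
  map_add' _ _ := add_smul _ _ x
  map_smul' a k := by
    change (𝒟.toS K j a * (show K from k)) • x = a • (show K from k) • x
    rw [smul_comm a, hx, mul_comm, mul_smul]

theorem mem_span_socle {j : ι} {x : M} (hx : ∀ a, a • x = 𝒟.toS K j a • x) {y : M} :
    y ∈ Submodule.span (𝒟.Alg K) {x} ↔ ∃ k : K, k • x = y := by
  rw [Submodule.mem_span_singleton]
  constructor
  · rintro ⟨a, rfl⟩
    exact ⟨_, (hx a).symm⟩
  · rintro ⟨k, rfl⟩
    exact ⟨algebraMap K _ k, algebraMap_smul _ _ _⟩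

theorem eq_span_socle {j : ι} {x : M} (hx : ∀ a, a • x = 𝒟.toS K j a • x)
    {B : Submodule (𝒟.Alg K) M} (hB : B ≤ Submodule.span (𝒟.Alg K) {x}) (h0 : B ≠ ⊥) :
    B = Submodule.span (𝒟.Alg K) {x} := by
  obtain ⟨b, hb, hb0⟩ := B.ne_bot_iff.1 h0
  obtain ⟨k, rfl⟩ := (𝒟.mem_span_socle hx).1 (hB hb)
  have hk : k ≠ 0 := by
    rintro rfl
    exact hb0 (zero_smul _ _)
  refine le_antisymm hB ((Submodule.span_singleton_le_iff_mem _ _).2 ?_)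
  have := B.smul_mem (algebraMap K _ k⁻¹) hb
  rwa [algebraMap_smul, smul_smul, inv_mul_cancel₀ hk, one_smul] at this

/-- The line spanned by a vector x on which Π acts as on S_j is one of the submodules whose supremum
is sub_j. Conversely, a nonzero submodule of an Artinian module contains a simple one, which the
defining condition forces to be S_j. -/
theorem sub_eq_bot_iff [IsArtinian (𝒟.Alg K) M] {j : ι} :
    𝒟.sub K M j = ⊥ ↔ ∀ x : M, (∀ a, a • x = 𝒟.toS K j a • x) → x = 0 := by
  constructor
  · intro h x hx
    by_contra hx0
    refine hx0 ?_
    have h1 : Submodule.span (𝒟.Alg K) {x} ≤ 𝒟.sub K M j := by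
      refine le_sSup ?_
      intro A B hAB hB
      have hB1 : B ≠ ⊥ := fun h0 => not_lt_bot (h0 ▸ hAB.lt)
      have hB2 := 𝒟.eq_span_socle hx hB hB1
      have hA : A = ⊥ := by
        by_contra hA
        have := 𝒟.eq_span_socle hx (hAB.le.trans hB) hA
        exact hAB.lt.ne (this.trans hB2.symm)
      have hinj : Function.Injective (𝒟.ofSocle hx) := by
        intro k k' hkk
        exact smul_left_injective K hx0 hkk
      have hr : LinearMap.range (𝒟.ofSocle hx) = B := by
        rw [hB2]
        ext y
        rw [mem_span_socle 𝒟 hx]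
        rfl
      refine ⟨Submodule.quotEquivOfEqBot _ ?_ ≪≫ₗ
        ((LinearEquiv.ofInjective _ hinj) ≪≫ₗ LinearEquiv.ofEq _ _ hr).symm⟩
      rw [hA]
      exact LinearMap.ker_eq_bot.2 (Submodule.subtype_injective _)
    rw [h] at h1
    exact (Submodule.mem_bot _).1 (h1 (Submodule.mem_span_singleton_self x))
  · intro h
    rw [sub, sSup_eq_bot]
    intro N hN
    by_contra hN0
    obtain ⟨B, hB, hBN⟩ := (IsAtomic.eq_bot_or_exists_atom_le N).resolve_left hN0
    obtain ⟨E⟩ := hN ⊥ B (bot_covBy_iff.2 hB) hBN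
    let E' : B ≃ₗ[𝒟.Alg K] 𝒟.S K j :=
      (Submodule.quotEquivOfEqBot _ (LinearMap.ker_eq_bot.2 (Submodule.subtype_injective _))).symm
        ≪≫ₗ E
    let s : 𝒟.S K j := (1 : K)
    have hs : ∀ a : 𝒟.Alg K, a • s = algebraMap K (𝒟.Alg K) (𝒟.toS K j a) • s := by
      intro a
      change 𝒟.toS K j a * 1 = 𝒟.toS K j (algebraMap K (𝒟.Alg K) (𝒟.toS K j a)) * 1
      rw [AlgHom.commutes]
      rfl
    have h1 := h (E'.symm s) fun a => by
      have h2 := congrArg (fun y => (E'.symm y : M)) (hs a)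
      simp only [map_smul] at h2
      rw [← algebraMap_smul (𝒟.Alg K) (𝒟.toS K j a)]
      exact h2
    have h3 : s = 0 := E'.symm.map_eq_zero_iff.1 (Subtype.ext h1)
    exact one_ne_zero (α := K) h3

variable {𝒟} in
/-- A nonzero submodule of an `𝔼`-filtered module contains a simple module `S_j`. -/
theorem IsEFiltered.exists_socle (h : 𝒟.IsEFiltered K M) {B : Submodule (𝒟.Alg K) M}
    (hB : B ≠ ⊥) : ∃ x ∈ B, x ≠ 0 ∧ ∃ j, ∀ a, a • x = 𝒟.toS K j a • x := by
  classical
  obtain ⟨n, F, h0, hn, hF⟩ := h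
  -- At the first filtration step that B meets, the intersection embeds into some E_j. The last
  -- nonzero power of ε_j then moves any of its nonzero elements into the socle.
  have hex : ∃ k, B ⊓ F k ≠ ⊥ := ⟨n, by rwa [hn, inf_top_eq]⟩
  obtain ⟨m, hm⟩ : ∃ m, Nat.find hex = m + 1 := by
    refine Nat.exists_eq_succ_of_ne_zero fun h1 => Nat.find_spec hex ?_
    rw [h1, h0, inf_bot_eq]
  have h1 : B ⊓ F m = ⊥ := not_not.1 (Nat.find_min hex (m := m) (by omega))
  have h2 := Nat.find_spec hex
  rw [hm] at h2
  have hmn : m < n := by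
    have := Nat.find_min' hex (m := n) (by rwa [hn, inf_top_eq])
    omega
  obtain ⟨-, j, ⟨E⟩⟩ := hF m hmn
  let q : F (m + 1) →ₗ[𝒟.Alg K] 𝒟.E K j := E.toLinearMap ∘ₗ ((F m).submoduleOf (F (m + 1))).mkQ
  have hq : ∀ y : F (m + 1), q y = 0 ↔ (y : M) ∈ F m := fun y =>
    E.map_eq_zero_iff.trans (Submodule.Quotient.mk_eq_zero _)
  obtain ⟨y, hy, hy0⟩ := Submodule.ne_bot_iff _ |>.1 h2
  have hqy : q ⟨y, hy.2⟩ ≠ 0 := fun h3 => hy0 ((Submodule.mem_bot (𝒟.Alg K)).1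
    (h1.le ⟨hy.1, (hq _).1 h3⟩))
  have hex' : ∃ s, 𝒟.ε K j ^ s • q ⟨y, hy.2⟩ = 0 :=
    ⟨𝒟.c j, by rw [(𝒟.relations K).p1, zero_smul]⟩
  obtain ⟨s, hs⟩ : ∃ s, Nat.find hex' = s + 1 := by
    refine Nat.exists_eq_succ_of_ne_zero fun h3 => hqy ?_
    have := Nat.find_spec hex'
    rwa [h3, pow_zero, one_smul] at this
  have h4 := Nat.find_spec hex'
  rw [hs, pow_succ', mul_smul, ← map_smul] at h4
  have h5 : q (𝒟.ε K j ^ s • ⟨y, hy.2⟩) ≠ 0 := by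
    rw [map_smul]
    exact Nat.find_min hex' (by omega)
  set x : F (m + 1) := 𝒟.ε K j ^ s • ⟨y, hy.2⟩ with hx
  have hxB : (x : M) ∈ B := B.smul_mem _ hy.1
  refine ⟨x, hxB, fun h6 => h5 ?_, j, fun a => ?_⟩
  · rw [hq, h6]; exact zero_mem _
  · have h6 := 𝒟.smul_eq_toS_smul (𝒟.e_smul_E K j (q x)) h4 (fun k g => by
      change 𝒟.toE K j (𝒟.α K k j g) * (show TruncPoly K (𝒟.c j) from q x) = 0
      rw [toE_α, zero_mul]) a
    rw [← algebraMap_smul (𝒟.Alg K), ← sub_eq_zero, ← map_smul, ← map_smul, ← map_sub, hq] at h6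
    rw [← algebraMap_smul (𝒟.Alg K) (𝒟.toS K j a), ← sub_eq_zero]
    have h7 : a • (x : M) - algebraMap K (𝒟.Alg K) (𝒟.toS K j a) • (x : M) ∈ B ⊓ F m :=
      ⟨B.sub_mem (B.smul_mem _ hxB) (B.smul_mem _ hxB), h6⟩
    rwa [h1, Submodule.mem_bot] at h7

end Socle

/-! ### The anti-involution and duality -/

section Dual

variable {ι : Type w} (𝒟 : CartanDatum ι) [Fintype ι] {K : Type u} [Field K]

theorem anti_e (i : ι) : 𝒟.anti K (𝒟.e K i) = .op (𝒟.e K i) := lift_e K _ i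

theorem anti_ε (i : ι) : 𝒟.anti K (𝒟.ε K i) = .op (𝒟.ε K i) := lift_ε K _ i

theorem anti_α (i j : ι) (g : ℕ) : 𝒟.anti K (𝒟.α K i j g) = .op (𝒟.α K j i g) := lift_α K _ i j g

theorem anti_anti (a : 𝒟.Alg K) : (𝒟.anti K (𝒟.anti K a).unop).unop = a := by
  induction a using alg_induction with
  | algebraMap k => simp
  | e i => simp [anti_e]
  | ε i => simp [anti_ε]
  | α i j g => simp [anti_α]
  | add a b ha hb => simp [ha, hb]
  | mul a b ha hb => simp [ha, hb]

theorem anti_mem_idemIdeal {j : ι} {a : 𝒟.Alg K} (ha : a ∈ 𝒟.idemIdeal K j) :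
    (𝒟.anti K a).unop ∈ 𝒟.idemIdeal K j := by
  induction ha using Submodule.span_induction with
  | mem x hx =>
    obtain ⟨a, b, rfl⟩ := hx
    simp only [map_mul, map_sub, map_one, anti_e, MulOpposite.unop_mul, MulOpposite.unop_sub,
      MulOpposite.unop_one, MulOpposite.unop_op, ← mul_assoc]
    exact Submodule.subset_span ⟨_, _, rfl⟩
  | zero => simp
  | add x y _ _ hx hy => rw [map_add]; exact add_mem hx hy
  | smul b x _ hx =>
    rw [smul_eq_mul, map_mul, MulOpposite.unop_mul]
    exact Ideal.mul_mem_right _ _ hx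

variable (M : Type v) [AddCommGroup M] [Module K M]

/-- An element of the dual module, as a linear form. -/
def ev : 𝒟.Dual K M →ₗ[K] Module.Dual K M := LinearMap.id

variable {M}

theorem dual_ext {φ ψ : 𝒟.Dual K M} (h : ∀ m, 𝒟.ev M φ m = 𝒟.ev M ψ m) : φ = ψ :=
  LinearMap.ext (f := 𝒟.ev M φ) (g := 𝒟.ev M ψ) h

variable [Module (𝒟.Alg K) M] [IsScalarTower K (𝒟.Alg K) M]

theorem ev_smul (a : 𝒟.Alg K) (φ : 𝒟.Dual K M) (m : M) :
    𝒟.ev M (a • φ) m = 𝒟.ev M φ ((𝒟.anti K a).unop • m) := rfl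

theorem ev_e_smul (i : ι) (φ : 𝒟.Dual K M) (m : M) :
    𝒟.ev M (𝒟.e K i • φ) m = 𝒟.ev M φ (𝒟.e K i • m) := by
  rw [ev_smul, anti_e, MulOpposite.unop_op]

theorem ev_ε_pow_smul (i : ι) (n : ℕ) (φ : 𝒟.Dual K M) (m : M) :
    𝒟.ev M (𝒟.ε K i ^ n • φ) m = 𝒟.ev M φ (𝒟.ε K i ^ n • m) := by
  rw [ev_smul, map_pow, anti_ε, MulOpposite.unop_pow, MulOpposite.unop_op]

theorem ev_ε_smul (i : ι) (φ : 𝒟.Dual K M) (m : M) :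
    𝒟.ev M (𝒟.ε K i • φ) m = 𝒟.ev M φ (𝒟.ε K i • m) := by
  rw [ev_smul, anti_ε, MulOpposite.unop_op]

theorem finrank_vertexSpace_dual [Module.Finite K M] (k : ι) :
    Module.finrank K (𝒟.vertexSpace K (𝒟.Dual K M) k) =
      Module.finrank K (𝒟.vertexSpace K M k) := by
  have h : Algebra.lsmul K K (𝒟.Dual K M) (𝒟.e K k) =
      (Algebra.lsmul K K M (𝒟.e K k)).dualMap := by
    refine LinearMap.ext fun φ => 𝒟.dual_ext fun m => ?_
    exact 𝒟.ev_e_smul k φ m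
  rw [vertexSpace, vertexSpace, h]
  exact LinearMap.finrank_range_dualMap_eq_finrank_range _

section Free

variable {j : ι} {Y Y' : Submodule (𝒟.Alg K) M}
  (hfree : ∀ p ∈ Y, 𝒟.e K j • p = p → 𝒟.ε K j • p ∈ Y' →
      ∃ p' ∈ Y, 𝒟.e K j • p' = p' ∧ p - 𝒟.ε K j ^ (𝒟.c j - 1) • p' ∈ Y')

theorem e_smul_ε_pow_smul (i : ι) (n : ℕ) (x : M) :
    𝒟.e K i • 𝒟.ε K i ^ n • x = 𝒟.ε K i ^ n • 𝒟.e K i • x := by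
  have h := 𝒟.vertexHom_comm K i (truncX K (𝒟.c i) ^ n)
  rw [map_pow, vertexHom_truncX] at h
  rw [← mul_smul, ← h, mul_smul]

include hfree in
-- The analogue of `IsFreeNilp.exists_eq_pow` for the subquotient Y / Y' at the vertex j, in terms
-- of representatives.
theorem exists_sub_ε_pow_smul_mem {a : ℕ} (ha : a ≤ 𝒟.c j) : ∀ p ∈ Y, 𝒟.e K j • p = p →
    𝒟.ε K j ^ a • p ∈ Y' →
    ∃ p' ∈ Y, 𝒟.e K j • p' = p' ∧ p - 𝒟.ε K j ^ (𝒟.c j - a) • p' ∈ Y' := by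
  induction a with
  | zero =>
    intro p hp hep h
    rw [pow_zero, one_smul] at h
    exact ⟨0, Y.zero_mem, smul_zero _, by rwa [smul_zero, sub_zero]⟩
  | succ a ih =>
    intro p hp hep h
    rw [pow_succ, mul_smul] at h
    obtain ⟨p', hp', hep', h1⟩ := ih (by omega) _ (Y.smul_mem _ hp) (e_smul_ε_smul j p) h
    rw [show 𝒟.c j - a = 𝒟.c j - (a + 1) + 1 by omega, pow_succ', mul_smul, ← smul_sub] at h1
    obtain ⟨p'', hp'', hep'', h2⟩ := hfree _ (Y.sub_mem hp (Y.smul_mem _ hp'))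
      (by rw [smul_sub, hep, e_smul_ε_pow_smul, hep']) h1
    refine ⟨p' + 𝒟.ε K j ^ a • p'', Y.add_mem hp' (Y.smul_mem _ hp''), ?_, ?_⟩
    · rw [smul_add, hep', e_smul_ε_pow_smul, hep'']
    · rw [smul_add, ← mul_smul, ← pow_add, show 𝒟.c j - (a + 1) + a = 𝒟.c j - 1 by omega]
      rwa [sub_sub] at h2

include hfree in
/-- Freeness over `H_j` passes to the dual of a subquotient. -/
theorem exists_dual_sub_ε_pow_smul {φ : 𝒟.Dual K M} (hφ : ∀ p ∈ Y', 𝒟.ev M φ p = 0)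
    (heφ : 𝒟.e K j • φ = φ) (hεφ : ∀ p ∈ Y, 𝒟.ev M (𝒟.ε K j • φ) p = 0) :
    ∃ φ' : 𝒟.Dual K M, (∀ p ∈ Y', 𝒟.ev M φ' p = 0) ∧ 𝒟.e K j • φ' = φ' ∧
      ∀ p ∈ Y, 𝒟.ev M (φ - 𝒟.ε K j ^ (𝒟.c j - 1) • φ') p = 0 := by
  have hc := 𝒟.one_le_c j
  -- The required form is one through which φ restricted to Y factors along T. It exists because φ
  -- vanishes on ker T: if T p = 0, then e_j p lies in ε_j q + Y' with q in Y, and both φ on Y' and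
  -- ε_j φ on Y are zero.
  let T : Y →ₗ[K] M ⧸ Y' := (Y'.mkQ.restrictScalars K) ∘ₗ
    Algebra.lsmul K K M (𝒟.ε K j ^ (𝒟.c j - 1) * 𝒟.e K j) ∘ₗ Y.subtype.restrictScalars K
  have hT : ∀ p : Y, T p = Submodule.Quotient.mk
      (𝒟.ε K j ^ (𝒟.c j - 1) • 𝒟.e K j • (p : M)) := by
    intro p
    rw [← mul_smul]
    rfl
  have hmem : 𝒟.ev M φ ∘ₗ Y.subtype.restrictScalars K ∈ LinearMap.range T.dualMap := by
    rw [LinearMap.range_dualMap_eq_dualAnnihilator_ker, Submodule.mem_dualAnnihilator]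
    intro p hp
    rw [LinearMap.mem_ker, hT, Submodule.Quotient.mk_eq_zero] at hp
    obtain ⟨q, hq, heq, h1⟩ := 𝒟.exists_sub_ε_pow_smul_mem hfree (a := 𝒟.c j - 1) (by omega) _
      (Y.smul_mem _ p.2) (e_smul_e_smul j _) hp
    rw [show 𝒟.c j - (𝒟.c j - 1) = 1 by omega, pow_one] at h1
    change 𝒟.ev M φ p = 0
    have h2 := hφ _ h1
    rw [map_sub, ← ev_e_smul, heφ, ← ev_ε_smul, hεφ q hq, sub_zero] at h2
    exact h2
  obtain ⟨ψ, hψ⟩ := hmem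
  let ψ' : 𝒟.Dual K M := ψ ∘ₗ Y'.mkQ.restrictScalars K
  have hψ' : ∀ m, 𝒟.ev M ψ' m = ψ (Submodule.Quotient.mk m) := fun _ => rfl
  refine ⟨𝒟.e K j • ψ', fun p hp => ?_, e_smul_e_smul j _, fun p hp => ?_⟩
  · rw [ev_e_smul, hψ', (Submodule.Quotient.mk_eq_zero Y').2 (Y'.smul_mem _ hp), map_zero]
  · have h1 := LinearMap.congr_fun hψ ⟨p, hp⟩
    rw [LinearMap.dualMap_apply, hT] at h1
    rw [map_sub, LinearMap.sub_apply, ev_ε_pow_smul, ev_e_smul, e_smul_ε_pow_smul, hψ', h1,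
      sub_eq_zero]
    rfl

end Free

theorem isFreeNilp_epsOn_dual {j : ι} (h : IsFreeNilp (𝒟.c j) (𝒟.epsOn K M j)) :
    IsFreeNilp (𝒟.c j) (𝒟.epsOn K (𝒟.Dual K M) j) := by
  rintro ⟨φ, hφ⟩ hε
  rw [mem_vertexSpace] at hφ
  have hε' : 𝒟.ε K j • φ = 0 := congrArg Subtype.val hε
  obtain ⟨φ', -, he, h1⟩ := 𝒟.exists_dual_sub_ε_pow_smul (Y := (⊤ : Submodule (𝒟.Alg K) M))
    (Y' := ⊥) (j := j) (φ := φ) (fun p _ hep hεp => by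
      rw [Submodule.mem_bot] at hεp
      obtain ⟨y, hy⟩ := h ⟨p, (𝒟.mem_vertexSpace K).2 hep⟩ (Subtype.ext hεp)
      refine ⟨y, Submodule.mem_top, (𝒟.mem_vertexSpace K).1 y.2, ?_⟩
      rw [Submodule.mem_bot, sub_eq_zero, ← coe_epsOn_pow, ← hy])
    (fun p hp => by rw [(Submodule.mem_bot _).1 hp, map_zero]) hφ
    (fun p _ => by rw [hε', map_zero, LinearMap.zero_apply])
  refine ⟨⟨φ', (𝒟.mem_vertexSpace K).2 he⟩, Subtype.ext ?_⟩
  rw [coe_epsOn_pow, ← sub_eq_zero]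
  exact 𝒟.dual_ext fun p => h1 p Submodule.mem_top

end Dual

end GPA.CartanDatum

namespace GPA.CartanDatum

theorem map_smul_of_generators {ι : Type w} (𝒟 : CartanDatum ι) [Fintype ι] {K : Type u} [Field K]
    {M : Type v} [AddCommGroup M] [Module K M] [Module (𝒟.Alg K) M] [IsScalarTower K (𝒟.Alg K) M]
    {B : Type*} [Ring B] [Algebra K B] {N : Type*} [AddCommGroup N] [Module K N] [Module B N]
    [IsScalarTower K B N] (τ : 𝒟.Alg K →ₐ[K] B) (f : M →ₗ[K] N)
    (he : ∀ i x, f (𝒟.e K i • x) = τ (𝒟.e K i) • f x)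
    (hε : ∀ i x, f (𝒟.ε K i • x) = τ (𝒟.ε K i) • f x)
    (hα : ∀ i j g x, f (𝒟.α K i j g • x) = τ (𝒟.α K i j g) • f x) (a : 𝒟.Alg K) (x : M) :
    f (a • x) = τ a • f x := by
  induction a using alg_induction generalizing x with
  | algebraMap k => rw [AlgHom.commutes, algebraMap_smul, algebraMap_smul, map_smul]
  | e i => exact he i x
  | ε i => exact hε i x
  | α i j g => exact hα i j g x
  | add a b ha hb => rw [add_smul, map_add, ha, hb, map_add, add_smul]
  | mul a b ha hb => rw [mul_smul, ha, hb, map_mul, mul_smul]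

/-! ### Framed modules V ⊕ H_i -/

section Framed

variable {ι : Type w} (𝒟 : CartanDatum ι) [Fintype ι] (K : Type u) [Field K]
variable (V : Type v) [AddCommGroup V] [Module K V] [Module (𝒟.Alg K) V]
  [IsScalarTower K (𝒟.Alg K) V]

/-- An `H_i`-linear map `e_i V → H_i`, extended by zero to `V`. -/
structure FramingMap (i : ι) where
  toLin : V →ₗ[K] TruncPoly K (𝒟.c i)
  map_e : ∀ x, toLin (𝒟.e K i • x) = toLin x
  map_ε : ∀ x, toLin (𝒟.ε K i • x) = truncX K (𝒟.c i) * toLin x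

variable {𝒟 K V} {i : ι} (Θ : 𝒟.FramingMap K V i)

namespace FramingMap

include Θ in
/-- The vector space `V ⊕ H_i`. -/
def FramedMod (_ : 𝒟.FramingMap K V i) : Type (max u v) := V × TruncPoly K (𝒟.c i)

instance : AddCommGroup Θ.FramedMod := inferInstanceAs (AddCommGroup (V × TruncPoly K (𝒟.c i)))
instance : Module K Θ.FramedMod := inferInstanceAs (Module K (V × TruncPoly K (𝒟.c i)))

/-- The operator on `V ⊕ H_i` given by the action of an element of `Π` on `V`. -/
def actV : 𝒟.Alg K →ₗ[K] Module.End K Θ.FramedMod where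
  toFun a := LinearMap.prodMap (Algebra.lsmul K K V a) 0
  map_add' a b := by
    refine LinearMap.ext fun x => Prod.ext (add_smul _ _ x.1) (add_zero _).symm
  map_smul' k a := by
    refine LinearMap.ext fun x => Prod.ext (smul_assoc _ _ x.1) (smul_zero k).symm

theorem actV_mul (a b : 𝒟.Alg K) : Θ.actV (a * b) = Θ.actV a * Θ.actV b :=
  LinearMap.ext fun x => Prod.ext (mul_smul _ _ x.1) rfl

theorem actV_pow_mul (a b : 𝒟.Alg K) (n : ℕ) : Θ.actV (a ^ n * b) = Θ.actV a ^ n * Θ.actV b := by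
  induction n with
  | zero => rw [pow_zero, pow_zero, one_mul, one_mul]
  | succ n ih => rw [pow_succ', mul_assoc, actV_mul, ih, pow_succ', mul_assoc]

theorem actV_mul_pow (a b : 𝒟.Alg K) (n : ℕ) : Θ.actV (b * a ^ n) = Θ.actV b * Θ.actV a ^ n := by
  induction n with
  | zero => rw [pow_zero, pow_zero, mul_one, mul_one]
  | succ n ih => rw [pow_succ, ← mul_assoc, actV_mul, ih, pow_succ, mul_assoc]

/-- The operator on `V ⊕ H_i` given by multiplication with an element of `H_i`. -/
def actH : TruncPoly K (𝒟.c i) →ₗ[K] Module.End K Θ.FramedMod where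
  toFun h := LinearMap.prodMap 0 (Algebra.lmul K _ h)
  map_add' a b := by
    refine LinearMap.ext fun x => Prod.ext (add_zero _).symm (add_mul _ _ x.2)
  map_smul' k a := by
    refine LinearMap.ext fun x => Prod.ext (smul_zero k).symm (smul_mul_assoc _ _ x.2)

theorem actH_apply (h : TruncPoly K (𝒟.c i)) (x : Θ.FramedMod) : Θ.actH h x = (0, h * x.2) := rfl

theorem actH_mul (a b : TruncPoly K (𝒟.c i)) : Θ.actH (a * b) = Θ.actH a * Θ.actH b :=
  LinearMap.ext fun x => Prod.ext rfl (mul_assoc _ _ x.2)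

theorem actH_pow_mul (a b : TruncPoly K (𝒟.c i)) (n : ℕ) :
    Θ.actH (a ^ n * b) = Θ.actH a ^ n * Θ.actH b := by
  induction n with
  | zero => rw [pow_zero, pow_zero, one_mul, one_mul]
  | succ n ih => rw [pow_succ', mul_assoc, actH_mul, ih, pow_succ', mul_assoc]

theorem actV_mul_actH (a : 𝒟.Alg K) (h : TruncPoly K (𝒟.c i)) : Θ.actV a * Θ.actH h = 0 :=
  LinearMap.ext fun _ => Prod.ext (smul_zero a) rfl

theorem actH_mul_actV (a : 𝒟.Alg K) (h : TruncPoly K (𝒟.c i)) : Θ.actH h * Θ.actV a = 0 :=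
  LinearMap.ext fun _ => Prod.ext rfl (mul_zero h)

/-- The framing map as an operator on `V ⊕ H_i`. -/
def frame : Module.End K Θ.FramedMod :=
  (LinearMap.inr K V (TruncPoly K (𝒟.c i))) ∘ₗ Θ.toLin ∘ₗ LinearMap.fst K V _

theorem frame_apply (x : Θ.FramedMod) : Θ.frame x = (0, Θ.toLin x.1) := rfl

variable [DecidableEq ι]

/-- The idempotents of the framed algebra, as operators. -/
def opE : ι ⊕ ι → Module.End K Θ.FramedMod
  | .inl j => Θ.actV (𝒟.e K j)
  | .inr j => if j = i then Θ.actH 1 else 0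

/-- The loops of the framed algebra, as operators. -/
def opEps : ι ⊕ ι → Module.End K Θ.FramedMod
  | .inl j => Θ.actV (𝒟.ε K j)
  | .inr j => if j = i then Θ.actH (truncX K (𝒟.c i)) else 0

/-- The arrows of the framed algebra, as operators. -/
def opArr : ι ⊕ ι → ι ⊕ ι → ℕ → Module.End K Θ.FramedMod
  | .inl j, .inl k, g => Θ.actV (𝒟.α K j k g)
  | .inr j, .inl k, g => if j = i ∧ k = i ∧ g = 0 then Θ.frame else 0
  | _, .inr _, _ => 0

/-- No arrow out of a primed vertex acts, so the mesh relations on V are unchanged and those at the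
primed vertices are trivial. The one new relation with content is the commutation for the arrow i →
i', which says that the framing map is H_i-linear, as both numbers f are 1. -/
theorem relations : 𝒟.framed.Relations Θ.opE Θ.opEps Θ.opArr := by
  have R := 𝒟.relations K
  refine ⟨?_, ?_, ?_, ?_, ?_, ?_, ?_, ?_, ?_, ?_, ?_⟩
  · rintro (j | j)
    · simp only [opE, ← actV_mul, R.e_mul_self]
    · by_cases h : j = i
      · simp only [opE, h, if_true, ← actH_mul, mul_one]
      · simp only [opE, h, if_false, mul_zero]
  · rintro (j | j) (k | k) h
    · simp only [opE, ← actV_mul, R.e_mul_e j k (fun h' => h (congrArg _ h')), map_zero]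
    · by_cases h : k = i <;> simp [opE, h, actV_mul_actH]
    · by_cases h : j = i <;> simp [opE, h, actH_mul_actV]
    · by_cases h1 : j = i
      · have h2 : k ≠ i := fun h2 => h (congrArg _ (h1.trans h2.symm))
        simp [opE, h2]
      · simp [opE, h1]
  · rw [Fintype.sum_sum_type]
    simp only [opE, ← map_sum, R.sum_e, Finset.sum_ite_eq', Finset.mem_univ, if_true]
    refine LinearMap.ext fun x => Prod.ext ?_ ?_
    · exact (add_zero _).trans (one_smul _ x.1)
    · exact (zero_add _).trans (one_mul x.2)
  · rintro (j | j)
    · simp only [opE, opEps, ← actV_mul, R.e_mul_ε]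
    · by_cases h : j = i
      · simp only [opE, opEps, h, if_true, ← actH_mul, one_mul]
      · simp only [opE, opEps, h, if_false, mul_zero]
  · rintro (j | j)
    · simp only [opE, opEps, ← actV_mul, R.ε_mul_e]
    · by_cases h : j = i
      · simp only [opE, opEps, h, if_true, ← actH_mul, mul_one]
      · simp only [opE, opEps, h, if_false, mul_zero]
  · rintro (j | j) (k | k) g
    · simp only [opE, opArr, ← actV_mul, R.e_mul_α]
    · simp only [opArr, mul_zero]
    · by_cases h : j = i ∧ k = i ∧ g = 0
      · simp only [opArr, opE, h, and_self, if_true]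
        exact LinearMap.ext fun x => Prod.ext rfl (one_mul _)
      · simp only [opArr, h, if_false, mul_zero]
    · simp only [opArr, mul_zero]
  · rintro (j | j) (k | k) g
    · simp only [opE, opArr, ← actV_mul, R.α_mul_e]
    · simp only [opArr, zero_mul]
    · by_cases h : j = i ∧ k = i ∧ g = 0
      · simp only [opArr, opE, h, and_self, if_true]
        exact LinearMap.ext fun x => Prod.ext rfl (Θ.map_e _)
      · simp only [opArr, h, if_false, zero_mul]
    · simp only [opArr, zero_mul]
  · rintro (j | j) (k | k) g h
    · have h' : ¬ 𝒟.IsArrow j k g := h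
      simp only [opArr, R.α_eq_zero j k g h', map_zero]
    · rfl
    · simp only [opArr]
      rw [if_neg]
      rintro ⟨rfl, rfl, rfl⟩
      exact h (by simp [IsArrow, CartanDatum.g, framed])
    · rfl
  · rintro (j | j)
    · have h1 := Θ.actV_mul_pow (𝒟.ε K j) (𝒟.e K j) (𝒟.c j)
      rw [R.p1, mul_zero, map_zero] at h1
      have hc : 𝒟.c j = 𝒟.c j - 1 + 1 := (Nat.sub_add_cancel (𝒟.one_le_c j)).symm
      change Θ.actV (𝒟.ε K j) ^ 𝒟.c j = 0
      rw [hc, pow_succ, ← actV_pow_mul, ← pow_succ, ← hc, R.p1, map_zero]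
    · change Θ.opEps (.inr j) ^ 𝒟.c j = 0
      have hc : 𝒟.c j = 𝒟.c j - 1 + 1 := (Nat.sub_add_cancel (𝒟.one_le_c j)).symm
      by_cases h : j = i
      · subst h
        simp only [opEps, if_true]
        refine (congrArg (fun m => Θ.actH (truncX K (𝒟.c j)) ^ m) hc).trans ?_
        rw [pow_succ, ← actH_pow_mul, ← pow_succ, Nat.sub_add_cancel (𝒟.one_le_c j), truncX_pow,
          map_zero]
      · simp only [opEps, h, if_false]
        rw [hc, pow_succ, mul_zero]
  · rintro (j | j) (k | k) g h
    · have h' : 𝒟.IsArrow j k g := h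
      have h1 := congrArg Θ.actV (R.p2 j k g h')
      rwa [actV_pow_mul, actV_mul_pow] at h1
    · simp only [opArr, zero_mul, mul_zero]
    · by_cases h1 : j = i ∧ k = i ∧ g = 0
      · obtain ⟨rfl, rfl, rfl⟩ := h1
        have hf1 : 𝒟.framed.f (.inl k) (.inr k) = 1 := by
          simp [CartanDatum.f, CartanDatum.g, framed]
        have hf2 : 𝒟.framed.f (.inr k) (.inl k) = 1 := by
          simp [CartanDatum.f, CartanDatum.g, framed]
        simp only [opArr, opEps, hf1, hf2, pow_one, and_self, if_true]
        exact LinearMap.ext fun x => Prod.ext rfl (Θ.map_ε _).symm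
      · simp only [opArr, h1, if_false, zero_mul, mul_zero]
    · simp only [opArr, zero_mul, mul_zero]
  · rintro (j | j)
    · have h1 := congrArg Θ.actV (R.p3 j)
      rw [map_zero] at h1
      rw [← h1]
      simp only [map_sum, Finset.sum_filter]
      rw [Fintype.sum_sum_type]
      have h2 : ∀ k : ι, (if 𝒟.framed.C (.inl j) (.inr k) < 0 then
          ∑ g ∈ Finset.range (𝒟.framed.g (.inl j) (.inr k)),
            ∑ s ∈ Finset.range (𝒟.framed.f (.inr k) (.inl j)), 𝒟.framed.sgn (.inl j) (.inr k) •
              (Θ.opEps (.inl j) ^ s * Θ.opArr (.inl j) (.inr k) g * Θ.opArr (.inr k) (.inl j) g *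
                Θ.opEps (.inl j) ^ (𝒟.framed.f (.inr k) (.inl j) - 1 - s)) else 0) = 0 := by
        intro k
        simp [opArr]
      rw [Finset.sum_congr rfl fun k _ => h2 k, Finset.sum_const_zero, add_zero]
      refine Finset.sum_congr rfl fun k _ => ?_
      change (if 𝒟.C j k < 0 then ∑ g ∈ Finset.range (𝒟.g j k), ∑ s ∈ Finset.range (𝒟.f k j),
        𝒟.sgn j k • (Θ.actV (𝒟.ε K j) ^ s * Θ.actV (𝒟.α K j k g) * Θ.actV (𝒟.α K k j g) *
          Θ.actV (𝒟.ε K j) ^ (𝒟.f k j - 1 - s)) else 0) = _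
      split_ifs
      · rw [map_sum]
        refine Finset.sum_congr rfl fun g _ => ?_
        rw [map_sum]
        refine Finset.sum_congr rfl fun s _ => ?_
        rw [map_zsmul, actV_mul_pow, actV_mul, actV_pow_mul]
      · rw [map_zero]
    · refine Finset.sum_eq_zero fun k _ => Finset.sum_eq_zero fun g _ =>
        Finset.sum_eq_zero fun s _ => ?_
      cases k <;> simp [opArr]

instance : Module (𝒟.framed.Alg K) Θ.FramedMod :=
  Module.compHom Θ.FramedMod (lift K Θ.relations).toRingHom

theorem smul_def (a : 𝒟.framed.Alg K) (x : Θ.FramedMod) : a • x = lift K Θ.relations a x := rfl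

instance : IsScalarTower K (𝒟.framed.Alg K) Θ.FramedMod where
  smul_assoc k a x := by
    rw [smul_def, smul_def, map_smul, LinearMap.smul_apply]

theorem e_inl_smul (j : ι) (x : Θ.FramedMod) : 𝒟.framed.e K (.inl j) • x = (𝒟.e K j • x.1, 0) := by
  rw [smul_def, lift_e]; rfl

theorem e_inr_smul (x : Θ.FramedMod) : 𝒟.framed.e K (.inr i) • x = (0, x.2) := by
  rw [smul_def, lift_e, opE, if_pos rfl, actH_apply, one_mul]

theorem e_inr_smul_of_ne {j : ι} (h : j ≠ i) (x : Θ.FramedMod) :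
    𝒟.framed.e K (.inr j) • x = 0 := by
  rw [smul_def, lift_e, opE, if_neg h]; rfl

theorem ε_inl_smul (j : ι) (x : Θ.FramedMod) : 𝒟.framed.ε K (.inl j) • x = (𝒟.ε K j • x.1, 0) := by
  rw [smul_def, lift_ε]; rfl

theorem ε_inr_smul (x : Θ.FramedMod) :
    𝒟.framed.ε K (.inr i) • x = (0, truncX K (𝒟.c i) * x.2) := by
  rw [smul_def, lift_ε, opEps, if_pos rfl, actH_apply]

theorem ε_inr_smul_of_ne {j : ι} (h : j ≠ i) (x : Θ.FramedMod) :
    𝒟.framed.ε K (.inr j) • x = 0 := by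
  rw [smul_def, lift_ε, opEps, if_neg h]; rfl

theorem α_inl_inl_smul (j k : ι) (g : ℕ) (x : Θ.FramedMod) :
    𝒟.framed.α K (.inl j) (.inl k) g • x = (𝒟.α K j k g • x.1, 0) := by
  rw [smul_def, lift_α]; rfl

theorem α_inr_inl_smul (x : Θ.FramedMod) :
    𝒟.framed.α K (.inr i) (.inl i) 0 • x = (0, Θ.toLin x.1) := by
  rw [smul_def, lift_α, opArr, if_pos ⟨rfl, rfl, rfl⟩, frame_apply]

theorem α_inr_smul (j : ι) (y : ι ⊕ ι) (g : ℕ) (x : Θ.FramedMod) :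
    (𝒟.framed.α K (.inr j) y g • x).1 = 0 := by
  rw [smul_def, lift_α]
  cases y with
  | inl k =>
    rw [opArr]
    split_ifs <;> rfl
  | inr k => rfl

theorem α_inr_smul' (y : ι ⊕ ι) (j : ι) (g : ℕ) (x : Θ.FramedMod) :
    𝒟.framed.α K y (.inr j) g • x = 0 := by
  rw [smul_def, lift_α]
  cases y <;> rfl

theorem unframe_e_inl (j : ι) : 𝒟.unframe K (𝒟.framed.e K (.inl j)) = 𝒟.e K j := lift_e K _ _

theorem fst_smul (a : 𝒟.framed.Alg K) (x : Θ.FramedMod) :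
    (a • x).1 = 𝒟.unframe K a • x.1 := by
  refine map_smul_of_generators 𝒟.framed (𝒟.unframe K)
    (show Θ.FramedMod →ₗ[K] V from LinearMap.fst K V (TruncPoly K (𝒟.c i))) ?_ ?_ ?_ a x
  · rintro (j | j) x
    · rw [e_inl_smul, unframe, lift_e]; rfl
    · rw [unframe, lift_e]
      by_cases h : j = i
      · subst h; rw [e_inr_smul]; exact (zero_smul _ _).symm
      · rw [e_inr_smul_of_ne Θ h]; exact (zero_smul _ _).symm
  · rintro (j | j) x
    · rw [ε_inl_smul, unframe, lift_ε]; rfl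
    · rw [unframe, lift_ε]
      by_cases h : j = i
      · subst h; rw [ε_inr_smul]; exact (zero_smul _ _).symm
      · rw [ε_inr_smul_of_ne Θ h]; exact (zero_smul _ _).symm
  · rintro (j | j) (k | k) g x
    · rw [α_inl_inl_smul, unframe, lift_α]; rfl
    · rw [α_inr_smul', unframe, lift_α]; exact (zero_smul _ _).symm
    · rw [unframe, lift_α]; exact (Θ.α_inr_smul j (.inl k) g x).trans (zero_smul _ _).symm
    · rw [α_inr_smul', unframe, lift_α]; exact (zero_smul _ _).symm

/-- The projection `V ⊕ H_i → V`. -/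
def fst : Θ.FramedMod →ₛₗ[(𝒟.unframe K).toRingHom] V where
  toFun x := x.1
  map_add' _ _ := rfl
  map_smul' := Θ.fst_smul

/-- The embedding `H_i → V ⊕ H_i`. -/
def inrLin : 𝒟.framed.E K (.inr i) →ₗ[K] Θ.FramedMod :=
  LinearMap.inr K V (TruncPoly K (𝒟.c i))

theorem inrLin_smul (a : 𝒟.framed.Alg K) (h : 𝒟.framed.E K (.inr i)) :
    Θ.inrLin (a • h) = a • Θ.inrLin h := by
  refine map_smul_of_generators 𝒟.framed (AlgHom.id K _) Θ.inrLin ?_ ?_ ?_ a h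
  · rintro (j | j) x
    · rw [AlgHom.id_apply, e_inl_smul, ← 𝒟.framed.e_smul_E K (.inr i) x,
        e_smul_e_smul_of_ne Sum.inl_ne_inr]
      exact Prod.ext (smul_zero _).symm rfl
    · rw [AlgHom.id_apply]
      by_cases h : j = i
      · subst h; rw [e_inr_smul, 𝒟.framed.e_smul_E]; rfl
      · rw [e_inr_smul_of_ne Θ h, ← 𝒟.framed.e_smul_E K (.inr i) x,
          e_smul_e_smul_of_ne fun h' => h (Sum.inr_injective h')]
        rfl
  · rintro (j | j) x
    · rw [AlgHom.id_apply, ε_inl_smul, ε_smul_of_ne Sum.inl_ne_inr (𝒟.framed.e_smul_E K _ x)]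
      exact Prod.ext (smul_zero _).symm rfl
    · rw [AlgHom.id_apply]
      by_cases h : j = i
      · subst h
        rw [ε_inr_smul]
        refine Prod.ext rfl ?_
        change 𝒟.framed.toE K (.inr j) (𝒟.framed.ε K (.inr j)) * _ = _
        rw [toE_ε]
        rfl
      · rw [ε_inr_smul_of_ne Θ h, ε_smul_of_ne (fun h' => h (Sum.inr_injective h'))
          (𝒟.framed.e_smul_E K _ x)]
        rfl
  · intro y z g x
    rw [AlgHom.id_apply]
    have h1 : 𝒟.framed.α K y z g • x = 0 := by
      change 𝒟.framed.toE K (.inr i) (𝒟.framed.α K y z g) *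
        (show TruncPoly K (𝒟.framed.c (.inr i)) from x) = 0
      rw [toE_α, zero_mul]
    rw [h1, map_zero, eq_comm]
    cases z with
    | inr k => exact Θ.α_inr_smul' y k g _
    | inl k =>
      rw [← α_smul_e_smul, e_inl_smul]
      have h2 : (show Θ.FramedMod from (𝒟.e K k • (Θ.inrLin x).1, 0)) = 0 :=
        Prod.ext (smul_zero _) rfl
      exact (congrArg _ h2).trans (smul_zero _)

/-- The embedding `E_{i'} → V ⊕ H_i`. -/
def inr : 𝒟.framed.E K (.inr i) →ₗ[𝒟.framed.Alg K] Θ.FramedMod where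
  toFun h := (0, h)
  map_add' _ _ := Prod.ext (add_zero _).symm rfl
  map_smul' := Θ.inrLin_smul

theorem inr_injective : Function.Injective Θ.inr := fun _ _ h => congrArg Prod.snd h

theorem fst_surjective : Function.Surjective Θ.fst := fun x => ⟨(x, 0), rfl⟩

theorem exact_inr_fst : Function.Exact Θ.inr Θ.fst := by
  intro x
  constructor
  · intro h
    exact ⟨x.2, Prod.ext (Eq.symm h) rfl⟩
  · rintro ⟨h, rfl⟩
    rfl

end FramingMap

end Framed

end GPA.CartanDatum

namespace GPA

theorem IsFreeNilp.of_equiv {K : Type*} [Field K] {V W : Type*} [AddCommGroup V] [Module K V]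
    [AddCommGroup W] [Module K W] {c : ℕ} {ε : Module.End K V} {ε' : Module.End K W}
    (h : IsFreeNilp c ε') (E : V ≃ₗ[K] W) (hE : ∀ x, E (ε x) = ε' (E x)) : IsFreeNilp c ε := by
  intro x hx
  obtain ⟨y, hy⟩ := h (E x) (by rw [← hE, hx, map_zero])
  refine ⟨E.symm y, E.injective ?_⟩
  rw [hy]
  exact ((pow_apply_comm_of_comp (f := E.toLinearMap) hE (c - 1) (E.symm y)).trans
    (congrArg _ (E.apply_symm_apply y))).symm

namespace CartanDatum

theorem weight_eq {ι : Type w} (𝒟 : CartanDatum ι) [Fintype ι] [DecidableEq ι] (i : ι)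
    (l : List ι) :
    (l.map 𝒟.sP).prod (𝒟.antidominant (Pi.single i 1)) - 𝒟.antidominant (Pi.single i 1) =
      (𝒟.rvec i l, 0) := by
  rw [sub_eq_iff_eq_add]
  induction l with
  | nil => simp [rvec]
  | cons j l ih =>
    rw [List.map_cons, List.prod_cons, LinearEquiv.mul_apply, ih, sP, Module.reflection_apply,
      antidominant, rvec, s_apply]
    refine Prod.ext ?_ ?_
    · funext k
      by_cases h : j = i
      · subst h
        simp [corootP]
        ring
      · simp [corootP, h]
    · simp

theorem I_append {ι : Type w} (𝒟 : CartanDatum ι) [Fintype ι] (K : Type u) [Field K]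
    (l l' : List ι) : 𝒟.I K (l ++ l') = 𝒟.I K l * 𝒟.I K l' := by
  induction l with
  | nil => rw [List.nil_append, I, Ideal.top_mul]
  | cons j l ih => rw [List.cons_append, I_cons, I_cons, ih, mul_assoc]

namespace FramingMap

variable {ι : Type w} {𝒟 : CartanDatum ι} [Fintype ι] {K : Type u} [Field K]
variable {V : Type v} [AddCommGroup V] [Module K V] [Module (𝒟.Alg K) V]
  [IsScalarTower K (𝒟.Alg K) V] {i : ι} (Θ : 𝒟.FramingMap K V i) [DecidableEq ι]

instance [Module.Finite K V] : Module.Finite K Θ.FramedMod :=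
  inferInstanceAs (Module.Finite K (V × TruncPoly K (𝒟.c i)))

/-- The vertex spaces of `V ⊕ H_i` at the unframed vertices. -/
def vertexSpaceInl (k : ι) :
    𝒟.framed.vertexSpace K Θ.FramedMod (.inl k) ≃ₗ[K] 𝒟.vertexSpace K V k where
  toFun x := ⟨x.1.1, (𝒟.mem_vertexSpace K).2 (by
    have h := (𝒟.framed.mem_vertexSpace K).1 x.2
    rw [e_inl_smul] at h
    exact congrArg Prod.fst h)⟩
  map_add' _ _ := rfl
  map_smul' _ _ := rfl
  invFun y := ⟨(show Θ.FramedMod from (y.1, 0)), (𝒟.framed.mem_vertexSpace K).2 (by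
    rw [e_inl_smul]
    exact Prod.ext ((𝒟.mem_vertexSpace K).1 y.2) rfl)⟩
  left_inv x := by
    have h := (𝒟.framed.mem_vertexSpace K).1 x.2
    rw [e_inl_smul] at h
    have h3 : (0 : TruncPoly K (𝒟.c i)) = x.1.2 := congrArg Prod.snd h
    exact Subtype.ext (Prod.ext rfl h3)
  right_inv _ := rfl

theorem vertexSpaceInl_epsOn (k : ι) (x : 𝒟.framed.vertexSpace K Θ.FramedMod (.inl k)) :
    Θ.vertexSpaceInl k (𝒟.framed.epsOn K Θ.FramedMod (.inl k) x) =
      𝒟.epsOn K V k (Θ.vertexSpaceInl k x) := by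
  apply Subtype.ext
  change (𝒟.framed.ε K (.inl k) • x.1).1 = _
  rw [ε_inl_smul]
  rfl

theorem bijective_vertexMap_inr (k : ι) :
    Function.Bijective (𝒟.framed.vertexMap K Θ.inr (.inr k)) := by
  refine ⟨𝒟.framed.vertexMap_injective K Θ.inr_injective _, ?_⟩
  rintro ⟨x, hx⟩
  have hx' := (𝒟.framed.mem_vertexSpace K).1 hx
  have h1 : Θ.inr x.2 = x := by
    by_cases h : k = i
    · subst h
      rw [e_inr_smul] at hx'
      exact hx'
    · rw [e_inr_smul_of_ne Θ h] at hx'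
      rw [← hx']
      rfl
  obtain ⟨y, rfl⟩ : ∃ y, Θ.inr y = x := ⟨_, h1⟩
  refine ⟨⟨y, (𝒟.framed.mem_vertexSpace K).2 (Θ.inr_injective ?_)⟩, rfl⟩
  rw [map_smul, hx']

theorem hasRankVector [Module.Finite K V] (hfree : ∀ k, IsFreeNilp (𝒟.c k) (𝒟.epsOn K V k))
    {ν : ι → ℕ} (hν : ∀ k, Module.finrank K (𝒟.vertexSpace K V k) = 𝒟.c k * ν k) :
    𝒟.framed.HasRankVector K Θ.FramedMod (Sum.elim ν (Pi.single i 1)) := by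
  refine 𝒟.framed.hasRankVector_of_isFreeNilp (fun _ => inferInstance) ?_ ?_
  · rintro (k | k)
    · exact (hfree k).of_equiv (Θ.vertexSpaceInl k) (Θ.vertexSpaceInl_epsOn k)
    · let E := LinearEquiv.ofBijective _ (Θ.bijective_vertexMap_inr k)
      refine (𝒟.framed.isFreeNilp_epsOn_E K (.inr i) (.inr k)).of_equiv E.symm fun x => ?_
      obtain ⟨y, rfl⟩ := E.surjective x
      apply E.injective
      rw [LinearEquiv.apply_symm_apply, LinearEquiv.symm_apply_apply]
      exact (𝒟.framed.vertexMap_epsOn K Θ.inr (.inr k) y).symm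
  · rintro (k | k)
    · exact (Θ.vertexSpaceInl k).finrank_eq.trans (hν k)
    · rw [← 𝒟.framed.finrank_vertexSpace_of_bijective (Θ.bijective_vertexMap_inr k),
        finrank_vertexSpace_E]
      by_cases h : k = i
      · subst h; simp
      · simp [h]

end FramingMap

/-! ### Stable framed modules from duals of cyclic modules -/

section DualFraming

variable {ι : Type w} {𝒟 : CartanDatum ι} [Fintype ι] {K : Type u} [Field K]
variable {X : Type v} [AddCommGroup X] [Module K X] [Module (𝒟.Alg K) X]
  [IsScalarTower K (𝒟.Alg K) X]

/-- The framing of the dual of a module that is defined by an element `x` of it. -/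
def dualFraming {i : ι} {x : X} (hx : 𝒟.e K i • x = x) : 𝒟.FramingMap K (𝒟.Dual K X) i where
  -- The H_i-linear map φ ↦ ∑ φ(ε_i^s x) ε^(c_i - 1 - s) whose coefficient at the socle power ε^(c_i
  -- - 1) is evaluation at x.
  toLin := ∑ s ∈ Finset.range (𝒟.c i),
    ((Module.Dual.eval K X (𝒟.ε K i ^ s • x)) ∘ₗ 𝒟.ev X).smulRight
      (truncX K (𝒟.c i) ^ (𝒟.c i - 1 - s))
  map_e φ := by
    simp only [LinearMap.sum_apply, LinearMap.smulRight_apply, LinearMap.comp_apply,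
      Module.Dual.eval_apply, ev_e_smul, e_smul_ε_pow_smul, hx]
  map_ε φ := by
    simp only [LinearMap.sum_apply, LinearMap.smulRight_apply, LinearMap.comp_apply,
      Module.Dual.eval_apply, ev_ε_smul, Finset.mul_sum, mul_smul_comm, ← pow_succ', ← mul_smul]
    have hp1 := (𝒟.relations K).p1 i
    have htr := truncX_pow K (𝒟.c i)
    obtain ⟨m, hm⟩ : ∃ m, 𝒟.c i = m + 1 := ⟨𝒟.c i - 1, by have := 𝒟.one_le_c i; omega⟩
    have hm' : 𝒟.c i - 1 = m := by omega
    have hsum : ∀ F : ℕ → TruncPoly K (𝒟.c i), ∑ s ∈ Finset.range (𝒟.c i), F s =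
        ∑ s ∈ Finset.range (m + 1), F s := fun F =>
      congrArg (fun n => ∑ s ∈ Finset.range n, F s) hm
    have htr' : truncX K (𝒟.c i) ^ (m + 1) = 0 :=
      (congrArg (truncX K (𝒟.c i) ^ ·) hm.symm).trans htr
    rw [hm] at hp1
    -- The two sums agree after an index shift. The surplus terms vanish, one by ε_i^(c_i) = 0 in Π
    -- and the other by ε^(c_i) = 0 in H_i.
    rw [hsum, hsum, hm', Finset.sum_range_succ, Finset.sum_range_succ', hp1, zero_smul, map_zero,
      zero_smul, add_zero, Nat.sub_zero, htr', smul_zero, add_zero]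
    refine Finset.sum_congr rfl fun s hs => ?_
    rw [show m - (s + 1) + 1 = m - s by have := Finset.mem_range.1 hs; omega]

theorem dualFraming_toLin {i : ι} {x : X} (hx : 𝒟.e K i • x = x) (φ : 𝒟.Dual K X) :
    (dualFraming hx).toLin φ = ∑ s ∈ Finset.range (𝒟.c i),
      𝒟.ev X φ (𝒟.ε K i ^ s • x) • truncX K (𝒟.c i) ^ (𝒟.c i - 1 - s) := by
  simp [dualFraming]

variable [DecidableEq ι]

theorem ev_eq_zero_of_dualFraming {i : ι} {x : X} (hx : 𝒟.e K i • x = x) {φ : 𝒟.Dual K X}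
    (hε : 𝒟.ε K i • φ = 0) (h : (dualFraming hx).toLin φ = 0) : 𝒟.ev X φ x = 0 := by
  rw [dualFraming_toLin, Finset.sum_eq_single 0] at h
  · rw [pow_zero, one_smul, Nat.sub_zero, smul_eq_zero] at h
    exact h.resolve_right (truncX_pow_pred_ne_zero (𝒟.one_le_c i))
  · intro s _ hs
    obtain ⟨s, rfl⟩ := Nat.exists_eq_succ_of_ne_zero hs
    rw [Nat.succ_eq_add_one, pow_succ', mul_smul, ← ev_ε_smul, hε, map_zero, LinearMap.zero_apply,
      zero_smul]
  · intro h0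
    exact absurd (Finset.mem_range.2 (𝒟.one_le_c i)) h0

/-- A socle element at an unprimed vertex is a form φ that is also killed by the framing arrow,
hence φ(x) = 0. As Π acts on φ by scalars, φ vanishes on all of Π x = X. -/
theorem sub_dualFraming_eq_bot [Module.Finite K X] {i : ι} {x : X} (hx : 𝒟.e K i • x = x)
    (hgen : ∀ y : X, ∃ a : 𝒟.Alg K, a • x = y) (j : ι) :
    𝒟.framed.sub K (dualFraming hx).FramedMod (.inl j) = ⊥ := by
  have : Module.Finite K (𝒟.Dual K X) := inferInstanceAs (Module.Finite K (Module.Dual K X))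
  have : IsArtinian (𝒟.framed.Alg K) (dualFraming hx).FramedMod := isArtinian_of_tower K inferInstance
  rw [sub_eq_bot_iff]
  intro y hy
  have he := hy (𝒟.framed.e K (.inl j))
  rw [toS_e_self, one_smul, FramingMap.e_inl_smul] at he
  have h2 : y.2 = 0 := (congrArg Prod.snd he).symm
  refine Prod.ext ?_ h2
  have he1 : 𝒟.e K j • y.1 = y.1 := congrArg Prod.fst he
  have hε : 𝒟.ε K j • y.1 = 0 := by
    have h := hy (𝒟.framed.ε K (.inl j))
    rw [toS_ε, zero_smul, FramingMap.ε_inl_smul] at h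
    exact congrArg Prod.fst h
  have hα : ∀ k g, 𝒟.α K k j g • y.1 = 0 := by
    intro k g
    have h := hy (𝒟.framed.α K (.inl k) (.inl j) g)
    rw [toS_α, zero_smul, FramingMap.α_inl_inl_smul] at h
    exact congrArg Prod.fst h
  have hx0 : 𝒟.ev X y.1 x = 0 := by
    by_cases h : j = i
    · subst h
      refine ev_eq_zero_of_dualFraming hx hε ?_
      have h := hy (𝒟.framed.α K (.inr j) (.inl j) 0)
      rw [toS_α, zero_smul, FramingMap.α_inr_inl_smul] at h
      exact congrArg Prod.snd h
    · rw [← hx, ← ev_e_smul, ← he1, e_smul_e_smul_of_ne (Ne.symm h), map_zero,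
        LinearMap.zero_apply]
  refine 𝒟.dual_ext fun m => ?_
  obtain ⟨a, rfl⟩ := hgen m
  have h3 := 𝒟.smul_eq_toS_smul he1 hε hα (𝒟.anti K a).unop
  have h4 := congrArg (fun φ => 𝒟.ev X φ x) h3
  simp only [ev_smul, anti_anti, map_smul, LinearMap.smul_apply, hx0, smul_zero] at h4
  exact h4

/-- The submodule of the framed dual that consists of the linear forms vanishing on `Y`. -/
def annMod {i : ι} (Θ : 𝒟.FramingMap K (𝒟.Dual K X) i) (Y : Submodule (𝒟.Alg K) X) :
    Submodule (𝒟.framed.Alg K) Θ.FramedMod where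
  carrier := {y | ∀ p ∈ Y, 𝒟.ev X y.1 p = 0}
  zero_mem' _ _ := rfl
  add_mem' {y z} hy hz p hp := by
    change 𝒟.ev X (y.1 + z.1) p = 0
    rw [map_add, LinearMap.add_apply, hy p hp, hz p hp, add_zero]
  smul_mem' a y hy p hp := by
    rw [FramingMap.fst_smul, ev_smul]
    exact hy _ (Y.smul_mem _ hp)

section

variable {i : ι} (Θ : 𝒟.FramingMap K (𝒟.Dual K X) i)

theorem annMod_bot : annMod Θ (⊥ : Submodule (𝒟.Alg K) X) = ⊤ := by
  rw [eq_top_iff]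
  intro y _ p hp
  rw [(Submodule.mem_bot _).1 hp, map_zero]

theorem annMod_top : annMod Θ (⊤ : Submodule (𝒟.Alg K) X) = LinearMap.range Θ.inr := by
  ext y
  constructor
  · intro h
    exact ⟨y.2, Prod.ext (𝒟.dual_ext fun m => (h m Submodule.mem_top).symm) rfl⟩
  · rintro ⟨h, rfl⟩ p _
    rfl

theorem unframe_mem_idemIdeal {j : ι} {a : 𝒟.framed.Alg K}
    (ha : a ∈ 𝒟.framed.idemIdeal K (.inl j)) : 𝒟.unframe K a ∈ 𝒟.idemIdeal K j := by
  induction ha using Submodule.span_induction with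
  | mem x hx =>
    obtain ⟨a, b, rfl⟩ := hx
    rw [map_mul, map_mul, map_sub, map_one, FramingMap.unframe_e_inl]
    exact Submodule.subset_span ⟨_, _, rfl⟩
  | zero => rw [map_zero]; exact zero_mem _
  | add x y _ _ hx hy => rw [map_add]; exact add_mem hx hy
  | smul b x _ hx =>
    rw [smul_eq_mul, map_mul]
    exact Ideal.mul_mem_left _ _ hx

/-- The quotient of the two annihilators is dual to Y / Y', so it is again killed by I_j and free
over H_j. -/
theorem reflTransGen_annMod [Module.Finite K X] {j : ι} {Y Y' : Submodule (𝒟.Alg K) X}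
    (hY : Y' ≤ Y) (hI : ∀ a ∈ 𝒟.idemIdeal K j, ∀ p ∈ Y, a • p ∈ Y')
    (hfree : ∀ p ∈ Y, 𝒟.e K j • p = p → 𝒟.ε K j • p ∈ Y' →
      ∃ p' ∈ Y, 𝒟.e K j • p' = p' ∧ p - 𝒟.ε K j ^ (𝒟.c j - 1) • p' ∈ Y') :
    Relation.ReflTransGen (𝒟.framed.EStep K) (annMod Θ Y) (annMod Θ Y') := by
  have : Module.Finite K (𝒟.Dual K X) := inferInstanceAs (Module.Finite K (Module.Dual K X))
  have : IsNoetherian (𝒟.framed.Alg K) Θ.FramedMod := isNoetherian_of_tower K inferInstance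
  refine 𝒟.framed.reflTransGen_eStep (j := .inl j) (fun y hy p hp => hy p (hY hp)) ?_ ?_
  · intro a ha y hy p hp
    rw [FramingMap.fst_smul, ev_smul]
    exact hy _ (hI _ (𝒟.anti_mem_idemIdeal (unframe_mem_idemIdeal ha)) p hp)
  · intro y hy hey hεy
    have he1 : 𝒟.e K j • y.1 = y.1 := by
      rw [FramingMap.e_inl_smul] at hey
      exact congrArg Prod.fst hey
    obtain ⟨φ', h1, h2, h3⟩ := 𝒟.exists_dual_sub_ε_pow_smul hfree hy he1 (fun p hp => by
      have := hεy p hp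
      rwa [FramingMap.ε_inl_smul] at this)
    let y' : Θ.FramedMod := (φ', 0)
    refine ⟨y', h1, ?_, fun p hp => ?_⟩
    · rw [FramingMap.e_inl_smul]
      exact Prod.ext h2 rfl
    · change 𝒟.ev X (y.1 - (𝒟.framed.ε K (.inl j) ^ (𝒟.c j - 1) • y').1) p = 0
      rw [FramingMap.fst_smul, map_pow]
      have h4 : 𝒟.unframe K (𝒟.framed.ε K (.inl j)) = 𝒟.ε K j := lift_ε K _ _
      rw [h4]
      exact h3 p hp

end

end DualFraming

/-! ### Existence of N(-wϖ_i) -/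

section Existence

variable {ι : Type w} (𝒟 : CartanDatum ι) [Fintype ι] [DecidableEq ι] {K : Type u} [Field K]

variable (K) in
/-- The framing of the dual of `Π e_i / I_w e_i`. -/
abbrev framingQP (i : ι) (l : List ι) : 𝒟.FramingMap K (𝒟.Dual K (𝒟.QP K i l)) i :=
  dualFraming (𝒟.QP_gen K i l)

variable (K) in
/-- The image of `I_{w'} e_i` in `Π e_i / I_w e_i`. -/
def imP (i : ι) (l l' : List ι) : Submodule (𝒟.Alg K) (𝒟.QP K i l) :=
  (𝒟.subP K i l').map (𝒟.subP K i l).mkQ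

theorem smul_mem_imP {i j : ι} {l l' : List ι} {a : 𝒟.Alg K} (ha : a ∈ 𝒟.idemIdeal K j)
    {p : 𝒟.QP K i l} (hp : p ∈ 𝒟.imP K i l l') : a • p ∈ 𝒟.imP K i l (j :: l') := by
  obtain ⟨q, hq, rfl⟩ := hp
  refine ⟨a • q, ?_, map_smul _ _ _⟩
  rw [SetLike.mem_coe, subP_cons]
  exact Submodule.smul_mem_smul ha hq

theorem subP_append_le (i : ι) (l l' : List ι) : 𝒟.subP K i (l ++ l') ≤ 𝒟.subP K i l' := by
  intro p hp
  have h : (p : 𝒟.Alg K) ∈ 𝒟.I K (l ++ l') := hp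
  rw [I_append] at h
  exact Ideal.mul_le.2 (fun a _ b hb => Ideal.mul_mem_left _ a hb) h

theorem free_imP (i j : ι) {l l₁ l₂ : List ι} (hl : 𝒟.IsReduced l) (h : l = l₁ ++ j :: l₂)
    {x : 𝒟.QP K i l} (hx : x ∈ 𝒟.imP K i l l₂) (hex : 𝒟.e K j • x = x)
    (hεx : 𝒟.ε K j • x ∈ 𝒟.imP K i l (j :: l₂)) :
    ∃ x' ∈ 𝒟.imP K i l l₂, 𝒟.e K j • x' = x' ∧
      x - 𝒟.ε K j ^ (𝒟.c j - 1) • x' ∈ 𝒟.imP K i l (j :: l₂) := by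
  obtain ⟨q, hq, rfl⟩ := hx
  obtain ⟨r, hr, hr'⟩ := hεx
  have h1 : 𝒟.ε K j • 𝒟.e K j • q ∈ 𝒟.subP K i (j :: l₂) := by
    have h2 : 𝒟.ε K j • q - r ∈ 𝒟.subP K i l := by
      rw [← (𝒟.subP K i l).ker_mkQ, LinearMap.mem_ker, map_sub, hr', map_smul, sub_self]
    rw [h] at h2
    rw [ε_smul_e_smul]
    have h3 := add_mem (𝒟.subP_append_le i l₁ (j :: l₂) h2) hr
    rwa [sub_add_cancel] at h3
  obtain ⟨q', hq', heq', h2⟩ := 𝒟.free_subP_quotient i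
    (IsReduced.of_append_right 𝒟 (l := l₁) (h ▸ hl)) (Submodule.smul_mem _ (𝒟.e K j) hq)
    (e_smul_e_smul j q) h1
  refine ⟨(𝒟.subP K i l).mkQ q', ⟨q', hq', rfl⟩, ?_, ?_⟩
  · rw [← map_smul, heq']
  · rw [← hex, ← map_smul, ← map_smul, ← map_sub]
    exact ⟨_, h2, rfl⟩

/-- Going leftward through the suffixes of the word, the images of I_{l₂} e_i decrease and their
annihilators grow. Each added letter j contributes a layer free over H_j, because suffixes of a
reduced word are reduced. -/
theorem reflTransGen_annMod_imP (i : ι) {l : List ι} (hl : 𝒟.IsReduced l) (l₁ l₂ : List ι)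
    (h : l = l₁ ++ l₂) : Relation.ReflTransGen (𝒟.framed.EStep K)
      (annMod (𝒟.framingQP K i l) ⊤) (annMod (𝒟.framingQP K i l) (𝒟.imP K i l l₂)) := by
  have := (𝒟.isExtremal_of_isReduced (K := K) i hl).finite
  induction l₂ generalizing l₁ with
  | nil =>
    have h0 : 𝒟.imP K i l [] = ⊤ := by
      rw [imP, 𝒟.subP_eq_top (l := []) (by simp), Submodule.map_top, Submodule.range_mkQ]
    rw [h0]
  | cons j l₂ ih =>
    refine (ih (l₁ ++ [j]) (by simpa using h)).trans (reflTransGen_annMod _ (j := j) ?_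
      (fun a ha p hp => 𝒟.smul_mem_imP ha hp)
      (fun p hp hep hεp => 𝒟.free_imP i j hl h hp hep hεp))
    exact Submodule.map_mono (𝒟.subP_append_le i [j] l₂)

/-- The filtration starts with E_{i'}, the forms vanishing on everything, and continues through the
annihilators of the suffix ideals up to the annihilator of 0. -/
theorem isEFiltered_framingQP (i : ι) {l : List ι} (hl : 𝒟.IsReduced l) :
    𝒟.framed.IsEFiltered K (𝒟.framingQP K i l).FramedMod := by
  apply isEFiltered_of_reflTransGen
  have h1 := 𝒟.reflTransGen_annMod_imP (K := K) i hl [] l rfl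
  have h2 : 𝒟.imP K i l l = ⊥ := by
    rw [imP, ← LinearMap.le_ker_iff_map, Submodule.ker_mkQ]
  rw [h2, annMod_bot, annMod_top] at h1
  exact Relation.ReflTransGen.head
    (𝒟.framed.eStep_bot_range K (𝒟.framingQP K i l).inr_injective) h1

theorem IsExtremal.exists_nat {i : ι} {l : List ι} (h : 𝒟.IsExtremal K i l) :
    ∃ ν : ι → ℕ, (𝒟.rvec i l = fun k => (ν k : ℤ)) ∧
      ∀ k, Module.finrank K (𝒟.vertexSpace K (𝒟.QP K i l) k) = 𝒟.c k * ν k := by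
  have h0 : ∀ k, 0 ≤ 𝒟.rvec i l k := by
    intro k
    have h1 : (0 : ℤ) ≤ 𝒟.c k * 𝒟.rvec i l k := by rw [← h.rank]; positivity
    exact nonneg_of_mul_nonneg_right h1 (by exact_mod_cast 𝒟.one_le_c k)
  refine ⟨fun k => (𝒟.rvec i l k).toNat, funext fun k => (Int.toNat_of_nonneg (h0 k)).symm,
    fun k => ?_⟩
  have h1 := h.rank k
  rw [← Int.toNat_of_nonneg (h0 k)] at h1
  exact_mod_cast h1

theorem isStableOfWeight_framingQP (i : ι) {l : List ι} (hl : 𝒟.IsReduced l) :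
    𝒟.IsStableOfWeight K l (Pi.single i 1) (𝒟.framingQP K i l).FramedMod := by
  have hext := 𝒟.isExtremal_of_isReduced (K := K) i hl
  have := hext.finite
  have : Module.Finite K (𝒟.Dual K (𝒟.QP K i l)) :=
    inferInstanceAs (Module.Finite K (Module.Dual K _))
  obtain ⟨ν, h1, h2⟩ := IsExtremal.exists_nat 𝒟 hext
  refine ⟨𝒟.isEFiltered_framingQP i hl,
    sub_dualFraming_eq_bot (𝒟.QP_gen K i l) (𝒟.QP_cyclic i l), ν,
    FramingMap.hasRankVector _ (fun k => 𝒟.isFreeNilp_epsOn_dual (hext.free k)) (fun k => ?_), ?_⟩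
  · rw [finrank_vertexSpace_dual, h2]
  · rw [weight_eq, h1]

theorem isStableOfWeight_E_inr (i : ι) :
    𝒟.IsStableOfWeight K [] (Pi.single i 1) (𝒟.framed.E K (.inr i)) := by
  have : IsArtinian (𝒟.framed.Alg K) (𝒟.framed.E K (.inr i)) := isArtinian_of_tower K inferInstance
  refine ⟨?_, fun j => ?_, 0, ?_, ?_⟩
  · apply isEFiltered_of_reflTransGen
    have h := 𝒟.framed.eStep_bot_range K (f := LinearMap.id (R := 𝒟.framed.Alg K)
      (M := 𝒟.framed.E K (.inr i))) Function.injective_id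
    rw [LinearMap.range_id] at h
    exact .single h
  · rw [sub_eq_bot_iff]
    intro x hx
    have h := hx (𝒟.framed.e K (.inl j))
    rw [toS_e_self, one_smul, ← 𝒟.framed.e_smul_E K (.inr i) x,
      e_smul_e_smul_of_ne Sum.inl_ne_inr] at h
    rw [← 𝒟.framed.e_smul_E K (.inr i) x, ← h]
  · refine 𝒟.framed.hasRankVector_of_isFreeNilp (fun _ => inferInstance)
      (𝒟.framed.isFreeNilp_epsOn_E K (.inr i)) fun k => ?_
    rw [finrank_vertexSpace_E]
    rcases k with k | k
    · simp
    · by_cases h : k = i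
      · subst h; simp
      · simp [h]
  · simp
    rfl

end Existence

theorem isN_dual_QP {ι : Type} (𝒟 : CartanDatum ι) [Fintype ι] [DecidableEq ι] {K : Type u}
    [Field K] (i : ι) {l : List ι} (hl : 𝒟.IsReduced l) :
    𝒟.IsN K l (Pi.single i 1) (𝒟.Dual K (𝒟.QP K i l)) :=
  ⟨(𝒟.framingQP K i l).FramedMod, inferInstance, inferInstance, inferInstance, inferInstance,
    𝒟.framed.E K (.inr i), inferInstance, inferInstance, inferInstance, inferInstance,
    (𝒟.framingQP K i l).inr, (𝒟.framingQP K i l).fst, 𝒟.isStableOfWeight_framingQP i hl,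
    𝒟.isStableOfWeight_E_inr i, (𝒟.framingQP K i l).inr_injective,
    (𝒟.framingQP K i l).exact_inr_fst, (𝒟.framingQP K i l).fst_surjective⟩

theorem IsN.of_equiv {ι : Type w} {𝒟 : CartanDatum ι} [Fintype ι] [DecidableEq ι] {K : Type u}
    [Field K] {l : List ι} {m : ι → ℕ} {V W : Type v} [AddCommGroup V] [Module (𝒟.Alg K) V]
    [AddCommGroup W] [Module (𝒟.Alg K) W] (h : 𝒟.IsN K l m V) (E : V ≃ₗ[𝒟.Alg K] W) :
    𝒟.IsN K l m W := by
  obtain ⟨N, _, _, _, _, N₀, _, _, _, _, f, p, h1, h2, h3, h4, h5⟩ := h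
  refine ⟨N, _, _, _, ‹_›, N₀, _, _, _, ‹_›, f, E.toLinearMap.comp p, h1, h2, h3, fun x => ?_,
    E.surjective.comp h5⟩
  rw [← h4 x]
  exact E.map_eq_zero_iff

end CartanDatum

end GPA

namespace GPA.CartanDatum

/-! ### Duals of homomorphisms and the double dual -/

section DualFunctor

variable {ι : Type w} {𝒟 : CartanDatum ι} [Fintype ι] {K : Type u} [Field K]
variable {X : Type*} [AddCommGroup X] [Module K X] [Module (𝒟.Alg K) X] [IsScalarTower K (𝒟.Alg K) X]
variable {Y : Type*} [AddCommGroup Y] [Module K Y] [Module (𝒟.Alg K) Y] [IsScalarTower K (𝒟.Alg K) Y]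

/-- The dual of a homomorphism. -/
def dualHom (f : X →ₗ[𝒟.Alg K] Y) : 𝒟.Dual K Y →ₗ[𝒟.Alg K] 𝒟.Dual K X where
  toFun φ := 𝒟.ev Y φ ∘ₗ f.restrictScalars K
  map_add' _ _ := rfl
  map_smul' a φ := 𝒟.dual_ext fun m => by
    change 𝒟.ev Y φ ((𝒟.anti K a).unop • f m) = 𝒟.ev Y φ (f ((𝒟.anti K a).unop • m))
    exact (congrArg (𝒟.ev Y φ) (map_smul f _ m)).symm

theorem ev_dualHom (f : X →ₗ[𝒟.Alg K] Y) (φ : 𝒟.Dual K Y) (x : X) :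
    𝒟.ev X (dualHom f φ) x = 𝒟.ev Y φ (f x) := rfl

/-- The dual of an isomorphism. -/
def dualEquiv (f : X ≃ₗ[𝒟.Alg K] Y) : 𝒟.Dual K Y ≃ₗ[𝒟.Alg K] 𝒟.Dual K X :=
  LinearEquiv.ofLinearMap (dualHom f.toLinearMap) (dualHom f.symm.toLinearMap)
    (LinearMap.ext fun φ => 𝒟.dual_ext fun x => by
      rw [LinearMap.comp_apply, ev_dualHom, ev_dualHom]
      exact congrArg (𝒟.ev X φ) (f.symm_apply_apply x))
    (LinearMap.ext fun φ => 𝒟.dual_ext fun x => by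
      rw [LinearMap.comp_apply, ev_dualHom, ev_dualHom]
      exact congrArg (𝒟.ev Y φ) (f.apply_symm_apply x))

variable (𝒟 X) in
/-- The canonical homomorphism to the double dual. -/
def dualEval : X →ₗ[𝒟.Alg K] 𝒟.Dual K (𝒟.Dual K X) where
  toFun x := Module.Dual.eval K X x ∘ₗ 𝒟.ev X
  map_add' x y := 𝒟.dual_ext fun φ => map_add (𝒟.ev X φ) x y
  map_smul' a x := 𝒟.dual_ext fun φ => by
    change 𝒟.ev X φ (a • x) = 𝒟.ev X ((𝒟.anti K a).unop • φ) x
    rw [ev_smul, anti_anti]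

variable (𝒟 X) in
theorem dualEval_bijective [Module.Finite K X] : Function.Bijective (dualEval 𝒟 (K := K) X) :=
  (Module.evalEquiv K X).bijective

end DualFunctor

/-! ### Recognizing the dual of Π e_i / I_w e_i -/

section Cyclic

variable {ι : Type w} {𝒟 : CartanDatum ι} [Fintype ι] [DecidableEq ι] {K : Type u} [Field K]
variable {V : Type*} [AddCommGroup V] [Module K V] [Module (𝒟.Alg K) V] [IsScalarTower K (𝒟.Alg K) V]
  [Module.Finite K V]

/-- A linear form without submodules in its kernel generates the dual. -/
theorem exists_smul_eq_of_dual {t : 𝒟.Dual K V}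
    (ht : ∀ v, (∀ a : 𝒟.Alg K, 𝒟.ev V t (a • v) = 0) → v = 0) (φ : 𝒟.Dual K V) :
    ∃ a : 𝒟.Alg K, a • t = φ := by
  let W : Subspace K (Module.Dual K V) := (Submodule.span (𝒟.Alg K) {t}).restrictScalars K
  have hW : W.dualCoannihilator = ⊥ := by
    rw [eq_bot_iff]
    intro v hv
    rw [Submodule.mem_dualCoannihilator] at hv
    refine ht v fun a => ?_
    have h := hv ((𝒟.anti K a).unop • t) (Submodule.smul_mem _ _ (Submodule.mem_span_singleton_self t))
    have h1 : 𝒟.ev V ((𝒟.anti K a).unop • t) v = 0 := h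
    rwa [ev_smul, anti_anti] at h1
  have h := Subspace.dualCoannihilator_dualAnnihilator_eq (W := W)
  rw [hW, Submodule.dualAnnihilator_bot] at h
  have h1 : 𝒟.ev V φ ∈ W := h.le Submodule.mem_top
  exact Submodule.mem_span_singleton.1 h1

/-- A module with the dimensions of `Π e_i / I_w e_i` whose dual is generated by a form concentrated
at `i` is the dual of `Π e_i / I_w e_i`. -/
theorem nonempty_equiv_dual_QP {i : ι} {l : List ι} (hl : 𝒟.IsReduced l)
    (hdim : ∀ k, (Module.finrank K (𝒟.vertexSpace K V k) : ℤ) = 𝒟.c k * 𝒟.rvec i l k)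
    {t : 𝒟.Dual K V} (het : 𝒟.e K i • t = t)
    (ht : ∀ v, (∀ a : 𝒟.Alg K, 𝒟.ev V t (a • v) = 0) → v = 0) :
    Nonempty (V ≃ₗ[𝒟.Alg K] 𝒟.Dual K (𝒟.QP K i l)) := by
  have : Module.Finite K (𝒟.Dual K V) := inferInstanceAs (Module.Finite K (Module.Dual K V))
  have hext := 𝒟.isExtremal_of_isReduced (K := K) i hl
  have := hext.finite
  have hgen := exists_smul_eq_of_dual ht
  have hdim' : ∀ k, (Module.finrank K (𝒟.vertexSpace K (𝒟.Dual K V) k) : ℤ) =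
      𝒟.c k * 𝒟.rvec i l k := fun k => by rw [finrank_vertexSpace_dual, hdim]
  -- With defect z = 0 the extremality argument says that I_w kills t. So Π e_i / I_w e_i maps onto
  -- the dual of V, and equality of dimensions at each vertex makes this an isomorphism.
  obtain ⟨-, hann⟩ := 𝒟.extremal_cyclic hl (𝒟.Dual K V) het hgen 0 (by rw [map_zero]) (by
    rw [sub_zero]
    funext k
    have h1 : (𝒟.scale k : ℤ) * 𝒟.c k = ∏ k, (𝒟.c k : ℤ) := by exact_mod_cast 𝒟.scale_mul_c k
    rw [dimVec, hdim', ← mul_assoc, h1]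
    rfl)
  let π : 𝒟.QP K i l →ₗ[𝒟.Alg K] 𝒟.Dual K V := (𝒟.subP K i l).liftQ
    ((LinearMap.toSpanSingleton (𝒟.Alg K) _ t).comp (𝒟.P K i).subtype) fun p hp => hann p hp
  have hsurj : Function.Surjective π := by
    intro φ
    obtain ⟨a, rfl⟩ := hgen φ
    refine ⟨Submodule.Quotient.mk (a • 𝒟.genP K i), ?_⟩
    change (a * 𝒟.e K i) • t = a • t
    rw [mul_smul, het]
  have hinj : Function.Injective π := by
    rw [← LinearMap.ker_eq_bot, eq_bot_iff]
    intro x hx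
    have h1 : ∀ k, 𝒟.e K k • x = 0 := by
      intro k
      have h2 : Function.Injective (𝒟.vertexMap K π k) := by
        rw [LinearMap.injective_iff_surjective_of_finrank_eq_finrank]
        · exact 𝒟.vertexMap_surjective K hsurj k
        · have := hext.rank k
          rw [← hdim'] at this
          exact_mod_cast this
      have h3 := @h2 ⟨𝒟.e K k • x, (𝒟.mem_vertexSpace K).2 (e_smul_e_smul k x)⟩ 0 (by
        apply Subtype.ext
        rw [coe_vertexMap, map_smul, LinearMap.mem_ker.1 hx, smul_zero, map_zero]
        rfl)
      exact congrArg Subtype.val h3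
    rw [Submodule.mem_bot, ← sum_e_smul (𝒟 := 𝒟) (K := K) x, Finset.sum_eq_zero fun k _ => h1 k]
  exact ⟨LinearEquiv.ofBijective _ (dualEval_bijective 𝒟 V) ≪≫ₗ
    dualEquiv (LinearEquiv.ofBijective π ⟨hinj, hsurj⟩)⟩

end Cyclic

/-! ### The linear form defined by a stable framed module -/

section Stable

variable {ι : Type w} {𝒟 : CartanDatum ι} [Fintype ι] [DecidableEq ι] {K : Type u} [Field K]

theorem unframe_e_inr (k : ι) : 𝒟.unframe K (𝒟.framed.e K (.inr k)) = 0 := lift_e K _ _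

theorem framed_ε_pow_mul_α (i : ι) (n : ℕ) :
    𝒟.framed.ε K (.inr i) ^ n * 𝒟.framed.α K (.inr i) (.inl i) 0 =
      𝒟.framed.α K (.inr i) (.inl i) 0 * 𝒟.framed.ε K (.inl i) ^ n := by
  have hf1 : 𝒟.framed.f (.inl i) (.inr i) = 1 := by
    simp [CartanDatum.f, CartanDatum.g, framed]
  have hf2 : 𝒟.framed.f (.inr i) (.inl i) = 1 := by
    simp [CartanDatum.f, CartanDatum.g, framed]
  have h := (𝒟.framed.relations K).p2 (.inr i) (.inl i) 0
    (by simp [IsArrow, CartanDatum.g, framed])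
  rw [hf1, hf2, pow_one, pow_one] at h
  have h1 : SemiconjBy (𝒟.framed.α K (.inr i) (.inl i) 0) (𝒟.framed.ε K (.inl i))
    (𝒟.framed.ε K (.inr i)) := h.symm
  exact (h1.pow_right n).symm

theorem framed_α_inr_inl_eq_zero {i m : ι} {g : ℕ} (h : ¬ (m = i ∧ g = 0)) :
    𝒟.framed.α K (.inr i) (.inl m) g = 0 := by
  refine (𝒟.framed.relations K).α_eq_zero _ _ _ fun h1 => h ?_
  obtain ⟨h1, h2⟩ := h1
  have h3 : m = i := by
    by_contra h3
    simp [framed, Ne.symm h3] at h1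
  subst h3
  refine ⟨rfl, ?_⟩
  simpa [CartanDatum.g, framed] using h2

variable {V : Type*} [AddCommGroup V] [Module K V] [Module (𝒟.Alg K) V] [IsScalarTower K (𝒟.Alg K) V]
variable {N : Type*} [AddCommGroup N] [Module K N] [Module (𝒟.framed.Alg K) N]
  [IsScalarTower K (𝒟.framed.Alg K) N]
variable {N₀ : Type*} [AddCommGroup N₀] [Module K N₀] [Module (𝒟.framed.Alg K) N₀]
  [IsScalarTower K (𝒟.framed.Alg K) N₀]
variable {i : ι} {l : List ι} (hN : 𝒟.IsStableOfWeight K l (Pi.single i 1) N)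
  (hN₀ : 𝒟.IsStableOfWeight K [] (Pi.single i 1) N₀)
  {f : N₀ →ₗ[𝒟.framed.Alg K] N} {p : N →ₛₗ[(𝒟.unframe K).toRingHom] V}
  (hex : Function.Exact f p) (hp : Function.Surjective p)

include hN₀ in
theorem e_inl_smul_eq_zero (k : ι) (y : N₀) : 𝒟.framed.e K (.inl k) • y = 0 := by
  obtain ⟨-, -, ν, hr, hw⟩ := hN₀
  rw [weight_eq] at hw
  have hν : ν k = 0 := by
    have := congrFun (congrArg Prod.fst hw) k
    simp only [rvec, Pi.zero_apply] at this
    exact_mod_cast this.symm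
  have hfin := hr.finite_vertexSpace (.inl k)
  have h := hr.finrank_eq (.inl k)
  rw [Sum.elim_inl, hν, mul_zero, Module.finrank_zero_iff] at h
  exact congrArg Subtype.val (Subsingleton.elim (⟨_, (𝒟.framed.mem_vertexSpace K).2
    (e_smul_e_smul (Sum.inl k) y)⟩ : 𝒟.framed.vertexSpace K N₀ (.inl k)) 0)

include hN in
theorem e_inr_smul_eq_zero {k : ι} (hk : k ≠ i) (y : N) : 𝒟.framed.e K (.inr k) • y = 0 := by
  obtain ⟨-, -, ν, hr, -⟩ := hN
  have hfin := hr.finite_vertexSpace (.inr k)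
  have h := hr.finrank_eq (.inr k)
  rw [Sum.elim_inr, Pi.single_eq_of_ne hk, mul_zero, Module.finrank_zero_iff] at h
  exact congrArg Subtype.val (Subsingleton.elim (⟨_, (𝒟.framed.mem_vertexSpace K).2
    (e_smul_e_smul (Sum.inr k) y)⟩ : 𝒟.framed.vertexSpace K N (.inr k)) 0)

theorem map_framed_smul (p : N →ₛₗ[(𝒟.unframe K).toRingHom] V) (a : 𝒟.framed.Alg K) (n : N) :
    p (a • n) = 𝒟.unframe K a • p n := map_smulₛₗ p a n

/-- The underlying linear map of a homomorphism to a `Π`-module. -/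
def toLinOfFramed (p : N →ₛₗ[(𝒟.unframe K).toRingHom] V) : N →ₗ[K] V where
  toFun := p
  map_add' := map_add p
  map_smul' k n := by
    rw [← algebraMap_smul (𝒟.framed.Alg K) k n, map_framed_smul, AlgHom.commutes, algebraMap_smul,
      RingHom.id_apply]

include hN₀ hex hp in
/-- At the unprimed vertices, `N` and `N / N₀` agree. -/
theorem finrank_vertexSpace_of_framed (k : ι) :
    Module.finrank K (𝒟.framed.vertexSpace K N (.inl k)) =
      Module.finrank K (𝒟.vertexSpace K V k) := by
  let q : 𝒟.framed.vertexSpace K N (.inl k) →ₗ[K] 𝒟.vertexSpace K V k :=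
    (toLinOfFramed p).restrict fun x hx => by
      rw [mem_vertexSpace] at hx ⊢
      change 𝒟.e K k • p x = p x
      rw [← FramingMap.unframe_e_inl, ← map_framed_smul, hx]
  refine (LinearEquiv.ofBijective q ⟨?_, ?_⟩).finrank_eq
  · rw [← LinearMap.ker_eq_bot, eq_bot_iff]
    rintro ⟨n, hn⟩ h
    have h1 : p n = 0 := congrArg Subtype.val (LinearMap.mem_ker.1 h)
    obtain ⟨y, rfl⟩ := (hex n).1 h1
    rw [mem_vertexSpace, ← map_smul, e_inl_smul_eq_zero hN₀, map_zero] at hn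
    exact Subtype.ext hn.symm
  · rintro ⟨v, hv⟩
    obtain ⟨n, rfl⟩ := hp v
    refine ⟨⟨𝒟.framed.e K (.inl k) • n, (𝒟.framed.mem_vertexSpace K).2 (e_smul_e_smul _ n)⟩,
      Subtype.ext ?_⟩
    change p (𝒟.framed.e K (.inl k) • n) = p n
    rw [map_framed_smul, FramingMap.unframe_e_inl, (𝒟.mem_vertexSpace K).1 hv]

include hN hN₀ hex hp in
-- The form is the framing arrow i → i' followed by a form τ on e_{i'} N without H_i-submodules in
-- its kernel. Elements of N with no primed component on whose image it vanishes under all of Π form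
-- a submodule of N. Its socle would lie at unprimed vertices, where stability forbids it, so the
-- submodule is zero.
theorem exists_dual_of_framed : ∃ t : 𝒟.Dual K V, 𝒟.e K i • t = t ∧
    ∀ v, (∀ a : 𝒟.Alg K, 𝒟.ev V t (a • v) = 0) → v = 0 := by
  have hinr := fun k (hk : k ≠ i) => e_inr_smul_eq_zero hN hk
  obtain ⟨hE, hsub, ν, hr, -⟩ := hN
  obtain ⟨τ, hτ⟩ := hr.exists_dual (k := .inr i) (by simp)
  have hfin : Module.Finite K N :=
    finite_of_vertexSpace (𝒟 := 𝒟.framed) fun k => hr.finite_vertexSpace k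
  have : IsArtinian (𝒟.framed.Alg K) N := isArtinian_of_tower K inferInstance
  set A := 𝒟.framed.α K (.inr i) (.inl i) 0 with hA
  let T : N →ₗ[K] K := τ ∘ₗ (Algebra.lsmul K K N A).codRestrict _ fun n =>
    (𝒟.framed.mem_vertexSpace K).2 (e_smul_α_smul (Sum.inr i) (Sum.inl i) 0 n)
  have hT : ∀ n, T n = τ ⟨A • n, (𝒟.framed.mem_vertexSpace K).2
    (e_smul_α_smul (Sum.inr i) (Sum.inl i) 0 n)⟩ := fun _ => rfl
  obtain ⟨t, ht⟩ : ∃ t : 𝒟.Dual K V, ∀ n, 𝒟.ev V t (p n) = T n := by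
    -- The form T descends to V because N₀ has no component at i, where the arrow starts.
    have hmem : T ∈ LinearMap.range (toLinOfFramed p).dualMap := by
      rw [LinearMap.range_dualMap_eq_dualAnnihilator_ker, Submodule.mem_dualAnnihilator]
      intro n hn
      obtain ⟨y, rfl⟩ := (hex n).1 hn
      have h1 : A • f y = 0 := by
        rw [← map_smul, hA, ← α_smul_e_smul, e_inl_smul_eq_zero hN₀, smul_zero, map_zero]
      rw [hT]
      exact (congrArg τ (Subtype.ext h1)).trans (map_zero τ)
    obtain ⟨t, ht⟩ := hmem
    exact ⟨t, LinearMap.congr_fun ht⟩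
  refine ⟨t, 𝒟.dual_ext fun v => ?_, fun v hv => ?_⟩
  · obtain ⟨n, rfl⟩ := hp v
    rw [ev_e_smul, ← FramingMap.unframe_e_inl, ← map_framed_smul, ht, ht, hT, hT]
    exact congrArg τ (Subtype.ext (α_smul_e_smul _ _ _ n))
  -- Once stable under the framed algebra, W is a submodule without primed components.
  let W : Submodule K N :=
    { carrier := {n | (∀ k, 𝒟.framed.e K (.inr k) • n = 0) ∧ ∀ b : 𝒟.Alg K, 𝒟.ev V t (b • p n) = 0}
      zero_mem' := ⟨fun k => smul_zero _, fun b => by rw [map_zero, smul_zero, map_zero]⟩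
      add_mem' := fun {m n} hm hn => ⟨fun k => by rw [smul_add, hm.1, hn.1, add_zero], fun b => by
        rw [map_add, smul_add, map_add, hm.2, hn.2, add_zero]⟩
      smul_mem' := fun c n hn => ⟨fun k => by rw [smul_comm, hn.1, smul_zero], fun b => by
        have h1 : p (c • n) = c • p n := map_smul (toLinOfFramed p) c n
        rw [h1, smul_comm, map_smul, hn.2, smul_zero]⟩ }
  have hsnd : ∀ (x : 𝒟.framed.Alg K), ∀ n ∈ W, ∀ b : 𝒟.Alg K, 𝒟.ev V t (b • p (x • n)) = 0 := by
    intro x n hn b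
    rw [map_framed_smul, ← mul_smul]
    exact hn.2 _
  have hstable : ∀ a : 𝒟.framed.Alg K, ∀ n ∈ W, a • n ∈ W := by
    refine smul_mem_of_generators ?_ ?_ ?_
    · intro y n hn
      refine ⟨fun k => ?_, hsnd _ n hn⟩
      rcases y with j | j
      · exact e_smul_e_smul_of_ne Sum.inr_ne_inl n
      · rw [hn.1, smul_zero]
    · intro y n hn
      refine ⟨fun k => ?_, hsnd _ n hn⟩
      rcases y with j | j
      · exact e_smul_ε_smul_of_ne Sum.inr_ne_inl n
      · rw [← ε_smul_e_smul, hn.1, smul_zero, smul_zero]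
    · intro y z g n hn
      refine ⟨fun k => ?_, hsnd _ n hn⟩
      rcases z with m | m
      · rcases y with j | j
        · exact e_smul_α_smul_of_ne Sum.inr_ne_inl _ g n
        by_cases hkj : k = j
        · subst hkj
          by_cases hki : k = i
          · subst hki
            by_cases hm : m = k ∧ g = 0
            · obtain ⟨rfl, rfl⟩ := hm
              -- The values τ(ε^s A n) = τ(A ε^s n) are values of the form on the Π-submodule
              -- generated by p n, hence all zero. The choice of τ then gives A n = 0.
              have h1 := hτ ⟨A • n, (𝒟.framed.mem_vertexSpace K).2
                (e_smul_α_smul (Sum.inr m) (Sum.inl m) 0 n)⟩ fun s => by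
                  have h2 : 𝒟.framed.ε K (.inr m) ^ s • A • n =
                      A • 𝒟.framed.ε K (.inl m) ^ s • n := by
                    rw [← mul_smul, framed_ε_pow_mul_α, mul_smul]
                  have h3 := ht (𝒟.framed.ε K (.inl m) ^ s • n)
                  rw [map_framed_smul, hn.2, hT] at h3
                  rw [h3]
                  congr 1
                  apply Subtype.ext
                  rw [coe_epsOn_pow]
                  exact h2
              have h2 : A • n = 0 := congrArg Subtype.val h1
              rw [h2, smul_zero]
            · rw [framed_α_inr_inl_eq_zero hm, zero_smul, smul_zero]
          · exact hinr k hki _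
        · exact e_smul_α_smul_of_ne (fun h => hkj (Sum.inr_injective h)) _ g n
      · rw [← α_smul_e_smul, hn.1, smul_zero, smul_zero]
  let G : Submodule (𝒟.framed.Alg K) N := { W with smul_mem' := fun a n hn => hstable a n hn }
  have hG : G = ⊥ := by
    by_contra hG
    obtain ⟨x, hx, hx0, j, hj⟩ := hE.exists_socle hG
    rcases j with j | j
    · exact hx0 (𝒟.framed.sub_eq_bot_iff.1 (hsub j) x hj)
    · have h1 := hj (𝒟.framed.e K (.inr j))
      rw [toS_e_self, one_smul] at h1
      exact hx0 (h1.symm.trans (hx.1 j))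
  obtain ⟨n, rfl⟩ := hp v
  have h1 := sum_e_smul (𝒟 := 𝒟.framed) (K := K) n
  rw [Fintype.sum_sum_type] at h1
  have h2 : p n = p (∑ k, 𝒟.framed.e K (.inl k) • n) := by
    conv_lhs => rw [← h1]
    rw [map_add, map_sum p (fun k => 𝒟.framed.e K (.inr k) • n),
      Finset.sum_eq_zero (f := fun k => p (𝒟.framed.e K (.inr k) • n)), add_zero]
    intro k _
    rw [map_framed_smul, unframe_e_inr, zero_smul]
  have h3 : ∑ k, 𝒟.framed.e K (.inl k) • n ∈ G := by
    refine ⟨fun k => ?_, fun b => by rw [← h2]; exact hv b⟩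
    rw [Finset.smul_sum]
    exact Finset.sum_eq_zero fun m _ => e_smul_e_smul_of_ne Sum.inr_ne_inl n
  rw [hG, Submodule.mem_bot] at h3
  rw [h2, h3, map_zero]

end Stable

variable {ι : Type w} {𝒟 : CartanDatum ι} [Fintype ι] [DecidableEq ι] {K : Type u} [Field K]

/-- The uniqueness of `N(w λ)`, for `λ = -ϖ_i`. -/
theorem IsN.nonempty_equiv_dual_QP {i : ι} {l : List ι} (hl : 𝒟.IsReduced l) {V : Type v}
    [AddCommGroup V] [Module (𝒟.Alg K) V] (h : 𝒟.IsN K l (Pi.single i 1) V) :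
    Nonempty (V ≃ₗ[𝒟.Alg K] 𝒟.Dual K (𝒟.QP K i l)) := by
  let _ : Module K V := Module.compHom V (algebraMap K (𝒟.Alg K))
  have : IsScalarTower K (𝒟.Alg K) V := ⟨fun k a v => by
    rw [Algebra.smul_def, mul_smul]
    rfl⟩
  obtain ⟨N, _, _, _, _, N₀, _, _, _, _, f, p, hN, hN₀, -, hex, hp⟩ := h
  obtain ⟨t, ht, ht'⟩ := exists_dual_of_framed hN hN₀ hex hp
  obtain ⟨-, -, ν, hr, hw⟩ := hN
  have hfin : Module.Finite K N :=
    finite_of_vertexSpace (𝒟 := 𝒟.framed) fun k => hr.finite_vertexSpace k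
  have : Module.Finite K V := Module.Finite.of_surjective (toLinOfFramed p) hp
  refine CartanDatum.nonempty_equiv_dual_QP hl (fun k => ?_) ht ht'
  rw [weight_eq] at hw
  have hw' : 𝒟.rvec i l = fun k => (ν k : ℤ) := congrArg Prod.fst hw
  rw [← finrank_vertexSpace_of_framed hN₀ hex hp, hr.finrank_eq, hw']
  push_cast
  rfl

end GPA.CartanDatum

namespace GPA.CartanDatum

/-! ### The tensor products with Π e_i and with E_i -/

section Tensor

variable {ι : Type w} (𝒟 : CartanDatum ι) [Fintype ι] (K : Type u) [Field K]

theorem balancedTensor_rel {M : Type*} [AddCommGroup M] [Module K M] [Module (𝒟.Alg K) M]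
    [IsScalarTower K (𝒟.Alg K) M] [Module (𝒟.Alg K)ᵐᵒᵖ M] {N : Type*} [AddCommGroup N] [Module K N]
    [Module (𝒟.Alg K) N] (m : M) (a : 𝒟.Alg K) (n : N) :
    (Submodule.Quotient.mk ((MulOpposite.op a • m) ⊗ₜ[K] n) :
      BalancedTensor K (𝒟.Alg K) M N) = Submodule.Quotient.mk (m ⊗ₜ[K] (a • n)) :=
  (Submodule.Quotient.eq _).2 (Submodule.subset_span ⟨m, a, n, rfl⟩)

/-- `(Π / I_w) ⊗ Π e_i → Π e_i / I_w e_i`. -/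
def tensorPToQP (i : ι) (l : List ι) :
    BalancedTensor K (𝒟.Alg K) (𝒟.Alg K ⧸ 𝒟.I K l) (𝒟.P K i) →ₗ[𝒟.Alg K] 𝒟.QP K i l :=
  Submodule.liftQ _ (TensorProduct.AlgebraTensorModule.lift
    ((𝒟.I K l).liftQ (LinearMap.toSpanSingleton (𝒟.Alg K) (𝒟.P K i →ₗ[K] 𝒟.QP K i l)
      ((𝒟.subP K i l).mkQ.restrictScalars K)) (by
        intro a ha
        rw [LinearMap.mem_ker, LinearMap.toSpanSingleton_apply]
        ext p
        change a • Submodule.Quotient.mk p = (0 : 𝒟.QP K i l)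
        rw [← Submodule.Quotient.mk_smul, Submodule.Quotient.mk_eq_zero]
        exact Ideal.mul_mem_right _ _ ha))) (by
    rw [Submodule.span_le]
    rintro _ ⟨m, a, n, rfl⟩
    obtain ⟨b, rfl⟩ := Submodule.Quotient.mk_surjective _ m
    rw [SetLike.mem_coe, LinearMap.mem_ker, map_sub, sub_eq_zero]
    change (b * a) • (Submodule.Quotient.mk n : 𝒟.QP K i l) = b • Submodule.Quotient.mk (a • n)
    rw [mul_smul]
    rfl)

theorem tensorPToQP_mk (i : ι) (l : List ι) (a : 𝒟.Alg K) (p : 𝒟.P K i) :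
    𝒟.tensorPToQP K i l (Submodule.Quotient.mk ((Submodule.Quotient.mk a) ⊗ₜ[K] p)) =
      a • Submodule.Quotient.mk p := rfl

theorem mk_tmul_eq (i : ι) (l : List ι) (a : 𝒟.Alg K) (p : 𝒟.P K i) :
    (Submodule.Quotient.mk ((Submodule.Quotient.mk 1) ⊗ₜ[K] (a • p)) :
      BalancedTensor K (𝒟.Alg K) (𝒟.Alg K ⧸ 𝒟.I K l) (𝒟.P K i)) =
      Submodule.Quotient.mk ((Submodule.Quotient.mk a) ⊗ₜ[K] p) := by
  rw [← balancedTensor_rel]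
  congr 2
  change (Submodule.Quotient.mk (1 * a) : 𝒟.Alg K ⧸ 𝒟.I K l) = _
  rw [one_mul]

/-- `Π e_i / I_w e_i → (Π / I_w) ⊗ Π e_i`. -/
def QPToTensorP (i : ι) (l : List ι) :
    𝒟.QP K i l →ₗ[𝒟.Alg K] BalancedTensor K (𝒟.Alg K) (𝒟.Alg K ⧸ 𝒟.I K l) (𝒟.P K i) :=
  (𝒟.subP K i l).liftQ
    { toFun := fun p => Submodule.Quotient.mk ((Submodule.Quotient.mk 1) ⊗ₜ[K] p)
      map_add' := fun p q => by rw [TensorProduct.tmul_add, Submodule.Quotient.mk_add]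
      map_smul' := fun a p => by
        rw [mk_tmul_eq, RingHom.id_apply, ← Submodule.Quotient.mk_smul, TensorProduct.smul_tmul',
          ← Submodule.Quotient.mk_smul, smul_eq_mul, mul_one] } (by
    intro p hp
    rw [LinearMap.mem_ker]
    change Submodule.Quotient.mk ((Submodule.Quotient.mk 1) ⊗ₜ[K] p) = _
    have h0 : (Submodule.Quotient.mk (p : 𝒟.Alg K) : 𝒟.Alg K ⧸ 𝒟.I K l) = 0 :=
      (Submodule.Quotient.mk_eq_zero _).2 hp
    rw [← 𝒟.smul_genP i p, mk_tmul_eq, h0, TensorProduct.zero_tmul, Submodule.Quotient.mk_zero])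

theorem QPToTensorP_mk (i : ι) (l : List ι) (p : 𝒟.P K i) :
    𝒟.QPToTensorP K i l (Submodule.Quotient.mk p) =
      Submodule.Quotient.mk ((Submodule.Quotient.mk 1) ⊗ₜ[K] p) := rfl

/-- `(Π / I_w) ⊗ Π e_i ≅ Π e_i / I_w e_i`. -/
def tensorPEquiv (i : ι) (l : List ι) :
    BalancedTensor K (𝒟.Alg K) (𝒟.Alg K ⧸ 𝒟.I K l) (𝒟.P K i) ≃ₗ[𝒟.Alg K] 𝒟.QP K i l :=
  LinearEquiv.ofLinearMap (𝒟.tensorPToQP K i l) (𝒟.QPToTensorP K i l)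
    (by
      refine LinearMap.ext fun x => ?_
      obtain ⟨p, rfl⟩ := Submodule.Quotient.mk_surjective _ x
      rw [LinearMap.comp_apply, QPToTensorP_mk, tensorPToQP_mk, one_smul, LinearMap.id_apply])
    (by
      refine LinearMap.ext fun x => ?_
      obtain ⟨z, rfl⟩ := Submodule.Quotient.mk_surjective _ x
      rw [LinearMap.id_apply]
      induction z using TensorProduct.induction_on with
      | zero => rw [Submodule.Quotient.mk_zero, map_zero]
      | add x y hx hy => rw [Submodule.Quotient.mk_add, map_add, hx, hy]
      | tmul m p =>
        obtain ⟨a, rfl⟩ := Submodule.Quotient.mk_surjective _ m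
        rw [LinearMap.comp_apply, tensorPToQP_mk, ← Submodule.Quotient.mk_smul, QPToTensorP_mk,
          mk_tmul_eq])

variable (J : Ideal (𝒟.Alg K)) [J.IsTwoSided] (i : ι)

/-- The submodule `J I_i` of a two-sided ideal `J`. -/
abbrev mulIdem : Submodule (𝒟.Alg K) J := (J * 𝒟.idemIdeal K i).submoduleOf J

/-- Right multiplication by elements of `H_i`. -/
def mulVertexHom : J →ₗ[𝒟.Alg K] 𝒟.E K i →ₗ[K] J ⧸ 𝒟.mulIdem K J i where
  toFun x :=
    { toFun := fun h => Submodule.Quotient.mk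
        ⟨x * 𝒟.vertexHom K i (show TruncPoly K (𝒟.c i) from h), J.mul_mem_right _ x.2⟩
      map_add' := fun h h' => by
        rw [← Submodule.Quotient.mk_add]
        congr 1
        exact Subtype.ext ((congrArg (x.1 * ·) (map_add (𝒟.vertexHom K i) _ _)).trans
          (mul_add _ _ _))
      map_smul' := fun k h => by
        rw [RingHom.id_apply, ← Submodule.Quotient.mk_smul]
        congr 1
        exact Subtype.ext ((congrArg (x.1 * ·) (map_smul (𝒟.vertexHom K i) _ _)).trans
          (mul_smul_comm _ _ _)) }
  map_add' x y := by
    refine LinearMap.ext fun h => ?_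
    rw [LinearMap.add_apply]
    change Submodule.Quotient.mk _ = Submodule.Quotient.mk _ + Submodule.Quotient.mk _
    rw [← Submodule.Quotient.mk_add]
    congr 1
    exact Subtype.ext (add_mul _ _ _)
  map_smul' a x := by
    refine LinearMap.ext fun h => ?_
    rw [RingHom.id_apply, LinearMap.smul_apply]
    change Submodule.Quotient.mk _ = a • Submodule.Quotient.mk _
    rw [← Submodule.Quotient.mk_smul]
    congr 1
    exact Subtype.ext (mul_assoc _ _ _)

theorem mulVertexHom_apply (x : J) (h : TruncPoly K (𝒟.c i)) : 𝒟.mulVertexHom K J i x h =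
    Submodule.Quotient.mk ⟨x * 𝒟.vertexHom K i h, J.mul_mem_right _ x.2⟩ := rfl

/-- `J ⊗ E_i → J / J I_i`. -/
def tensorEToQuot : BalancedTensor K (𝒟.Alg K) J (𝒟.E K i) →ₗ[𝒟.Alg K] J ⧸ 𝒟.mulIdem K J i :=
  Submodule.liftQ _ (TensorProduct.AlgebraTensorModule.lift (𝒟.mulVertexHom K J i)) (by
    rw [Submodule.span_le]
    rintro _ ⟨x, a, (h : TruncPoly K (𝒟.c i)), rfl⟩
    rw [SetLike.mem_coe, LinearMap.mem_ker, map_sub, sub_eq_zero]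
    change 𝒟.mulVertexHom K J i (MulOpposite.op a • x) h =
      𝒟.mulVertexHom K J i x (𝒟.toE K i a * h : TruncPoly K (𝒟.c i))
    rw [mulVertexHom_apply, mulVertexHom_apply, Submodule.Quotient.eq]
    change (x.1 * a) * 𝒟.vertexHom K i h - x.1 * 𝒟.vertexHom K i (𝒟.toE K i a * h) ∈
      J * 𝒟.idemIdeal K i
    -- An element a acts on E_i through its value in H_i, from which it differs by an element of
    -- I_i.
    rw [map_mul, mul_assoc, ← mul_sub, ← sub_mul]
    exact Ideal.mul_mem_mul x.2 (Ideal.mul_mem_right _ _ (𝒟.sub_vertexHom_toE_mem K i a)))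

theorem tensorEToQuot_mk (x : J) (h : TruncPoly K (𝒟.c i)) :
    𝒟.tensorEToQuot K J i (Submodule.Quotient.mk (x ⊗ₜ[K] (show 𝒟.E K i from h))) =
      Submodule.Quotient.mk ⟨x * 𝒟.vertexHom K i h, J.mul_mem_right _ x.2⟩ := rfl

/-- The generator of `E_i`. -/
def genE : 𝒟.E K i := (1 : TruncPoly K (𝒟.c i))

theorem mk_tmul_genE (x : J) (b : 𝒟.Alg K) :
    (Submodule.Quotient.mk ((⟨x * b, J.mul_mem_right _ x.2⟩ : J) ⊗ₜ[K] 𝒟.genE K i) :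
      BalancedTensor K (𝒟.Alg K) J (𝒟.E K i)) = Submodule.Quotient.mk (x ⊗ₜ[K] (b • 𝒟.genE K i)) :=
  𝒟.balancedTensor_rel K x b (𝒟.genE K i)

theorem smul_genE (b : 𝒟.Alg K) : b • 𝒟.genE K i = 𝒟.toE K i b := mul_one (𝒟.toE K i b)

/-- `x ↦ x ⊗ 1`. -/
def toTensorE : J →ₗ[𝒟.Alg K] BalancedTensor K (𝒟.Alg K) J (𝒟.E K i) where
  toFun x := Submodule.Quotient.mk (x ⊗ₜ[K] 𝒟.genE K i)
  map_add' x y := by rw [TensorProduct.add_tmul, Submodule.Quotient.mk_add]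
  map_smul' a x := by
    rw [RingHom.id_apply, ← Submodule.Quotient.mk_smul, TensorProduct.smul_tmul']

theorem toTensorE_eq_zero {x : J} (hx : x ∈ 𝒟.mulIdem K J i) : 𝒟.toTensorE K J i x = 0 := by
  obtain ⟨x, hxJ⟩ := x
  have hx' : x ∈ J * 𝒟.idemIdeal K i := hx
  clear hx
  induction hx' using Submodule.mul_induction_on' with
  | mem_mul_mem a ha b hb =>
    refine (𝒟.mk_tmul_genE K J i ⟨a, ha⟩ b).trans ?_
    rw [smul_genE, (𝒟.mem_idemIdeal_iff K).1 hb]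
    exact (congrArg _ (TensorProduct.tmul_zero (𝒟.E K i) (⟨a, ha⟩ : J))).trans
      (Submodule.Quotient.mk_zero _)
  | add a ha b hb iha ihb =>
    have ha' : a ∈ J := Ideal.mul_le.2 (fun r hr s _ => J.mul_mem_right s hr) ha
    have hb' : b ∈ J := Ideal.mul_le.2 (fun r hr s _ => J.mul_mem_right s hr) hb
    have h : (⟨a + b, hxJ⟩ : J) = ⟨a, ha'⟩ + ⟨b, hb'⟩ := rfl
    rw [h, map_add, iha, ihb, add_zero]

/-- `J ⊗ E_i ≅ J / J I_i`. -/
def tensorEEquiv : BalancedTensor K (𝒟.Alg K) J (𝒟.E K i) ≃ₗ[𝒟.Alg K] J ⧸ 𝒟.mulIdem K J i :=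
  LinearEquiv.ofLinearMap (𝒟.tensorEToQuot K J i)
    ((𝒟.mulIdem K J i).liftQ (𝒟.toTensorE K J i) fun _ hx => 𝒟.toTensorE_eq_zero K J i hx)
    (by
      refine LinearMap.ext fun x => ?_
      obtain ⟨x, rfl⟩ := Submodule.Quotient.mk_surjective _ x
      refine (𝒟.tensorEToQuot_mk K J i x 1).trans ?_
      rw [LinearMap.id_apply]
      congr 1
      apply Subtype.ext
      change x.1 * 𝒟.vertexHom K i 1 = x
      rw [map_one, mul_one])
    (by
      refine LinearMap.ext fun x => ?_
      obtain ⟨z, rfl⟩ := Submodule.Quotient.mk_surjective _ x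
      rw [LinearMap.id_apply]
      induction z using TensorProduct.induction_on with
      | zero => rw [Submodule.Quotient.mk_zero, map_zero]
      | add x y hx hy => rw [Submodule.Quotient.mk_add, map_add, hx, hy]
      | tmul x h =>
        refine (𝒟.mk_tmul_genE K J i x (𝒟.vertexHom K i (show TruncPoly K (𝒟.c i) from h))).trans ?_
        rw [smul_genE]
        exact congrArg (fun h' : 𝒟.E K i => Submodule.Quotient.mk (x ⊗ₜ[K] h'))
          (𝒟.toE_vertexHom K i (show TruncPoly K (𝒟.c i) from h)))

end Tensor

/-! ### The layers I_w / I_w I_i -/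

section Layers

variable {ι : Type w} (𝒟 : CartanDatum ι) [Fintype ι] {K : Type u} [Field K]

theorem I_concat (l : List ι) (i : ι) : 𝒟.I K (l ++ [i]) = 𝒟.I K l * 𝒟.idemIdeal K i := by
  have h : 𝒟.I K [i] = 𝒟.idemIdeal K i :=
    le_antisymm (Ideal.mul_le.2 fun a ha b _ => Ideal.mul_mem_right b _ ha) fun a ha => by
      have := Ideal.mul_mem_mul ha (Submodule.mem_top (R := 𝒟.Alg K) (x := 1))
      rwa [mul_one] at this
  rw [I_append, h]

/-- The ideal of a word without the letter i contains e_i. Therefore I_w e_i depends only on the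
part of the word up to the last i, which identifies V_{k⁻} with the module of the prefix of length k
- 1. -/
theorem subP_append (i : ι) {l l' : List ι} (h : i ∉ l') : 𝒟.subP K i (l ++ l') = 𝒟.subP K i l := by
  ext p
  change (p : 𝒟.Alg K) ∈ 𝒟.I K (l ++ l') ↔ (p : 𝒟.Alg K) ∈ 𝒟.I K l
  rw [I_append]
  constructor
  · exact fun hp => Ideal.mul_le.2 (fun a ha b _ => Ideal.mul_mem_right b _ ha) hp
  · intro hp
    rw [← (𝒟.mem_P K).1 p.2]
    exact Ideal.mul_mem_mul hp (𝒟.e_mem_I h)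

/-- `x ↦ x e_i`, from `I_w` to `I_w e_i / I_w I_i e_i`. -/
def IToImP (i : ι) (l : List ι) : 𝒟.I K l →ₗ[𝒟.Alg K] 𝒟.imP K i (l ++ [i]) l where
  toFun a := ⟨Submodule.Quotient.mk ((a : 𝒟.Alg K) • 𝒟.genP K i),
    ⟨(a : 𝒟.Alg K) • 𝒟.genP K i, Ideal.mul_mem_right _ _ a.2, rfl⟩⟩
  map_add' a b := Subtype.ext (congrArg Submodule.Quotient.mk (add_smul a.1 b.1 (𝒟.genP K i)))
  map_smul' a b := Subtype.ext (congrArg Submodule.Quotient.mk (mul_smul a b.1 (𝒟.genP K i)))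

theorem IToImP_surjective (i : ι) (l : List ι) : Function.Surjective (𝒟.IToImP (K := K) i l) := by
  rintro ⟨_, p, hp, rfl⟩
  exact ⟨⟨p, hp⟩, Subtype.ext (congrArg Submodule.Quotient.mk (𝒟.smul_genP i p))⟩

/-- For a in I_w the element a (1 - e_i) always lies in I_w I_i, so a lies there exactly if a e_i
does. -/
theorem ker_IToImP (i : ι) (l : List ι) :
    LinearMap.ker (𝒟.IToImP (K := K) i l) = (𝒟.I K (l ++ [i])).submoduleOf (𝒟.I K l) := by
  ext a
  have h1 : a ∈ LinearMap.ker (𝒟.IToImP (K := K) i l) ↔ (a : 𝒟.Alg K) * 𝒟.e K i ∈ 𝒟.I K (l ++ [i]) :=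
    Subtype.ext_iff.trans (Submodule.Quotient.mk_eq_zero (𝒟.subP K i (l ++ [i])))
  rw [h1]
  change _ ↔ (a : 𝒟.Alg K) ∈ 𝒟.I K (l ++ [i])
  have h2 : (a : 𝒟.Alg K) * (1 - 𝒟.e K i) ∈ 𝒟.I K (l ++ [i]) := by
    rw [I_concat]
    exact Ideal.mul_mem_mul a.2 (𝒟.one_sub_e_mem i)
  have h3 : (a : 𝒟.Alg K) = a * (1 - 𝒟.e K i) + a * 𝒟.e K i := by rw [← mul_add]; simp
  constructor
  · intro h
    rw [h3]
    exact add_mem h2 h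
  · exact fun h => Ideal.mul_mem_right _ _ h

/-- `I_w / I_w I_i ≅ I_w e_i / I_w I_i e_i`. -/
def quotIEquivImP (i : ι) (l : List ι) :
    (𝒟.I K l ⧸ (𝒟.I K (l ++ [i])).submoduleOf (𝒟.I K l)) ≃ₗ[𝒟.Alg K] 𝒟.imP K i (l ++ [i]) l :=
  Submodule.quotEquivOfEq _ _ (𝒟.ker_IToImP i l).symm ≪≫ₗ
    (𝒟.IToImP i l).quotKerEquivOfSurjective (𝒟.IToImP_surjective i l)

/-- `(I_w ⊗ E_i)^* ≅ (I_w / I_w I_i)^*`. -/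
def dualTensorEEquiv (i : ι) (l : List ι) :
    𝒟.Dual K (BalancedTensor K (𝒟.Alg K) (𝒟.I K l) (𝒟.E K i)) ≃ₗ[𝒟.Alg K]
      𝒟.Dual K (𝒟.I K l ⧸ (𝒟.I K (l ++ [i])).submoduleOf (𝒟.I K l)) :=
  dualEquiv (Submodule.quotEquivOfEq _ _ (by rw [I_concat]) ≪≫ₗ (𝒟.tensorEEquiv K (𝒟.I K l) i).symm)

end Layers

/-! ### The image of an embedding of duals -/

section Embedding

variable {ι : Type w} {𝒟 : CartanDatum ι} [Fintype ι] {K : Type u} [Field K]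

theorem dualHom_injective {X Y : Type*} [AddCommGroup X] [Module K X] [Module (𝒟.Alg K) X]
    [IsScalarTower K (𝒟.Alg K) X] [AddCommGroup Y] [Module K Y] [Module (𝒟.Alg K) Y]
    [IsScalarTower K (𝒟.Alg K) Y] {f : X →ₗ[𝒟.Alg K] Y} (hf : Function.Surjective f) :
    Function.Injective (dualHom f) := fun φ ψ h => 𝒟.dual_ext fun y => by
  obtain ⟨x, rfl⟩ := hf y
  rw [← ev_dualHom, h, ev_dualHom]

theorem dualHom_surjective {X Y : Type*} [AddCommGroup X] [Module K X] [Module (𝒟.Alg K) X]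
    [IsScalarTower K (𝒟.Alg K) X] [AddCommGroup Y] [Module K Y] [Module (𝒟.Alg K) Y]
    [IsScalarTower K (𝒟.Alg K) Y] {f : X →ₗ[𝒟.Alg K] Y} (hf : Function.Injective f) :
    Function.Surjective (dualHom f) :=
  LinearMap.dualMap_surjective_of_injective (f := f.restrictScalars K) hf

/-- The image of any embedding of the dual of `Π e_i / I_{w'} e_i` into the dual of
`Π e_i / I_w e_i` consists of the forms vanishing on `I_{w'} e_i / I_w e_i`. -/
theorem range_eq_ker_dualHom {i : ι} {l l' : List ι} (hll : 𝒟.subP K i l ≤ 𝒟.subP K i l')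
    [Module.Finite K (𝒟.QP K i l)]
    {j : 𝒟.Dual K (𝒟.QP K i l') →ₗ[𝒟.Alg K] 𝒟.Dual K (𝒟.QP K i l)} (hj : Function.Injective j) :
    LinearMap.range j = LinearMap.ker (dualHom (K := K) (𝒟.imP K i l l').subtype) := by
  have hfin : Module.Finite K (𝒟.Dual K (𝒟.QP K i l)) :=
    inferInstanceAs (Module.Finite K (Module.Dual K _))
  have hle : LinearMap.range j ≤ LinearMap.ker (dualHom (K := K) (𝒟.imP K i l l').subtype) := by
    rintro _ ⟨φ, rfl⟩
    rw [LinearMap.mem_ker]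
    refine 𝒟.dual_ext ?_
    rintro ⟨_, p, hp, rfl⟩
    -- The value of j φ at p is the value at the generator of j applied to the transposed action of
    -- p on φ. That action is zero because the two-sided ideal of l' kills Π e_i modulo it.
    have h1 : (𝒟.anti K (p : 𝒟.Alg K)).unop • φ = 0 := by
      refine 𝒟.dual_ext fun m => ?_
      obtain ⟨q, rfl⟩ := Submodule.Quotient.mk_surjective _ m
      have h2 : (p : 𝒟.Alg K) • q ∈ 𝒟.subP K i l' := Ideal.mul_mem_right _ _ hp
      rw [ev_smul, anti_anti, ← Submodule.Quotient.mk_smul,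
        (Submodule.Quotient.mk_eq_zero (𝒟.subP K i l')).2 h2, map_zero]
      rfl
    have h2 := congrArg (fun ψ => 𝒟.ev _ (j ψ) (Submodule.Quotient.mk (𝒟.genP K i))) h1
    simp only [map_smul, ev_smul, anti_anti, map_zero] at h2
    rw [← Submodule.Quotient.mk_smul, smul_genP] at h2
    exact h2
  have hsur : Function.Surjective (dualHom (K := K) (𝒟.imP K i l l').subtype) :=
    dualHom_surjective (Submodule.subtype_injective _)
  -- The inclusion of the image is an equality because the annihilator of I_{l'} e_i / I_l e_i has
  -- the dimension of Π e_i / I_{l'} e_i, which j preserves.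
  let g := (dualHom (K := K) (𝒟.imP K i l l').subtype).restrictScalars K
  have hg : LinearMap.range g = ⊤ := LinearMap.range_eq_top.2 hsur
  have hd1 := g.finrank_range_add_finrank_ker
  rw [hg, finrank_top] at hd1
  have hd2 : Module.finrank K (LinearMap.range (j.restrictScalars K)) =
      Module.finrank K (𝒟.Dual K (𝒟.QP K i l')) := LinearMap.finrank_range_of_inj hj
  have hd3 : Module.finrank K (𝒟.QP K i l ⧸ 𝒟.imP K i l l') = Module.finrank K (𝒟.QP K i l') :=
    ((Submodule.quotientQuotientEquivQuotient _ _ hll).restrictScalars K).finrank_eq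
  have hd4 := Submodule.finrank_quotient_add_finrank ((𝒟.imP K i l l').restrictScalars K)
  have hd5 : ∀ (X : Type (max u w)) [AddCommGroup X] [Module K X],
      Module.finrank K (𝒟.Dual K X) = Module.finrank K X := fun X _ _ => Subspace.dual_finrank_eq
  have h : LinearMap.range (j.restrictScalars K) =
      LinearMap.ker g := by
    refine Submodule.eq_of_le_of_finrank_eq hle ?_
    rw [hd5, hd5] at hd1
    rw [hd5] at hd2
    have hd4' : Module.finrank K (𝒟.QP K i l ⧸ 𝒟.imP K i l l') +
      Module.finrank K (𝒟.imP K i l l') = Module.finrank K (𝒟.QP K i l) := hd4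
    omega
  ext x
  exact (SetLike.ext_iff.1 h) x

end Embedding

theorem IsReduced.take {ι : Type w} {𝒟 : CartanDatum ι} [Fintype ι] [DecidableEq ι] {l : List ι}
    (hl : 𝒟.IsReduced l) (k : ℕ) : 𝒟.IsReduced (l.take k) :=
  IsReduced.of_append_left 𝒟 (l := l.take k) (l' := l.drop k) (by rwa [List.take_append_drop])

/-- By maximality of k⁻, the letter i does not occur strictly between the positions k⁻ and k. If it
does not occur before k at all, then k⁻ = 0 and l' is the whole prefix. -/
theorem take_pred {ι : Type w} [DecidableEq ι] (l : List ι) {k : ℕ} {i : ι}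
    (hi : l[k - 1]? = some i) : ∃ l', l.take (k - 1) = l.take (pred l k) ++ l' ∧ i ∉ l' := by
  have hpred : pred l k ≤ k - 1 := by
    refine Finset.sup_le fun s hs => ?_
    exact (Finset.mem_Icc.1 (Finset.mem_filter.1 hs).1).2
  refine ⟨(l.take (k - 1)).drop (pred l k), ?_, fun h => ?_⟩
  · conv_lhs => rw [← List.take_append_drop (pred l k) (l.take (k - 1))]
    rw [List.take_take, min_eq_left hpred]
  · obtain ⟨m, hm⟩ := List.mem_iff_getElem?.1 h
    rw [List.getElem?_drop, List.getElem?_take] at hm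
    split_ifs at hm with hlt
    have h1 : pred l k + m + 1 ≤ pred l k := by
      refine Finset.le_sup (f := id) (Finset.mem_filter.2 ⟨Finset.mem_Icc.2 ⟨by omega, by omega⟩, ?_⟩)
      rw [Nat.add_sub_cancel, hm, hi]
    omega

end GPA.CartanDatum

namespace GPA.CartanDatum

/-! ### The embedding of V_{k⁻} into V_k and its quotient -/

variable {ι : Type w} {𝒟 : CartanDatum ι} [Fintype ι] [DecidableEq ι] {K : Type u} [Field K]
variable {V V' : Type*} [AddCommGroup V] [Module (𝒟.Alg K) V] [AddCommGroup V'] [Module (𝒟.Alg K) V']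
variable {i : ι} {l l₁ l₂ : List ι}

theorem subP_concat_le (i : ι) (l : List ι) : 𝒟.subP K i (l ++ [i]) ≤ 𝒟.subP K i l := by
  intro p hp
  have h : (p : 𝒟.Alg K) ∈ 𝒟.I K (l ++ [i]) := hp
  rw [I_append] at h
  exact Ideal.mul_le.2 (fun a ha b _ => Ideal.mul_mem_right b _ ha) h

theorem exists_embedding (h : l = l₁ ++ l₂) (hi : i ∉ l₂)
    (E : V ≃ₗ[𝒟.Alg K] 𝒟.Dual K (𝒟.QP K i (l ++ [i])))
    (E' : V' ≃ₗ[𝒟.Alg K] 𝒟.Dual K (𝒟.QP K i l₁)) :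
    ∃ j : V' →ₗ[𝒟.Alg K] V, Function.Injective j := by
  have hll : 𝒟.subP K i (l ++ [i]) ≤ 𝒟.subP K i l₁ := by
    rw [← 𝒟.subP_append (l := l₁) i hi, ← h]
    exact subP_concat_le i l
  exact ⟨E.symm.toLinearMap ∘ₗ dualHom (Submodule.factor hll) ∘ₗ E'.toLinearMap,
    E.symm.injective.comp ((dualHom_injective (Submodule.factor_surjective hll)).comp E'.injective)⟩

/-- After transport to duals, the image of any embedding is the annihilator of I_{l₁} e_i = I_l e_i
modulo I_l I_i e_i. The quotient is therefore the dual of this layer, which is I_l / I_l I_i ≅ I_l ⊗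
E_i. -/
theorem nonempty_quotient_equiv (hl : 𝒟.IsReduced (l ++ [i])) (h : l = l₁ ++ l₂) (hi : i ∉ l₂)
    (E : V ≃ₗ[𝒟.Alg K] 𝒟.Dual K (𝒟.QP K i (l ++ [i])))
    (E' : V' ≃ₗ[𝒟.Alg K] 𝒟.Dual K (𝒟.QP K i l₁)) {j : V' →ₗ[𝒟.Alg K] V}
    (hj : Function.Injective j) :
    Nonempty ((V ⧸ LinearMap.range j) ≃ₗ[𝒟.Alg K]
      𝒟.Dual K (BalancedTensor K (𝒟.Alg K) (𝒟.I K l) (𝒟.E K i))) := by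
  have := (𝒟.isExtremal_of_isReduced (K := K) i hl).finite
  have hsub : 𝒟.subP K i l = 𝒟.subP K i l₁ := by rw [h, 𝒟.subP_append i hi]
  have himP : 𝒟.imP K i (l ++ [i]) l = 𝒟.imP K i (l ++ [i]) l₁ := by rw [imP, imP, hsub]
  let j' := E.toLinearMap ∘ₗ j ∘ₗ E'.symm.toLinearMap
  have hj' : Function.Injective j' := E.injective.comp (hj.comp E'.symm.injective)
  have hr : (LinearMap.range j).map E.toLinearMap = LinearMap.range j' := by
    rw [LinearMap.range_comp, LinearMap.range_comp_of_range_eq_top j (LinearEquiv.range _)]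
  have hker := range_eq_ker_dualHom (hsub ▸ subP_concat_le i l) hj'
  exact ⟨Submodule.Quotient.equiv _ _ E hr ≪≫ₗ Submodule.quotEquivOfEq _ _ hker ≪≫ₗ
    (dualHom (K := K) (𝒟.imP K i (l ++ [i]) l₁).subtype).quotKerEquivOfSurjective
      (dualHom_surjective (Submodule.subtype_injective _)) ≪≫ₗ
    dualEquiv (𝒟.quotIEquivImP i l ≪≫ₗ LinearEquiv.ofEq _ _ himP) ≪≫ₗ
    (𝒟.dualTensorEEquiv i l).symm⟩

end GPA.CartanDatum

end

theorem mainTheorem8 {ι : Type} [Fintype ι] [DecidableEq ι] {K : Type u} [Field K]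
    (𝒟 : GPA.CartanDatum ι) (l : List ι) (hl : 𝒟.IsReduced l)
    (k : ℕ) (hk : 1 ≤ k) (i : ι) (hi : l[k - 1]? = some i) :
    -- the module `V_{i,k}` exists, namely the one on the right-hand side is one
    𝒟.IsN K (l.take k) (Pi.single i 1)
      (𝒟.Dual K (GPA.BalancedTensor K (𝒟.Alg K) (𝒟.Alg K ⧸ 𝒟.I K (l.take k)) (𝒟.P K i))) ∧
    -- `V_{i,k} ≅ ((Π / I_{s_{i_1} ⋯ s_{i_k}}) ⊗ Π e_{i_k})^*`
    (∀ (V : Type u) [AddCommGroup V] [Module (𝒟.Alg K) V],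
      𝒟.IsN K (l.take k) (Pi.single i 1) V →
      Nonempty (V ≃ₗ[𝒟.Alg K] 𝒟.Dual K
        (GPA.BalancedTensor K (𝒟.Alg K) (𝒟.Alg K ⧸ 𝒟.I K (l.take k)) (𝒟.P K i)))) ∧
    -- the module `V_{i,k⁻}` exists
    (∃ (V' : Type u) (_ : AddCommGroup V') (_ : Module (𝒟.Alg K) V'),
      𝒟.IsN K (l.take (GPA.CartanDatum.pred l k)) (Pi.single i 1) V') ∧
    -- `V_{i,k⁻}` embeds into `V_{i,k}`, and the quotient `M_{i,k}` by any embedding is isomorphic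
    -- to `(I_{s_{i_1} ⋯ s_{i_{k-1}}} ⊗ E_{i_k})^*`
    (∀ (V : Type u) [AddCommGroup V] [Module (𝒟.Alg K) V]
      (V' : Type u) [AddCommGroup V'] [Module (𝒟.Alg K) V'],
      𝒟.IsN K (l.take k) (Pi.single i 1) V →
      𝒟.IsN K (l.take (GPA.CartanDatum.pred l k)) (Pi.single i 1) V' →
      (∃ j : V' →ₗ[𝒟.Alg K] V, Function.Injective j) ∧
      ∀ j : V' →ₗ[𝒟.Alg K] V, Function.Injective j →
        Nonempty ((V ⧸ LinearMap.range j) ≃ₗ[𝒟.Alg K] 𝒟.Dual K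
          (GPA.BalancedTensor K (𝒟.Alg K) (𝒟.I K (l.take (k - 1))) (𝒟.E K i)))) ∧
    -- `(I_{s_{i_1} ⋯ s_{i_{k-1}}} ⊗ E_{i_k})^* ≅ (I_{s_{i_1} ⋯ s_{i_{k-1}}} / I_{s_{i_1} ⋯ s_{i_k}})^*`
    Nonempty (𝒟.Dual K
        (GPA.BalancedTensor K (𝒟.Alg K) (𝒟.I K (l.take (k - 1))) (𝒟.E K i)) ≃ₗ[𝒟.Alg K]
      𝒟.Dual K (𝒟.I K (l.take (k - 1)) ⧸
        (𝒟.I K (l.take k)).submoduleOf (𝒟.I K (l.take (k - 1))))) := by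
  have htake : l.take k = l.take (k - 1) ++ [i] := by
    obtain ⟨m, rfl⟩ : ∃ m, k = m + 1 := ⟨k - 1, by omega⟩
    rw [Nat.add_sub_cancel] at hi ⊢
    rw [List.take_add_one, hi]
    rfl
  obtain ⟨l', hl', hil'⟩ := GPA.CartanDatum.take_pred l hi
  have hlk := hl.take k
  have hlp := hl.take (GPA.CartanDatum.pred l k)
  refine ⟨(𝒟.isN_dual_QP i hlk).of_equiv
    (GPA.CartanDatum.dualEquiv (𝒟.tensorPEquiv K i (l.take k))), ?_,
    ⟨_, _, _, 𝒟.isN_dual_QP i hlp⟩, ?_, ?_⟩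
  · intro V _ _ hV
    obtain ⟨E⟩ := hV.nonempty_equiv_dual_QP hlk
    exact ⟨E ≪≫ₗ GPA.CartanDatum.dualEquiv (𝒟.tensorPEquiv K i (l.take k))⟩
  · intro V _ _ V' _ _ hV hV'
    obtain ⟨E⟩ := hV.nonempty_equiv_dual_QP hlk
    obtain ⟨E'⟩ := hV'.nonempty_equiv_dual_QP hlp
    rw [htake] at E hlk
    exact ⟨GPA.CartanDatum.exists_embedding hl' hil' E E', fun j hj =>
      GPA.CartanDatum.nonempty_quotient_equiv hlk hl' hil' E E' hj⟩
  · rw [htake]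
    exact ⟨𝒟.dualTensorEEquiv i (l.take (k - 1))⟩
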